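/- **Theorem 6.1 (Mixed formulation, contact).** Let $n\ge 2$, let $\Gamma=\mathbb R^{n-1}$ be the boundary of the half space $\mathbb R^n_+$, let $G\subset\Gamma$ be a bounded open set with Lipschitz boundary, $Q=\mathbb R\times G$, and let $\sigma>0$ and $\mu>0$ be constants. All distributions below are real-valued. For a distribution $u$ on $\mathbb R\times\Gamma$ such that $e^{-\sigma t}u$ is tempered, let $\hat u(\omega,\xi')$ be its Fourier–Laplace transform (formally $\iint e^{i\omega t-i\xi'\cdot x}u(t,x)\,dx\,dt$) at $\omega=\xi_0+i\sigma$, $(\xi_0,\xi')\in\mathbb R\times\mathbb R^{n-1}$. For $s,r\in\mathbb R$ define: * $H^s_\sigma(\mathbb R^+,H^r(\Gamma))$: the distributions $u$ on $\mathbb R\times\Gamma$ supported in $\{t\ge 0\}$ such that $e^{-\sigma t}u$ is tempered, $\hat u$ is a function, and $\iint|\omega|^{2s}(|\omega|^2+|\xi'|^2)^{r}|\hat u(\omega,\xi')|^2\,d\xi'\,d\xi_0<\infty$; * $H^s_\sigma(\mathbb R^+,\tilde H^r(G))$: its elements supported in $\mathbb R\times\overline G$; * $H^s_\sigma(\mathbb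 R^+,H^r(G))$: the restrictions of its elements to $Q$. A superscript $+$ denotes the subset of nonnegative distributions (on $\mathbb R\times\Gamma$, respectively on $Q$). Let $\langle\cdot,\cdot\rangle_\sigma$ be the duality between $H^{-1/2}_\sigma(\mathbb R^+,H^{-1/2}(G))$ and $H^{1/2}_\sigma(\mathbb R^+,\tilde H^{1/2}(G))$ that extends $\int e^{-2\sigma t}\int_G u\,v\,dx\,dt$. Let $\mathcal S_\sigma$ be the Dirichlet-to-Neumann operator of the wave equation (speed $1$) in the half space, $$\widehat{\mathcal S_\sigma u}(\omega,\xi')=-i\mu\sqrt{\omega^2-|\xi'|^2}\;\hat u(\omega,\xi'),\qquad \omega=\xi_0+i\sigma,\quad \operatorname{Im}\sqrt{\omega^2-|\xi'|^2}>0,$$ and let $p_Q$ be the restriction of distributions to $Q$. Let $h\in H^{3/2}_\sigma(\mathbb R^+,H^{-1/2}(G))$. Then the following two problems are equivalent. (VI) Find $u\in H^{1/2}_\sigma(\mathbb R^+,\tilde H^{1/2}(G))^+$ such that $$\langle p_Q\mathcal S_\sigma u,v-u\rangle_\sigma\ \ge\ \langle h,v-u\rangle_\sigma\qquad\text{for all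 } v\in H^{1/2}_\sigma(\mathbb R^+,\tilde H^{1/2}(G))^+ .$$ (M) Find $(u,\lambda)\in H^{1/2}_\sigma(\mathbb R^+,\tilde H^{1/2}(G))\times H^{1/2}_\sigma(\mathbb R^+,H^{-1/2}(G))^+$ such that $$\text{(a)}\ \ \langle p_Q\mathcal S_\sigma u,v\rangle_\sigma-\langle\lambda,v\rangle_\sigma=\langle h,v\rangle_\sigma,\qquad \text{(b)}\ \ \langle u,\mu'-\lambda\rangle_\sigma\ge 0$$ for all $(v,\mu')\in H^{1/2}_\sigma(\mathbb R^+,\tilde H^{1/2}(G))\times H^{1/2}_\sigma(\mathbb R^+,H^{-1/2}(G))^+$. That is, $u$ solves (VI) if and only if there is $\lambda$ such that $(u,\lambda)$ solves (M); moreover, $\lambda=p_Q\mathcal S_\sigma u-h$ for every solution $(u,\lambda)$ of (M). -/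

import Mathlib

open MeasureTheory TopologicalSpace Distribution
open scoped Distributions SchwartzMap FourierTransform ContDiff ComplexConjugate

noncomputable section

namespace WaveContact

/-- The boundary `Γ = ℝ^d` of the half space `ℝ^{d+1}_+`. -/
abbrev Bdry (d : ℕ) := EuclideanSpace ℝ (Fin d)

/-- Space-time `ℝ × Γ`. A point `z` has time `z.fst` and position `z.snd`; on the Fourier side
`z.fst` and `z.snd` are the dual variables. -/
abbrev SpaceTime (d : ℕ) := WithLp 2 (ℝ × Bdry d)

/-- `G` has Lipschitz boundary: near each of its boundary points, `G` is the set of points lying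
strictly above the graph of a Lipschitz function, in some direction `e`. -/
def HasLipschitzBoundary {d : ℕ} (G : Set (Bdry d)) : Prop :=
  ∀ x ∈ frontier G, ∃ e : Bdry d, ‖e‖ = 1 ∧ ∃ (K : NNReal) (f : Bdry d → ℝ), LipschitzWith K f ∧
    ∃ r > 0, ∀ y ∈ Metric.ball x r, y ∈ G ↔ f (y - inner ℝ e y • e) < inner ℝ e y

/-- The cylinder `Q = ℝ × G`. -/
def cylinder {d : ℕ} (G : Opens (Bdry d)) : Opens (SpaceTime d) where
  carrier := {z | z.snd ∈ G}
  is_open' := G.isOpen.preimage (WithLp.prod_continuous_ofLp 2 ℝ (Bdry d)).snd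

/-! ### Distributions on space-time -/

/-- Real distributions on the whole space-time `ℝ × Γ`. -/
abbrev Dist (d : ℕ) := 𝓓'((⊤ : Opens (SpaceTime d)), ℝ)

/-- Real distributions on the cylinder `Q = ℝ × G`. -/
abbrev DistOn {d : ℕ} (G : Opens (Bdry d)) := 𝓓'(cylinder G, ℝ)

/-- The restriction `p_Q` of distributions to `Q = ℝ × G`: precomposition with the inclusion of
the test functions on `Q` into the test functions on `ℝ × Γ`. -/
def restrict {d : ℕ} (G : Opens (Bdry d)) : Dist d →L[ℝ] DistOn G :=
  (TestFunction.monoCLM ℝ : 𝓓(cylinder G, ℝ) →L[ℝ] 𝓓((⊤ : Opens (SpaceTime d)), ℝ)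
    ).precompCompactConvergenceCLM ℝ

/-- A distribution is nonnegative if it is nonnegative on nonnegative test functions. -/
def IsNonneg {d : ℕ} {Ω : Opens (SpaceTime d)} (u : 𝓓'(Ω, ℝ)) : Prop :=
  ∀ φ : 𝓓(Ω, ℝ), (∀ z, 0 ≤ φ z) → 0 ≤ u φ

/-- `supp u ⊆ C`, for a closed set `C`: `u` vanishes on the complement of `C`. -/
def SuppIn {d : ℕ} (u : Dist d) (C : Set (SpaceTime d)) : Prop :=
  IsVanishingOn u Cᶜ

/-- The test function `e^{a t} φ`. -/
def expMul {d : ℕ} (a : ℝ) (φ : 𝓓((⊤ : Opens (SpaceTime d)), ℝ)) :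
    𝓓((⊤ : Opens (SpaceTime d)), ℝ) where
  toFun z := Real.exp (a * z.fst) * φ z
  contDiff' := by
    refine ContDiff.mul (Real.contDiff_exp.comp (contDiff_const.mul ?_)) φ.contDiff
    exact (WithLp.fstL 2 ℝ ℝ (Bdry d)).contDiff
  hasCompactSupport' := φ.hasCompactSupport.mul_left
  tsupport_subset' := fun _ _ => trivial

/-- A test function, regarded as a complex valued Schwartz function. -/
def toSchwartz {d : ℕ} (φ : 𝓓((⊤ : Opens (SpaceTime d)), ℝ)) : 𝓢(SpaceTime d, ℂ) :=
  HasCompactSupport.toSchwartzMap (f := fun z => ((φ z : ℝ) : ℂ))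
    (φ.hasCompactSupport.comp_left (g := ((↑) : ℝ → ℂ)) Complex.ofReal_zero)
    (Complex.ofRealCLM.contDiff.comp φ.contDiff)

/-! ### Fourier–Laplace transform and space-time anisotropic Sobolev spaces -/

/-- `f` is the Fourier–Laplace transform of `u`: the distribution `e^{-σ t} u` extends to a
tempered distribution `U`, and the space-time Fourier transform of `U` is the function `f`.

With Mathlib's normalization of the Fourier transform, `f z` is the transform
`∫∫ e^{i ω t - i ξ' · x} u(t, x) dx dt` at the frequencies `ω = ξ₀ + i σ`, `ξ₀ = -2π z.fst` and
`ξ' = 2π z.snd`. -/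
def IsFourierLaplace {d : ℕ} (σ : ℝ) (u : Dist d) (f : SpaceTime d → ℂ) : Prop :=
  ∃ U : 𝓢'(SpaceTime d, ℂ),
    (∀ φ : 𝓓((⊤ : Opens (SpaceTime d)), ℝ), U (toSchwartz φ) = ((u (expMul (-σ) φ) : ℝ) : ℂ)) ∧
    ∀ φ : 𝓢(SpaceTime d, ℂ), Integrable (fun z => f z * φ z) ∧ (𝓕 U) φ = ∫ z, f z * φ z

open Classical in
/-- The Fourier–Laplace transform of `u`, unique up to almost everywhere equality
(and `0` if there is none). -/
def fourierLaplace {d : ℕ} (σ : ℝ) (u : Dist d) : SpaceTime d → ℂ :=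
  if h : ∃ f, IsFourierLaplace σ u f then h.choose else 0

/-- `|ω|² = ξ₀² + σ²`. -/
def normSqOmega {d : ℕ} (σ : ℝ) (z : SpaceTime d) : ℝ :=
  (2 * Real.pi * z.fst) ^ 2 + σ ^ 2

/-- `|ξ'|²`. -/
def normSqXi {d : ℕ} (z : SpaceTime d) : ℝ :=
  (2 * Real.pi * ‖z.snd‖) ^ 2

/-- The weight `|ω|^s (|ω|² + |ξ'|²)^{r/2}`. -/
def sobolevWeight {d : ℕ} (σ s r : ℝ) (z : SpaceTime d) : ℝ :=
  normSqOmega σ z ^ (s / 2) * (normSqOmega σ z + normSqXi z) ^ (r / 2)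

/-- `u ∈ H^s_σ(ℝ⁺, H^r(Γ))`: `u` is supported in `{t ≥ 0}`, `e^{-σ t} u` is tempered and
`∫∫ |ω|^{2s} (|ω|² + |ξ'|²)^r |û(ω, ξ')|² dξ' dω < ∞`. -/
def MemH {d : ℕ} (σ s r : ℝ) (u : Dist d) : Prop :=
  SuppIn u {z | 0 ≤ z.fst} ∧
  ∃ f, IsFourierLaplace σ u f ∧ MemLp (fun z => (sobolevWeight σ s r z : ℂ) * f z) 2

/-- `u ∈ H^s_σ(ℝ⁺, H̃^r(G))`: the elements of `H^s_σ(ℝ⁺, H^r(Γ))` that are supported in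
`ℝ × closure G`. -/
def MemHTilde {d : ℕ} (σ s r : ℝ) (G : Opens (Bdry d)) (u : Dist d) : Prop :=
  MemH σ s r u ∧ SuppIn u {z | z.snd ∈ closure (G : Set (Bdry d))}

/-- `l ∈ H^s_σ(ℝ⁺, H^r(G))`: the restrictions to `Q = ℝ × G` of the elements of
`H^s_σ(ℝ⁺, H^r(Γ))`, i.e. the quotient of that space by the subspace of elements supported in
`ℝ × (Γ ∖ G)`. -/
def MemHRestr {d : ℕ} (σ s r : ℝ) (G : Opens (Bdry d)) (l : DistOn G) : Prop :=
  ∃ L : Dist d, MemH σ s r L ∧ restrict G L = l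

open Classical in
/-- The duality `⟨l, v⟩_σ` between `H^{-1/2}_σ(ℝ⁺, H^{-1/2}(G))` and `H^{1/2}_σ(ℝ⁺, H̃^{1/2}(G))`
that extends `∫∫ e^{-2σt} l v dx dt`. It is computed by Plancherel's formula from any extension
`L` of `l`; for Lipschitz `G` it does not depend on the choice of `L`. -/
def pairing {d : ℕ} (σ : ℝ) (G : Opens (Bdry d)) (l : DistOn G) (v : Dist d) : ℝ :=
  if h : ∃ L : Dist d, MemH σ (-1 / 2) (-1 / 2) L ∧ restrict G L = l then
    (∫ z, fourierLaplace σ h.choose z * conj (fourierLaplace σ v z)).re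
  else 0

/-! ### The Dirichlet-to-Neumann operator of the half space -/

/-- The symbol of the Dirichlet-to-Neumann operator, `μ √(|ξ'|² - ω²)` with the root of positive
real part. It equals `-i μ √(ω² - |ξ'|²)` for the root with `√(ω² - |ξ'|²) ≈ ω` for
`|ω| ≫ |ξ'|`. Here `-ω² = (σ + 2π i z.fst)²`. -/
def dtnSymbol {d : ℕ} (σ μ : ℝ) (z : SpaceTime d) : ℂ :=
  μ * (((σ : ℂ) + 2 * Real.pi * z.fst * Complex.I) ^ 2 + (normSqXi z : ℂ)) ^ (1 / 2 : ℂ)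

open Classical in
/-- The Dirichlet-to-Neumann operator `𝒮_σ`: the distribution whose Fourier–Laplace transform is
the symbol times that of `u`. -/
def dtn {d : ℕ} (σ μ : ℝ) (u : Dist d) : Dist d :=
  if h : ∃ w : Dist d, IsFourierLaplace σ w (fun z => dtnSymbol σ μ z * fourierLaplace σ u z) then
    h.choose
  else 0

/-! ### The two formulations of the contact problem -/

/-- `u` solves the variational inequality: `u ∈ H^{1/2}_σ(ℝ⁺, H̃^{1/2}(G))⁺` and
`⟨p_Q 𝒮_σ u, v - u⟩_σ ≥ ⟨h, v - u⟩_σ` for all `v` in `H^{1/2}_σ(ℝ⁺, H̃^{1/2}(G))⁺`. -/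
structure SolvesVI {d : ℕ} (σ μ : ℝ) (G : Opens (Bdry d)) (h : DistOn G) (u : Dist d) : Prop where
  mem : MemHTilde σ (1 / 2) (1 / 2) G u
  nonneg : IsNonneg u
  ineq : ∀ v : Dist d, MemHTilde σ (1 / 2) (1 / 2) G v → IsNonneg v →
    pairing σ G h (v - u) ≤ pairing σ G (restrict G (dtn σ μ u)) (v - u)

/-- `(u, l)` solves the mixed formulation: `u ∈ H^{1/2}_σ(ℝ⁺, H̃^{1/2}(G))`,
`l ∈ H^{1/2}_σ(ℝ⁺, H^{-1/2}(G))⁺`, and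
(a) `⟨p_Q 𝒮_σ u, v⟩_σ - ⟨l, v⟩_σ = ⟨h, v⟩_σ` for all `v ∈ H^{1/2}_σ(ℝ⁺, H̃^{1/2}(G))`,
(b) `⟨u, m - l⟩_σ ≥ 0` for all `m ∈ H^{1/2}_σ(ℝ⁺, H^{-1/2}(G))⁺`. -/
structure SolvesMixed {d : ℕ} (σ μ : ℝ) (G : Opens (Bdry d)) (h : DistOn G) (u : Dist d)
    (l : DistOn G) : Prop where
  mem_fst : MemHTilde σ (1 / 2) (1 / 2) G u
  mem_snd : MemHRestr σ (1 / 2) (-1 / 2) G l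
  nonneg_snd : IsNonneg l
  eq : ∀ v : Dist d, MemHTilde σ (1 / 2) (1 / 2) G v →
    pairing σ G (restrict G (dtn σ μ u)) v - pairing σ G l v = pairing σ G h v
  ineq : ∀ m : DistOn G, MemHRestr σ (1 / 2) (-1 / 2) G m → IsNonneg m →
    0 ≤ pairing σ G (m - l) u

end WaveContact

end

open MeasureTheory TopologicalSpace Distribution
open scoped Distributions SchwartzMap FourierTransform ContDiff ComplexConjugate

noncomputable section

namespace WaveContact

open Filter Topology
open scoped LineDeriv Manifold Pointwise

variable {d : ℕ}

/-! The equivalence is convex duality for a cone. Put λ = p_Q 𝒮_σ u - h. Since the nonnegative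
elements form a convex cone, the inequality ⟨λ, v - u⟩ ≥ 0 for all v ≥ 0 says that λ lies in the
dual cone and that ⟨λ, u⟩ = 0 (take v = 2u and v = 0). Condition (b) expresses the same
complementarity from the side of λ: m = 2λ and m = 0 give ⟨u, λ⟩ = 0, and m = λ + η with test
functions η ≥ 0 gives u ≥ 0. Condition (a) identifies λ with the residual. What needs proof is that
the dual cone consists of the nonnegative distributions, and that the residual lies in the right
space.

Nonnegative distributions lie in the dual cone, and the pairing does not depend on the chosen
extension, because test functions on Q approximate v weakly, with signs preserved
(`re_integral_conj_mem`). As û is square integrable, e^{-σt} v is a genuine function. It is cut off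
by a dilated bump, split by a partition of unity, translated into Q across the Lipschitz boundary,
and mollified. Translation and mollification are multipliers bounded by 1 that tend to 1 pointwise.
The large cutoff is controlled by the cross correlation of the two transforms, which by Peetre's
inequality is continuous at 0 and grows at most linearly (`tendsto_crossCorr`). Thus no
multiplication theorem in the fractional spaces is needed.

In the converse direction only test functions supported in t ≥ 0 are admissible. Elements of
H^{1/2}_σ(ℝ⁺, H^{-1/2}) are determined by their values on test functions in t > 0, since the spatial
Helmholtz operator absorbs the negative spatial order and commutes with cutoffs in time
(`exists_tendsto_of_memH`).

Finally, 𝒮_σ maps H^{1/2}(H^{1/2}) into H^{1/2}(H^{-1/2}) (`dtn_spec`). The order is read off from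
the symbol. For the support in t ≥ 0, with p = σ - iξ₀ and k = |ξ'|, the root √(p² + k²) is π⁻¹(p² +
k²) times (π/(p + ik))^{1/2} (π/(p - ik))^{1/2}. The polynomial is a differential operator, and each
remaining factor is the Gaussian integral ∫ exp(-(p ± ik) x²) dx, a superposition of delays x²
(`IsCausal.dtnSymbol_mul`). -/

/-! ### Density of compactly supported functions in the Schwartz space -/

/-- Compactly supported smooth functions are dense in the Schwartz space. -/
theorem dense_hasCompactSupport_schwartz {E F : Type*} [NormedAddCommGroup E]
    [InnerProductSpace ℝ E] [FiniteDimensional ℝ E] [NormedAddCommGroup F] [NormedSpace ℝ F] :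
    Dense {φ : 𝓢(E, F) | HasCompactSupport φ} := by
  intro φ
  set χ : ContDiffBump (0 : E) := ⟨1, 2, one_pos, one_lt_two⟩
  have hscale : ∀ R : ℝ, ContDiff ℝ ∞ (fun x : E => 1 - χ (R⁻¹ • x)) := fun R =>
    contDiff_const.sub (χ.contDiff.comp (contDiff_const_smul _))
  have hcs : ∀ n : ℕ, HasCompactSupport (fun x : E => χ (((n : ℝ) + 1)⁻¹ • x) • φ x) := fun n =>
    (χ.hasCompactSupport.comp_smul (by positivity)).smul_right
  let φs : ℕ → 𝓢(E, F) := fun n => (hcs n).toSchwartzMap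
    ((χ.contDiff.comp (contDiff_const_smul _)).smul (φ.smooth ⊤))
  -- uniform bounds for the derivatives of the complementary cutoff
  have hbd : ∀ i : ℕ, ∃ C : ℝ, 0 ≤ C ∧ ∀ (n : ℕ) (x : E),
      ‖iteratedFDeriv ℝ i (fun x : E => 1 - χ (((n : ℝ) + 1)⁻¹ • x)) x‖ ≤ C := by
    intro i
    obtain ⟨C, hC⟩ : ∃ C : ℝ, ∀ x : E, ‖iteratedFDeriv ℝ i (fun x : E => 1 - χ x) x‖ ≤ C := by
      let χS : 𝓢(E, ℝ) := χ.hasCompactSupport.toSchwartzMap χ.contDiff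
      refine ⟨1 + SchwartzMap.seminorm ℝ 0 i χS, fun x => ?_⟩
      have h1 : iteratedFDeriv ℝ i (fun x : E => 1 - χ x) x
          = iteratedFDeriv ℝ i (fun _ : E => (1 : ℝ)) x - iteratedFDeriv ℝ i χS x :=
        iteratedFDeriv_sub_apply (contDiffAt_const) ((χS.smooth i).contDiffAt)
      rw [h1]
      refine (norm_sub_le _ _).trans (add_le_add ?_ (χS.norm_iteratedFDeriv_le_seminorm ℝ i x))
      rcases Nat.eq_zero_or_pos i with rfl | hi
      · simp
      · rw [iteratedFDeriv_const_of_ne hi.ne']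
        simp
    refine ⟨C, (norm_nonneg _).trans (hC 0), fun n x => ?_⟩
    set L : E →L[ℝ] E := (((n : ℝ) + 1)⁻¹) • ContinuousLinearMap.id ℝ E
    -- The dilation contracts, so the chain rule does not increase derivatives and the bound is
    -- uniform in `n`.
    have hL : ‖L‖ ≤ 1 := by
      refine ContinuousLinearMap.opNorm_le_bound _ zero_le_one fun x => ?_
      simp only [L, smul_apply, ContinuousLinearMap.id_apply, norm_smul]
      gcongr
      rw [Real.norm_of_nonneg (by positivity)]
      exact inv_le_one_of_one_le₀ (by linarith [(Nat.cast_nonneg n : (0 : ℝ) ≤ n)])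
    have h2 := L.iteratedFDeriv_comp_right (n := ∞) (f := fun x : E => 1 - χ x)
      (contDiff_const.sub χ.contDiff) x (i := i) (mod_cast le_top)
    change ‖iteratedFDeriv ℝ i ((fun x : E => 1 - χ x) ∘ L) x‖ ≤ C
    rw [h2]
    refine (ContinuousMultilinearMap.norm_compContinuousLinearMap_le _ _).trans ?_
    refine (mul_le_of_le_one_right (norm_nonneg _) ?_).trans (hC _)
    exact Finset.prod_le_one (fun _ _ => norm_nonneg _) fun _ _ => hL
  choose C hC0 hC using hbd
  have hlim : Tendsto φs atTop (𝓝 φ) := by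
    rw [(schwartz_withSeminorms ℝ E F).tendsto_nhds_atTop]
    rintro ⟨k, m⟩ ε hε
    -- The error lives where ‖x‖ ≥ n + 1, so one extra power of ‖x‖ buys the factor 1/(n + 1). This
    -- is why seminorms of index `k + 1` appear.
    set M : ℝ := ∑ i ∈ Finset.range (m + 1), (m.choose i : ℝ) * C i *
      SchwartzMap.seminorm ℝ (k + 1) (m - i) φ
    have hM : 0 ≤ M := Finset.sum_nonneg fun i _ =>
      mul_nonneg (mul_nonneg (by positivity) (hC0 i)) (apply_nonneg _ _)
    obtain ⟨N, hN⟩ := exists_nat_gt (M / ε)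
    refine ⟨N, fun n hn => ?_⟩
    have hn1 : (0 : ℝ) < n + 1 := by positivity
    refine lt_of_le_of_lt (b := M / (n + 1)) ?_ ?_
    · refine SchwartzMap.seminorm_le_bound ℝ k m _ (by positivity) fun x => ?_
      have hneg : (⇑(φs n - φ) : E → F) = fun y => -((1 - χ (((n : ℝ) + 1)⁻¹ • y)) • φ y) := by
        ext y
        simp only [φs, sub_apply, HasCompactSupport.toSchwartzMap_toFun,
          sub_smul, one_smul, neg_sub]
      rw [hneg, show (fun y => -((1 - χ (((n : ℝ) + 1)⁻¹ • y)) • φ y))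
        = -(fun y => (1 - χ (((n : ℝ) + 1)⁻¹ • y)) • φ y) from rfl, iteratedFDeriv_neg_apply,
        norm_neg]
      rcases lt_or_ge ‖x‖ (n + 1) with hx | hx
      · have : (fun y => (1 - χ (((n : ℝ) + 1)⁻¹ • y)) • φ y) =ᶠ[𝓝 x] fun _ => 0 := by
          filter_upwards [(isOpen_lt continuous_norm continuous_const).mem_nhds hx] with y hy
          rw [χ.one_of_mem_closedBall, sub_self, zero_smul]
          simp only [mem_closedBall_zero_iff, norm_smul, norm_inv, Real.norm_of_nonneg hn1.le]
          rw [inv_mul_le_iff₀ hn1]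
          simpa [χ] using (le_of_lt hy)
        rw [(this.iteratedFDeriv ℝ m).eq_of_nhds]
        have : iteratedFDeriv ℝ m (fun _ : E => (0 : F)) x = 0 := by
          rw [show (fun _ : E => (0 : F)) = 0 from rfl, iteratedFDeriv_zero]; rfl
        rw [this, norm_zero, mul_zero]
        positivity
      · rw [le_div_iff₀ hn1]
        have h3 := norm_iteratedFDeriv_smul_le (𝕜 := ℝ) (N := ∞) (hscale ((n : ℝ) + 1))
          (φ.smooth ⊤) x (n := m) (mod_cast le_top)
        calc ‖x‖ ^ k * ‖iteratedFDeriv ℝ m (fun y => (1 - χ (((n : ℝ) + 1)⁻¹ • y)) • φ y) x‖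
              * (n + 1)
            ≤ ‖x‖ ^ k * (∑ i ∈ Finset.range (m + 1), (m.choose i : ℝ) *
              ‖iteratedFDeriv ℝ i (fun x : E => 1 - χ (((n : ℝ) + 1)⁻¹ • x)) x‖ *
              ‖iteratedFDeriv ℝ (m - i) φ x‖) * ‖x‖ := by gcongr
          _ = ∑ i ∈ Finset.range (m + 1), (m.choose i : ℝ) *
              ‖iteratedFDeriv ℝ i (fun x : E => 1 - χ (((n : ℝ) + 1)⁻¹ • x)) x‖ *
              (‖x‖ ^ (k + 1) * ‖iteratedFDeriv ℝ (m - i) φ x‖) := by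
            rw [Finset.mul_sum, Finset.sum_mul]
            exact Finset.sum_congr rfl fun i _ => by ring
          _ ≤ M := by
            refine Finset.sum_le_sum fun i _ => ?_
            have := hC0 i
            gcongr
            · exact hC i n x
            · exact φ.le_seminorm ℝ (k + 1) (m - i) x
    · rw [div_lt_iff₀ hn1]
      rw [div_lt_iff₀ hε] at hN
      have : (N : ℝ) ≤ n := by exact_mod_cast hn
      nlinarith
  exact mem_closure_of_tendsto hlim (Eventually.of_forall fun n => hcs n)

/-- Real test functions on space-time. -/
abbrev Test (d : ℕ) := 𝓓((⊤ : Opens (SpaceTime d)), ℝ)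

/-! ### Test functions inside the Schwartz space -/

/-- A smooth compactly supported function as a test function. -/
def mkTest (f : SpaceTime d → ℝ) (hf : ContDiff ℝ ∞ f) (hc : HasCompactSupport f) : Test d :=
  ⟨f, hf, hc, fun _ _ => trivial⟩

@[simp]
theorem mkTest_apply (f : SpaceTime d → ℝ) (hf : ContDiff ℝ ∞ f) (hc : HasCompactSupport f)
    (z : SpaceTime d) : mkTest f hf hc z = f z := rfl

@[simp]
theorem toSchwartz_apply (φ : Test d) (z : SpaceTime d) : toSchwartz φ z = (φ z : ℂ) := rfl

@[simp]
theorem expMul_apply (a : ℝ) (φ : Test d) (z : SpaceTime d) :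
    expMul a φ z = Real.exp (a * z.fst) * φ z := rfl

theorem expMul_expMul (a b : ℝ) (φ : Test d) : expMul a (expMul b φ) = expMul (a + b) φ := by
  ext z
  simp [← mul_assoc, ← Real.exp_add, add_mul]

theorem expMul_zero (φ : Test d) : expMul 0 φ = φ := by
  ext z
  simp

theorem expMul_neg_expMul (a : ℝ) (φ : Test d) : expMul (-a) (expMul a φ) = φ := by
  rw [expMul_expMul, neg_add_cancel, expMul_zero]

theorem tsupport_expMul (a : ℝ) (φ : Test d) : tsupport (expMul a φ) = tsupport φ := by
  unfold tsupport
  congr 1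
  ext z
  simp [Real.exp_ne_zero]

theorem expMul_add (a : ℝ) (φ ψ : Test d) : expMul a (φ + ψ) = expMul a φ + expMul a ψ := by
  ext z
  simp [mul_add]

theorem expMul_smul (a c : ℝ) (φ : Test d) : expMul a (c • φ) = c • expMul a φ := by
  ext z
  simp [mul_left_comm]

theorem expMul_nonneg {a : ℝ} {φ : Test d} (h : ∀ z, 0 ≤ φ z) (z : SpaceTime d) :
    0 ≤ expMul a φ z :=
  mul_nonneg (Real.exp_pos _).le (h z)

theorem toSchwartz_add (φ ψ : Test d) : toSchwartz (φ + ψ) = toSchwartz φ + toSchwartz ψ := by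
  ext z
  simp

theorem toSchwartz_smul (c : ℝ) (φ : Test d) : toSchwartz (c • φ) = (c : ℂ) • toSchwartz φ := by
  ext z
  simp

/-- Complex test functions are combinations of real test functions. -/
theorem exists_eq_toSchwartz_add (φ : 𝓢(SpaceTime d, ℂ)) (h : HasCompactSupport φ) :
    ∃ a b : Test d, φ = toSchwartz a + Complex.I • toSchwartz b ∧
      tsupport a ⊆ tsupport φ ∧ tsupport b ⊆ tsupport φ := by
  have hre : ContDiff ℝ ∞ fun z => (φ z).re := Complex.reCLM.contDiff.comp (φ.smooth ⊤)
  have him : ContDiff ℝ ∞ fun z => (φ z).im := Complex.imCLM.contDiff.comp (φ.smooth ⊤)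
  have hre' : HasCompactSupport fun z => (φ z).re := h.comp_left (g := Complex.re) rfl
  have him' : HasCompactSupport fun z => (φ z).im := h.comp_left (g := Complex.im) rfl
  refine ⟨mkTest _ hre hre', mkTest _ him him', ?_,
    tsupport_comp_subset (g := Complex.re) rfl φ, tsupport_comp_subset (g := Complex.im) rfl φ⟩
  ext z
  simp [mul_comm Complex.I, Complex.re_add_im]

/-- Two tempered distributions that agree on test functions are equal. -/
theorem tempered_ext {U V : 𝓢'(SpaceTime d, ℂ)}
    (h : ∀ φ : Test d, U (toSchwartz φ) = V (toSchwartz φ)) : U = V := by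
  ext φ
  have hcl : IsClosed {φ : 𝓢(SpaceTime d, ℂ) | U φ = V φ} :=
    isClosed_eq U.continuous V.continuous
  refine hcl.closure_subset_iff.2 ?_ (dense_hasCompactSupport_schwartz φ)
  intro φ hφ
  obtain ⟨a, b, rfl, -, -⟩ := exists_eq_toSchwartz_add φ hφ
  simp [h]

/-! ### Functions that define tempered distributions -/

/-- `f` defines a tempered distribution by integration. -/
def IsTempered (f : SpaceTime d → ℂ) : Prop :=
  ∃ W : 𝓢'(SpaceTime d, ℂ), ∀ φ : 𝓢(SpaceTime d, ℂ),
    Integrable (fun z => f z * φ z) ∧ W φ = ∫ z, f z * φ z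

theorem IsTempered.integrable {f : SpaceTime d → ℂ} (hf : IsTempered f)
    (φ : 𝓢(SpaceTime d, ℂ)) : Integrable (fun z => f z * φ z) :=
  (hf.choose_spec φ).1

theorem IsTempered.sub {f g : SpaceTime d → ℂ} (hf : IsTempered f) (hg : IsTempered g) :
    IsTempered (f - g) := by
  obtain ⟨W, hW⟩ := hf
  obtain ⟨X, hX⟩ := hg
  refine ⟨W - X, fun φ => ?_⟩
  simp only [Pi.sub_apply, sub_mul]
  refine ⟨(hW φ).1.sub (hX φ).1, ?_⟩
  rw [integral_sub (hW φ).1 (hX φ).1, ← (hW φ).2, ← (hX φ).2]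
  rfl

theorem IsTempered.add {f g : SpaceTime d → ℂ} (hf : IsTempered f) (hg : IsTempered g) :
    IsTempered (f + g) := by
  obtain ⟨W, hW⟩ := hf
  obtain ⟨X, hX⟩ := hg
  refine ⟨W + X, fun φ => ?_⟩
  simp only [Pi.add_apply, add_mul]
  refine ⟨(hW φ).1.add (hX φ).1, ?_⟩
  rw [integral_add (hW φ).1 (hX φ).1, ← (hW φ).2, ← (hX φ).2]
  rfl

theorem IsTempered.const_mul {f : SpaceTime d → ℂ} (hf : IsTempered f) (c : ℂ) :
    IsTempered (fun z => c * f z) := by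
  obtain ⟨W, hW⟩ := hf
  refine ⟨c • W, fun φ => ?_⟩
  simp only [mul_assoc]
  refine ⟨(hW φ).1.const_mul c, ?_⟩
  rw [integral_const_mul, ← (hW φ).2]
  rfl

theorem IsTempered.locallyIntegrable {f : SpaceTime d → ℂ} (hf : IsTempered f) :
    LocallyIntegrable f := by
  rw [locallyIntegrable_iff]
  intro K hK
  obtain ⟨R, hR, hKR⟩ := hK.isBounded.subset_closedBall_lt 0 (0 : SpaceTime d)
  let χ : ContDiffBump (0 : SpaceTime d) := ⟨R, R + 1, hR, lt_add_one R⟩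
  have h := (hf.integrable (toSchwartz (mkTest χ χ.contDiff χ.hasCompactSupport))).integrableOn
    (s := K)
  refine h.congr_fun_ae ?_
  filter_upwards [ae_restrict_mem hK.measurableSet] with z hz
  simp [χ.one_of_mem_closedBall (hKR hz)]

/-- A tempered function is determined almost everywhere by its integrals against test functions. -/
theorem ae_eq_of_integral_toSchwartz {f g : SpaceTime d → ℂ} (hf : LocallyIntegrable f)
    (hg : LocallyIntegrable g)
    (h : ∀ φ : Test d, ∫ z, f z * toSchwartz φ z = ∫ z, g z * toSchwartz φ z) :
    f =ᵐ[volume] g := by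
  refine ae_eq_of_integral_contDiff_smul_eq hf hg fun φ hφ hc => ?_
  have := h (mkTest φ hφ hc)
  simp only [toSchwartz_apply, mkTest_apply] at this
  simpa only [Complex.real_smul, mul_comm] using this

/-! ### The Fourier–Laplace transform -/

/-- Fourier inversion moves the transform onto the test function and so eliminates the tempered
extension `U`. All later work uses this form. -/
theorem isFourierLaplace_iff {σ : ℝ} {u : Dist d} {f : SpaceTime d → ℂ} :
    IsFourierLaplace σ u f ↔ IsTempered f ∧
      ∀ φ : Test d, ∫ z, f z * (𝓕⁻ (toSchwartz φ)) z = ((u (expMul (-σ) φ) : ℝ) : ℂ) := by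
  constructor
  · rintro ⟨U, hU, hf⟩
    refine ⟨⟨𝓕 U, hf⟩, fun φ => ?_⟩
    rw [← hU, ← (hf _).2, TemperedDistribution.fourier_apply, FourierTransform.fourier_fourierInv_eq]
  · rintro ⟨⟨W, hW⟩, h⟩
    refine ⟨𝓕⁻ W, fun φ => ?_, fun φ => ?_⟩
    · rw [TemperedDistribution.fourierInv_apply, (hW _).2, h]
    · rw [FourierTransform.fourier_fourierInv_eq]
      exact hW φ

theorem IsFourierLaplace.isTempered {σ : ℝ} {u : Dist d} {f : SpaceTime d → ℂ}
    (h : IsFourierLaplace σ u f) : IsTempered f :=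
  (isFourierLaplace_iff.1 h).1

theorem IsFourierLaplace.integral_eq {σ : ℝ} {u : Dist d} {f : SpaceTime d → ℂ}
    (h : IsFourierLaplace σ u f) (φ : Test d) :
    ∫ z, f z * (𝓕⁻ (toSchwartz φ)) z = ((u (expMul (-σ) φ) : ℝ) : ℂ) :=
  (isFourierLaplace_iff.1 h).2 φ

theorem IsFourierLaplace.integral_expMul {σ : ℝ} {u : Dist d} {f : SpaceTime d → ℂ}
    (h : IsFourierLaplace σ u f) (φ : Test d) :
    ∫ z, f z * (𝓕⁻ (toSchwartz (expMul σ φ))) z = ((u φ : ℝ) : ℂ) := by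
  rw [h.integral_eq, expMul_neg_expMul]

theorem IsFourierLaplace.ae_unique {σ : ℝ} {u : Dist d} {f g : SpaceTime d → ℂ}
    (hf : IsFourierLaplace σ u f) (hg : IsFourierLaplace σ u g) : f =ᵐ[volume] g := by
  refine ae_eq_of_integral_toSchwartz hf.isTempered.locallyIntegrable
    hg.isTempered.locallyIntegrable fun φ => ?_
  obtain ⟨U, hU, hUf⟩ := hf
  obtain ⟨V, hV, hVg⟩ := hg
  rw [← (hUf _).2, ← (hVg _).2, tempered_ext fun φ => (hU φ).trans (hV φ).symm]

theorem IsTempered.congr_ae {f g : SpaceTime d → ℂ} (h : IsTempered f) (hfg : f =ᵐ[volume] g) :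
    IsTempered g := by
  obtain ⟨W, hW⟩ := h
  have hae : ∀ φ : 𝓢(SpaceTime d, ℂ),
      (fun z => f z * φ z) =ᵐ[volume] fun z => g z * φ z := fun φ => by
    filter_upwards [hfg] with z hz
    rw [hz]
  exact ⟨W, fun φ => ⟨(hW φ).1.congr (hae φ), (hW φ).2.trans (integral_congr_ae (hae φ))⟩⟩

theorem IsFourierLaplace.congr_ae {σ : ℝ} {u : Dist d} {f g : SpaceTime d → ℂ}
    (h : IsFourierLaplace σ u f) (hfg : f =ᵐ[volume] g) : IsFourierLaplace σ u g := by
  rw [isFourierLaplace_iff] at h ⊢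
  refine ⟨h.1.congr_ae hfg, fun φ => ?_⟩
  rw [← h.2 φ]
  refine integral_congr_ae ?_
  filter_upwards [hfg] with z hz
  rw [hz]

theorem fourierLaplace_spec {σ : ℝ} {u : Dist d} {f : SpaceTime d → ℂ}
    (h : IsFourierLaplace σ u f) : IsFourierLaplace σ u (fourierLaplace σ u) := by
  have hex : ∃ f, IsFourierLaplace σ u f := ⟨f, h⟩
  rw [fourierLaplace, dif_pos hex]
  exact hex.choose_spec

theorem IsFourierLaplace.fourierLaplace_ae_eq {σ : ℝ} {u : Dist d} {f : SpaceTime d → ℂ}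
    (h : IsFourierLaplace σ u f) : fourierLaplace σ u =ᵐ[volume] f :=
  (fourierLaplace_spec h).ae_unique h

theorem IsFourierLaplace.sub {σ : ℝ} {u v : Dist d} {f g : SpaceTime d → ℂ}
    (hu : IsFourierLaplace σ u f) (hv : IsFourierLaplace σ v g) :
    IsFourierLaplace σ (u - v) (f - g) := by
  refine isFourierLaplace_iff.2 ⟨hu.isTempered.sub hv.isTempered, fun φ => ?_⟩
  simp only [Pi.sub_apply, sub_mul]
  rw [integral_sub (hu.isTempered.integrable _) (hv.isTempered.integrable _), hu.integral_eq,
    hv.integral_eq]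
  simp

theorem IsFourierLaplace.add {σ : ℝ} {u v : Dist d} {f g : SpaceTime d → ℂ}
    (hu : IsFourierLaplace σ u f) (hv : IsFourierLaplace σ v g) :
    IsFourierLaplace σ (u + v) (f + g) := by
  refine isFourierLaplace_iff.2 ⟨hu.isTempered.add hv.isTempered, fun φ => ?_⟩
  simp only [Pi.add_apply, add_mul]
  rw [integral_add (hu.isTempered.integrable _) (hv.isTempered.integrable _), hu.integral_eq,
    hv.integral_eq]
  simp

theorem IsFourierLaplace.smul {σ : ℝ} {u : Dist d} {f : SpaceTime d → ℂ}
    (hu : IsFourierLaplace σ u f) (c : ℝ) :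
    IsFourierLaplace σ (c • u) (fun z => (c : ℂ) * f z) := by
  refine isFourierLaplace_iff.2 ⟨hu.isTempered.const_mul _, fun φ => ?_⟩
  simp only [mul_assoc]
  rw [integral_const_mul, hu.integral_eq]
  simp

/-! ### Conjugation symmetry -/

/-- Complex conjugation on the Schwartz space. -/
def conjSchwartz : 𝓢(SpaceTime d, ℂ) →L[ℝ] 𝓢(SpaceTime d, ℂ) :=
  SchwartzMap.postcompCLM (Complex.conjCLE : ℂ →L[ℝ] ℂ)

@[simp]
theorem conjSchwartz_apply (φ : 𝓢(SpaceTime d, ℂ)) (z : SpaceTime d) :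
    conjSchwartz φ z = conj (φ z) := rfl

theorem conj_fourier (f : SpaceTime d → ℂ) (z : SpaceTime d) :
    conj ((𝓕 f) z) = (𝓕⁻ fun x => conj (f x)) z := by
  rw [Real.fourier_eq', Real.fourierInv_eq', ← integral_conj]
  congr 1
  ext x
  rw [smul_eq_mul, smul_eq_mul, map_mul, ← Complex.exp_conj, map_mul, Complex.conj_ofReal,
    Complex.conj_I]
  congr 2
  push_cast
  ring

theorem conj_fourier_toSchwartz (φ : Test d) (z : SpaceTime d) :
    conj ((𝓕 (toSchwartz φ)) z) = (𝓕⁻ (toSchwartz φ)) z := by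
  rw [SchwartzMap.fourier_coe, conj_fourier, SchwartzMap.fourierInv_coe]
  simp only [toSchwartz_apply, Complex.conj_ofReal]
  rfl

theorem conj_fourierInv_toSchwartz (φ : Test d) (z : SpaceTime d) :
    conj ((𝓕⁻ (toSchwartz φ)) z) = (𝓕 (toSchwartz φ)) z := by
  rw [← conj_fourier_toSchwartz, Complex.conj_conj]

/-- Both sides are continuous in `ψ` and agree on combinations a + ib of real test functions, which
are dense. -/
theorem tempered_conj {U : 𝓢'(SpaceTime d, ℂ)} {r : Test d → ℝ}
    (h : ∀ φ : Test d, U (toSchwartz φ) = (r φ : ℂ)) (ψ : 𝓢(SpaceTime d, ℂ)) :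
    U (conjSchwartz ψ) = conj (U ψ) := by
  have hcl : IsClosed {φ : 𝓢(SpaceTime d, ℂ) | U (conjSchwartz φ) = conj (U φ)} :=
    isClosed_eq (U.continuous.comp conjSchwartz.continuous)
      (Complex.continuous_conj.comp U.continuous)
  refine hcl.closure_subset_iff.2 ?_ (dense_hasCompactSupport_schwartz ψ)
  intro φ hφ
  obtain ⟨a, b, rfl, -, -⟩ := exists_eq_toSchwartz_add φ hφ
  have h1 : conjSchwartz (toSchwartz a + Complex.I • toSchwartz b)
      = toSchwartz a - Complex.I • toSchwartz b := by
    ext z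
    simp [sub_eq_add_neg]
  simp only [Set.mem_ofPred_eq, h1, map_sub, map_add, map_smul, h, smul_eq_mul, map_mul,
    Complex.conj_I, Complex.conj_ofReal]
  ring

/-- The transform of a real distribution is conjugation symmetric. -/
theorem IsFourierLaplace.neg_ae_eq {σ : ℝ} {u : Dist d} {f : SpaceTime d → ℂ}
    (h : IsFourierLaplace σ u f) : (fun z => conj (f (-z))) =ᵐ[volume] f := by
  have hloc := h.isTempered.locallyIntegrable
  obtain ⟨U, hU, hf⟩ := h
  have hmp : MeasurePreserving (fun z : SpaceTime d => -z) volume volume :=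
    Measure.measurePreserving_neg volume
  have hme : MeasurableEmbedding (fun z : SpaceTime d => -z) := (Homeomorph.neg _).measurableEmbedding
  refine ae_eq_of_integral_toSchwartz ?_ hloc fun φ => ?_
  · rw [locallyIntegrable_iff] at hloc ⊢
    intro K hK
    have h1 : IntegrableOn (fun z => f (-z)) K := by
      have := (hmp.integrableOn_comp_preimage hme (f := f) (s := -K)).2 (hloc (-K) hK.neg)
      simpa [Function.comp_def] using this
    exact (Complex.conjCLE : ℂ →L[ℝ] ℂ).integrable_comp h1
  · have hd : ContDiff ℝ ∞ fun z => φ (-z) := φ.contDiff.comp contDiff_neg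
    have hs : HasCompactSupport fun z => φ (-z) :=
      φ.hasCompactSupport.comp_homeomorph (Homeomorph.neg _)
    set φ' : Test d := mkTest _ hd hs
    have h1 : ∫ z, conj (f (-z)) * toSchwartz φ z = conj (∫ z, f z * toSchwartz φ' z) := by
      rw [← integral_conj, ← hmp.integral_comp hme]
      simp only [neg_neg, map_mul, toSchwartz_apply, Complex.conj_ofReal, φ', mkTest_apply]
    rw [h1, ← (hf _).2, ← (hf _).2, TemperedDistribution.fourier_apply,
      TemperedDistribution.fourier_apply, ← tempered_conj hU]
    congr 1
    ext z
    rw [conjSchwartz_apply, conj_fourier_toSchwartz, SchwartzMap.fourierInv_coe,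
      SchwartzMap.fourier_coe, Real.fourierInv_eq_fourier_comp_neg]
    simp only [toSchwartz_apply, φ', mkTest_apply, neg_neg]
    rfl

/-! ### The Sobolev weights -/

theorem normSqOmega_ge (σ : ℝ) (z : SpaceTime d) : σ ^ 2 ≤ normSqOmega σ z :=
  le_add_of_nonneg_left (sq_nonneg _)

theorem normSqOmega_pos {σ : ℝ} (hσ : 0 < σ) (z : SpaceTime d) : 0 < normSqOmega σ z :=
  (by positivity : 0 < σ ^ 2).trans_le (normSqOmega_ge σ z)

theorem normSqXi_nonneg (z : SpaceTime d) : 0 ≤ normSqXi z := sq_nonneg _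

theorem normSqSum_pos {σ : ℝ} (hσ : 0 < σ) (z : SpaceTime d) :
    0 < normSqOmega σ z + normSqXi z :=
  add_pos_of_pos_of_nonneg (normSqOmega_pos hσ z) (normSqXi_nonneg z)

theorem normSqSum_ge (σ : ℝ) (z : SpaceTime d) : σ ^ 2 ≤ normSqOmega σ z + normSqXi z :=
  (normSqOmega_ge σ z).trans (le_add_of_nonneg_right (normSqXi_nonneg z))

theorem norm_sq_eq (z : SpaceTime d) : ‖z‖ ^ 2 = z.fst ^ 2 + ‖z.snd‖ ^ 2 := by
  rw [WithLp.prod_norm_sq_eq_of_L2, Real.norm_eq_abs, sq_abs]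

theorem normSqSum_eq (σ : ℝ) (z : SpaceTime d) :
    normSqOmega σ z + normSqXi z = (2 * Real.pi) ^ 2 * ‖z‖ ^ 2 + σ ^ 2 := by
  rw [norm_sq_eq, normSqOmega, normSqXi]
  ring

theorem continuous_fst : Continuous fun z : SpaceTime d => z.fst :=
  (WithLp.fstL 2 ℝ ℝ (Bdry d)).continuous

theorem continuous_snd : Continuous fun z : SpaceTime d => z.snd :=
  (WithLp.sndL 2 ℝ ℝ (Bdry d)).continuous

theorem continuous_normSqOmega (σ : ℝ) : Continuous (normSqOmega (d := d) σ) :=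
  ((continuous_const.mul continuous_fst).pow 2).add continuous_const

theorem continuous_normSqXi : Continuous (normSqXi (d := d)) :=
  (continuous_const.mul continuous_snd.norm).pow 2

theorem continuous_sobolevWeight {σ : ℝ} (hσ : 0 < σ) (s r : ℝ) :
    Continuous (sobolevWeight (d := d) σ s r) :=
  ((continuous_normSqOmega σ).rpow_const fun z => Or.inl (normSqOmega_pos hσ z).ne').mul
    (((continuous_normSqOmega σ).add continuous_normSqXi).rpow_const
      fun z => Or.inl (normSqSum_pos hσ z).ne')

theorem sobolevWeight_pos {σ : ℝ} (hσ : 0 < σ) (s r : ℝ) (z : SpaceTime d) :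
    0 < sobolevWeight σ s r z :=
  mul_pos (Real.rpow_pos_of_pos (normSqOmega_pos hσ z) _)
    (Real.rpow_pos_of_pos (normSqSum_pos hσ z) _)

theorem sobolevWeight_add {σ : ℝ} (hσ : 0 < σ) (s r s' r' : ℝ) (z : SpaceTime d) :
    sobolevWeight σ (s + s') (r + r') z = sobolevWeight σ s r z * sobolevWeight σ s' r' z := by
  rw [sobolevWeight, sobolevWeight, sobolevWeight, add_div, add_div,
    Real.rpow_add (normSqOmega_pos hσ z), Real.rpow_add (normSqSum_pos hσ z)]
  ring

theorem sobolevWeight_zero (σ : ℝ) (z : SpaceTime d) : sobolevWeight σ 0 0 z = 1 := by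
  simp [sobolevWeight]

theorem sobolevWeight_mul_neg {σ : ℝ} (hσ : 0 < σ) (s r : ℝ) (z : SpaceTime d) :
    sobolevWeight σ s r z * sobolevWeight σ (-s) (-r) z = 1 := by
  rw [← sobolevWeight_add hσ, add_neg_cancel, add_neg_cancel, sobolevWeight_zero]

/-- The exponent may have either sign, hence the bounds on both `y` and `y⁻¹`. The ceiling makes the
final power a natural one, so that the majorant is polynomial. -/
theorem rpow_le_pow_ceil {y M B : ℝ} (hy : 0 < y) (hM : 1 ≤ M) (hB : 1 ≤ B) (h1 : y ≤ M * B)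
    (h2 : y⁻¹ ≤ M) (x : ℝ) : y ^ x ≤ (M * B) ^ ⌈|x|⌉₊ := by
  have hMB : 1 ≤ M * B := one_le_mul_of_one_le_of_one_le hM hB
  have h3 : y⁻¹ ≤ M * B := h2.trans (le_mul_of_one_le_right (by linarith) hB)
  have h4 : y ^ x ≤ (M * B) ^ |x| := by
    rcases le_total 0 x with hx | hx
    · rw [abs_of_nonneg hx]
      exact Real.rpow_le_rpow hy.le h1 hx
    · rw [abs_of_nonpos hx]
      calc y ^ x = (y⁻¹) ^ (-x) := by rw [Real.inv_rpow hy.le, ← Real.rpow_neg hy.le, neg_neg]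
        _ ≤ _ := Real.rpow_le_rpow (inv_nonneg.2 hy.le) h3 (neg_nonneg.2 hx)
  refine h4.trans ?_
  rw [← Real.rpow_natCast]
  exact Real.rpow_le_rpow_of_exponent_le hMB (Nat.le_ceil _)

/-- The weights grow at most polynomially. -/
theorem exists_sobolevWeight_le {σ : ℝ} (hσ : 0 < σ) (s r : ℝ) :
    ∃ C : ℝ, ∃ N : ℕ, 0 ≤ C ∧ ∀ z : SpaceTime d,
      sobolevWeight σ s r z ≤ C * (1 + ‖z‖ ^ 2) ^ N := by
  set M : ℝ := (2 * Real.pi) ^ 2 + σ ^ 2 + (σ ^ 2)⁻¹ + 1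
  have hM : 1 ≤ M := by
    have : 0 ≤ (2 * Real.pi) ^ 2 + σ ^ 2 + (σ ^ 2)⁻¹ := by positivity
    linarith
  refine ⟨M ^ (⌈|s / 2|⌉₊ + ⌈|r / 2|⌉₊), ⌈|s / 2|⌉₊ + ⌈|r / 2|⌉₊, by positivity, fun z => ?_⟩
  have hB : 1 ≤ 1 + ‖z‖ ^ 2 := le_add_of_nonneg_right (sq_nonneg _)
  have hsum : normSqOmega σ z + normSqXi z ≤ M * (1 + ‖z‖ ^ 2) := by
    rw [normSqSum_eq]
    have h1 : 0 ≤ (σ ^ 2)⁻¹ := by positivity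
    have h2 : 0 ≤ ‖z‖ ^ 2 := sq_nonneg _
    have h3 : 0 ≤ (2 * Real.pi) ^ 2 := sq_nonneg _
    have h4 : 0 ≤ σ ^ 2 := sq_nonneg _
    simp only [M]
    nlinarith [mul_nonneg h1 h2, mul_nonneg h4 h2]
  have hinv : ∀ y : ℝ, σ ^ 2 ≤ y → y⁻¹ ≤ M := fun y hy => by
    have h1 : y⁻¹ ≤ (σ ^ 2)⁻¹ := inv_anti₀ (by positivity) hy
    have h3 : 0 ≤ (2 * Real.pi) ^ 2 := sq_nonneg _
    have h4 : 0 ≤ σ ^ 2 := sq_nonneg _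
    simp only [M]
    linarith
  rw [← mul_pow, pow_add]
  refine mul_le_mul ?_ ?_ (Real.rpow_nonneg (normSqSum_pos hσ z).le _) (by positivity)
  · exact rpow_le_pow_ceil (normSqOmega_pos hσ z) hM hB
      ((le_add_of_nonneg_right (normSqXi_nonneg z)).trans hsum) (hinv _ (normSqOmega_ge σ z)) _
  · exact rpow_le_pow_ceil (normSqSum_pos hσ z) hM hB hsum (hinv _ (normSqSum_ge σ z)) _

/-- The weights are bounded below for nonnegative exponents. -/
theorem sobolevWeight_neg_le {σ : ℝ} (hσ : 0 < σ) {s r : ℝ} (hs : 0 ≤ s) (hr : 0 ≤ r)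
    (z : SpaceTime d) :
    sobolevWeight σ (-s) (-r) z ≤ (σ ^ 2) ^ (-s / 2) * (σ ^ 2) ^ (-r / 2) := by
  have h0 : (0 : ℝ) < σ ^ 2 := by positivity
  exact mul_le_mul
    (Real.rpow_le_rpow_of_nonpos h0 (normSqOmega_ge σ z) (by linarith))
    (Real.rpow_le_rpow_of_nonpos h0 (normSqSum_ge σ z) (by linarith))
    (Real.rpow_nonneg (normSqSum_pos hσ z).le _) (Real.rpow_nonneg h0.le _)

theorem aestronglyMeasurable_of_sobolevWeight_mul {σ : ℝ} (hσ : 0 < σ) {s r : ℝ}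
    {f : SpaceTime d → ℂ}
    (h : AEStronglyMeasurable (fun z => (sobolevWeight σ s r z : ℂ) * f z)) :
    AEStronglyMeasurable f := by
  have h1 : f = fun z =>
      ((sobolevWeight σ (-s) (-r) z : ℝ) : ℂ) * ((sobolevWeight σ s r z : ℂ) * f z) := by
    ext z
    rw [← mul_assoc, ← Complex.ofReal_mul, mul_comm (sobolevWeight σ (-s) (-r) z),
      sobolevWeight_mul_neg hσ, Complex.ofReal_one, one_mul]
  rw [h1]
  exact (Complex.continuous_ofReal.comp
    (continuous_sobolevWeight hσ _ _)).aestronglyMeasurable.mul h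

theorem aestronglyMeasurable_sobolevWeight_mul {σ : ℝ} (hσ : 0 < σ) (s r : ℝ)
    {f : SpaceTime d → ℂ} (h : AEStronglyMeasurable f) :
    AEStronglyMeasurable (fun z => (sobolevWeight σ s r z : ℂ) * f z) :=
  (Complex.continuous_ofReal.comp (continuous_sobolevWeight hσ _ _)).aestronglyMeasurable.mul h

theorem norm_sobolevWeight_mul {σ : ℝ} (hσ : 0 < σ) (s r : ℝ) (z : SpaceTime d) (c : ℂ) :
    ‖(sobolevWeight σ s r z : ℂ) * c‖ = sobolevWeight σ s r z * ‖c‖ := by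
  rw [norm_mul, Complex.norm_real, Real.norm_of_nonneg (sobolevWeight_pos hσ s r z).le]

/-- The quotient of the two weights has nonpositive exponents and is bounded because |ω| ≥ σ > 0. -/
theorem memLp_sobolevWeight_mono {σ : ℝ} (hσ : 0 < σ) {s r s' r' : ℝ} (hs : s' ≤ s) (hr : r' ≤ r)
    {f : SpaceTime d → ℂ} (h : MemLp (fun z => (sobolevWeight σ s r z : ℂ) * f z) 2) :
    MemLp (fun z => (sobolevWeight σ s' r' z : ℂ) * f z) 2 := by
  refine h.of_le_mul (c := (σ ^ 2) ^ (-(s - s') / 2) * (σ ^ 2) ^ (-(r - r') / 2))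
    (aestronglyMeasurable_sobolevWeight_mul hσ _ _
      (aestronglyMeasurable_of_sobolevWeight_mul hσ h.1)) (Eventually.of_forall fun z => ?_)
  rw [norm_sobolevWeight_mul hσ, norm_sobolevWeight_mul hσ, ← mul_assoc]
  gcongr
  rw [show s' = -(s - s') + s by ring, show r' = -(r - r') + r by ring, sobolevWeight_add hσ]
  have h1 := sobolevWeight_neg_le hσ (sub_nonneg.2 hs) (sub_nonneg.2 hr) z
  have h2 := (sobolevWeight_pos hσ s r z).le
  refine (mul_le_mul_of_nonneg_right h1 h2).trans (le_of_eq ?_)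
  congr 3 <;> ring_nf

theorem MemH.mono {σ : ℝ} (hσ : 0 < σ) {s r s' r' : ℝ} (hs : s' ≤ s) (hr : r' ≤ r) {u : Dist d}
    (h : MemH σ s r u) : MemH σ s' r' u := by
  obtain ⟨h1, f, h2, h3⟩ := h
  exact ⟨h1, f, h2, memLp_sobolevWeight_mono hσ hs hr h3⟩

/-- The polynomial weight `(1 + ‖z‖²) ^ N` as a complex function. -/
def polyWeight (N : ℕ) (z : SpaceTime d) : ℂ := ((((1 : ℝ) + ‖z‖ ^ 2) ^ N : ℝ) : ℂ)

theorem norm_polyWeight (N : ℕ) (z : SpaceTime d) : ‖polyWeight N z‖ = (1 + ‖z‖ ^ 2) ^ N := by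
  rw [polyWeight, Complex.norm_real, Real.norm_of_nonneg (by positivity)]

theorem polyWeight_ne_zero (N : ℕ) (z : SpaceTime d) : polyWeight N z ≠ 0 := by
  rw [← norm_ne_zero_iff, norm_polyWeight]
  positivity

theorem hasTemperateGrowth_polyWeight (N : ℕ) : (polyWeight (d := d) N).HasTemperateGrowth := by
  unfold polyWeight
  exact Function.HasTemperateGrowth.comp Function.Complex.hasTemperateGrowth_ofReal
    (((Function.HasTemperateGrowth.const 1).add
      (Function.hasTemperateGrowth_norm_sq (H := SpaceTime d))).pow N)

theorem memLp_sobolevWeight_schwartz {σ : ℝ} (hσ : 0 < σ) (s r : ℝ) (φ : 𝓢(SpaceTime d, ℂ)) :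
    MemLp (fun z => (sobolevWeight σ s r z : ℂ) * φ z) 2 := by
  obtain ⟨C, N, hC, h⟩ := exists_sobolevWeight_le (d := d) hσ s r
  have h1 : MemLp (SchwartzMap.smulLeftCLM ℂ (polyWeight N) φ) 2 (volume : Measure (SpaceTime d)) :=
    SchwartzMap.memLp _ 2 volume
  refine h1.of_le_mul (c := C) (aestronglyMeasurable_sobolevWeight_mul hσ s r
    φ.continuous.aestronglyMeasurable) (Eventually.of_forall fun z => ?_)
  rw [norm_sobolevWeight_mul hσ, SchwartzMap.smulLeftCLM_apply_apply
    (hasTemperateGrowth_polyWeight N), norm_smul, norm_polyWeight, ← mul_assoc]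
  gcongr
  exact h z

/-- Functions in a weighted `L²` space are tempered. -/
theorem isTempered_of_memLp {σ : ℝ} (hσ : 0 < σ) {s r : ℝ} {f : SpaceTime d → ℂ}
    (hf : MemLp (fun z => (sobolevWeight σ s r z : ℂ) * f z) 2) : IsTempered f := by
  obtain ⟨C, N, hC, h⟩ := exists_sobolevWeight_le (d := d) hσ (-s) (-r)
  have hT := hasTemperateGrowth_polyWeight (d := d) N
  have hm := aestronglyMeasurable_of_sobolevWeight_mul hσ hf.1
  have hg : MemLp (fun z => (polyWeight N z)⁻¹ * f z) 2 := by
    refine hf.of_le_mul (c := C) ?_ (Eventually.of_forall fun z => ?_)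
    · refine AEStronglyMeasurable.mul ?_ hm
      exact (hT.1.continuous.inv₀ (polyWeight_ne_zero N)).aestronglyMeasurable
    · rw [norm_sobolevWeight_mul hσ, norm_mul, norm_inv, norm_polyWeight,
        inv_mul_le_iff₀ (by positivity)]
      have h1 := mul_le_mul_of_nonneg_right (h z)
        (mul_nonneg (sobolevWeight_pos hσ s r z).le (norm_nonneg (f z)))
      rw [← mul_assoc, mul_comm (sobolevWeight σ (-s) (-r) z), sobolevWeight_mul_neg hσ,
        one_mul] at h1
      exact h1.trans (le_of_eq (by ring))
  -- Divided by a polynomial, `f` is square integrable and hence tempered; the polynomial is put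
  -- back by multiplying the test function.
  refine ⟨PointwiseConvergenceCLM.precomp ℂ (SchwartzMap.smulLeftCLM ℂ (polyWeight N))
    (Lp.toTemperedDistribution hg.toLp), fun φ => ?_⟩
  have heq : ∀ z, f z * φ z =
      (SchwartzMap.smulLeftCLM ℂ (polyWeight N) φ) z * ((polyWeight N z)⁻¹ * f z) := fun z => by
    rw [SchwartzMap.smulLeftCLM_apply_apply hT, smul_eq_mul]
    field_simp [polyWeight_ne_zero N z]
  constructor
  · simp only [heq]
    exact (SchwartzMap.memLp (SchwartzMap.smulLeftCLM ℂ (polyWeight N) φ) 2 volume).integrable_mul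
      hg
  · change Lp.toTemperedDistribution hg.toLp (SchwartzMap.smulLeftCLM ℂ (polyWeight N) φ) = _
    rw [Lp.toTemperedDistribution_apply]
    refine integral_congr_ae ?_
    filter_upwards [hg.coeFn_toLp] with z hz
    rw [hz, heq, smul_eq_mul]

/-- Peetre's inequality for the weight of `H^{1/2}(H^{1/2})`. -/
theorem exists_peetre {σ : ℝ} (hσ : 0 < σ) :
    ∃ C : ℝ, 0 ≤ C ∧ ∀ z ζ : SpaceTime d, sobolevWeight σ (1 / 2) (1 / 2) z ≤
      C * (1 + ‖ζ‖) * sobolevWeight σ (1 / 2) (1 / 2) (z - ζ) := by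
  -- Chosen so that (K - 2) σ² = 2 (2π)²: the contribution of `ζ` is then absorbed by the lower
  -- bound σ² of both quadratic forms.
  set K : ℝ := 2 + 2 * (2 * Real.pi) ^ 2 / σ ^ 2
  have hK : 0 ≤ K := by positivity
  have hKσ : 2 * (2 * Real.pi) ^ 2 = (K - 2) * σ ^ 2 := by
    simp only [K]
    field_simp
    ring
  -- the elementary estimate behind both factors
  have key : ∀ x y N E : ℝ, σ ^ 2 ≤ E → N ≤ 2 * (2 * Real.pi) ^ 2 * y + 2 * E → 0 ≤ y →
      y ≤ x ^ 2 → 0 ≤ x → N ≤ K * (1 + x) ^ 2 * E := by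
    intro x y N E hE hN hy hyx hx
    have hK2 : 0 ≤ K - 2 := by
      simp only [K]
      have : 0 ≤ 2 * (2 * Real.pi) ^ 2 / σ ^ 2 := by positivity
      linarith
    have hE0 : 0 ≤ E := (sq_nonneg σ).trans hE
    have h1 : (K - 2) * σ ^ 2 * y ≤ (K - 2) * E * x ^ 2 := by gcongr
    have h2 : 0 ≤ K * E * x := by positivity
    rw [hKσ] at hN
    nlinarith [mul_nonneg hE0 (sq_nonneg x), mul_nonneg hK2 hE0]
  refine ⟨K ^ (1 / 4 : ℝ) * K ^ (1 / 4 : ℝ), by positivity, fun z ζ => ?_⟩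
  have h1 : normSqOmega σ z ≤ K * (1 + ‖ζ‖) ^ 2 * normSqOmega σ (z - ζ) := by
    refine key ‖ζ‖ (ζ.fst ^ 2) _ _ (normSqOmega_ge _ _) ?_ (sq_nonneg _) ?_ (norm_nonneg _)
    · simp only [normSqOmega, WithLp.sub_fst]
      nlinarith [sq_nonneg (2 * Real.pi * (z.fst - 2 * ζ.fst)), sq_nonneg σ]
    · rw [norm_sq_eq]
      exact le_add_of_nonneg_right (sq_nonneg _)
  have h2 : normSqOmega σ z + normSqXi z ≤
      K * (1 + ‖ζ‖) ^ 2 * (normSqOmega σ (z - ζ) + normSqXi (z - ζ)) := by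
    refine key ‖ζ‖ (‖ζ‖ ^ 2) _ _ (normSqSum_ge _ _) ?_ (sq_nonneg _) le_rfl (norm_nonneg _)
    rw [normSqSum_eq, normSqSum_eq]
    have h3 : ‖z‖ ≤ ‖z - ζ‖ + ‖ζ‖ := by simpa using norm_add_le (z - ζ) ζ
    have h4 : ‖z‖ ^ 2 ≤ 2 * ‖z - ζ‖ ^ 2 + 2 * ‖ζ‖ ^ 2 := by
      nlinarith [norm_nonneg z, sq_nonneg (‖z - ζ‖ - ‖ζ‖)]
    have h5 : 0 ≤ (2 * Real.pi) ^ 2 := sq_nonneg _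
    nlinarith [sq_nonneg σ]
  have hx : 0 ≤ 1 + ‖ζ‖ := by positivity
  -- Each of the two factors of the weight contributes (1 + ‖ζ‖)^{1/2}, so the total loss is linear
  -- in ‖ζ‖.
  have hroot : ((1 + ‖ζ‖) ^ 2) ^ (1 / 4 : ℝ) * ((1 + ‖ζ‖) ^ 2) ^ (1 / 4 : ℝ) = 1 + ‖ζ‖ := by
    rw [← Real.rpow_add (by positivity), ← Real.rpow_natCast, ← Real.rpow_mul hx]
    norm_num
  have e1 := Real.rpow_le_rpow (normSqOmega_pos hσ z).le h1 (by norm_num : (0 : ℝ) ≤ 1 / 4)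
  have e2 := Real.rpow_le_rpow (normSqSum_pos hσ z).le h2 (by norm_num : (0 : ℝ) ≤ 1 / 4)
  rw [Real.mul_rpow (by positivity) (normSqOmega_pos hσ _).le, Real.mul_rpow hK (by positivity)]
    at e1
  rw [Real.mul_rpow (by positivity) (normSqSum_pos hσ _).le, Real.mul_rpow hK (by positivity)]
    at e2
  rw [sobolevWeight, sobolevWeight, show (1 / 2 / 2 : ℝ) = 1 / 4 by norm_num]
  refine (mul_le_mul e1 e2 (Real.rpow_nonneg (normSqSum_pos hσ z).le _)
    ((Real.rpow_nonneg (normSqOmega_pos hσ z).le _).trans e1)).trans (le_of_eq ?_)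
  generalize (1 + ‖ζ‖) ^ 2 = A at hroot
  rw [← hroot]
  ring

/-! ### Distributions defined by test functions and by tempered distributions -/

/-- Smooth functions supported in a fixed compact set embed continuously into the Schwartz
space. -/
theorem continuous_toSchwartzMap_supportedIn {E F : Type*} [NormedAddCommGroup E]
    [NormedSpace ℝ E] [NormedAddCommGroup F] [NormedSpace ℝ F] (K : Compacts E) :
    Continuous fun f : 𝓓_{K}(E, F) =>
      (f.hasCompactSupport.toSchwartzMap f.contDiff : 𝓢(E, F)) := by
  let Φ : 𝓓_{K}(E, F) →ₗ[ℝ] 𝓢(E, F) :=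
    { toFun f := f.hasCompactSupport.toSchwartzMap f.contDiff
      map_add' _ _ := rfl
      map_smul' _ _ := rfl }
  change Continuous Φ
  refine WithSeminorms.continuous_of_isBounded (ContDiffMapSupportedIn.withSeminorms ℝ E F ⊤ K)
    (schwartz_withSeminorms ℝ E F) Φ (.of_real fun i => ?_)
  obtain ⟨k, n⟩ := i
  obtain ⟨R, hR⟩ := K.isCompact.isBounded.exists_norm_le
  refine ⟨{n}, |R| ^ k, fun f => ?_⟩
  refine SchwartzMap.seminorm_le_bound ℝ k n _ (by positivity) fun x => ?_
  change ‖x‖ ^ k * ‖iteratedFDeriv ℝ n f x‖ ≤ _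
  simp only [Finset.sup_singleton]
  by_cases hx : x ∈ K
  · have h1 : ‖x‖ ≤ |R| := (hR x hx).trans (le_abs_self R)
    refine mul_le_mul (by gcongr) ?_ (norm_nonneg _) (by positivity)
    exact ContDiffMapSupportedIn.norm_iteratedFDeriv_apply_le_seminorm_top ℝ
  · rw [f.iteratedFDeriv_zero_on_compl hx]
    simp only [Pi.zero_apply, norm_zero, mul_zero]
    positivity

theorem contDiff_exp_fst (a : ℝ) :
    ContDiff ℝ ∞ fun z : SpaceTime d => ((Real.exp (a * z.fst) : ℝ) : ℂ) :=
  Complex.ofRealCLM.contDiff.comp (Real.contDiff_exp.comp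
    (contDiff_const.mul (WithLp.fstL 2 ℝ ℝ (Bdry d)).contDiff))

/-- The real part of `e^{σ t} W`, for a tempered distribution `W`. -/
def ofTempered (σ : ℝ) (W : 𝓢'(SpaceTime d, ℂ)) : Dist d :=
  let L : Test d →L[ℝ] ℝ := TestFunction.mkCLM ℝ (fun φ => (W (toSchwartz (expMul σ φ))).re)
    (fun φ ψ => by rw [expMul_add, toSchwartz_add, map_add, Complex.add_re])
    (fun c φ => by
      rw [expMul_smul, toSchwartz_smul, map_smul, smul_eq_mul, Complex.re_ofReal_mul, smul_eq_mul])
    (fun K hK => by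
      have h1 := (continuous_toSchwartzMap_supportedIn (F := ℂ) K).comp
        (ContDiffMapSupportedIn.bilinLeftCLM (n := ⊤) (K := K)
          (ContinuousLinearMap.lsmul ℝ ℝ : ℝ →L[ℝ] ℂ →L[ℝ] ℂ)
          (contDiff_exp_fst (d := d) σ)).continuous
      refine (Complex.continuous_re.comp (W.continuous.comp h1)).congr fun φ => ?_
      simp only [Function.comp_apply]
      congr 2
      ext z
      simp only [toSchwartz_apply, expMul_apply]
      change φ z • ((Real.exp (σ * z.fst) : ℝ) : ℂ) = ((Real.exp (σ * z.fst) * φ z : ℝ) : ℂ)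
      rw [Complex.real_smul, ← Complex.ofReal_mul, mul_comm])
  (ContinuousLinearMap.toUniformConvergenceCLM (RingHom.id ℝ) ℝ _) L

theorem ofTempered_apply (σ : ℝ) (W : 𝓢'(SpaceTime d, ℂ)) (φ : Test d) :
    ofTempered σ W φ = (W (toSchwartz (expMul σ φ))).re := rfl

/-- The distribution `ψ ↦ ∫ φ ψ`. -/
def ofTest (φ : Test d) : Dist d :=
  (ContinuousLinearMap.toUniformConvergenceCLM (RingHom.id ℝ) ℝ _)
    (TestFunction.integralAgainstBilinCLM (ContinuousLinearMap.mul ℝ ℝ) volume φ)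

theorem ofTest_apply (φ ψ : Test d) : ofTest φ ψ = ∫ z, ψ z * φ z := by
  change TestFunction.integralAgainstBilinCLM (ContinuousLinearMap.mul ℝ ℝ) volume φ ψ = _
  rw [TestFunction.integralAgainstBilinCLM_eq_integral]
  · rfl
  · exact (φ.continuous.locallyIntegrable).locallyIntegrableOn _

theorem isFourierLaplace_ofTest (σ : ℝ) (φ : Test d) :
    IsFourierLaplace σ (ofTest φ) (𝓕 (toSchwartz (expMul (-σ) φ)) : 𝓢(SpaceTime d, ℂ)) := by
  refine isFourierLaplace_iff.2 ⟨⟨SchwartzMap.toTemperedDistributionCLM _ ℂ volume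
    (𝓕 (toSchwartz (expMul (-σ) φ))), fun ψ => ⟨?_, ?_⟩⟩, fun ψ => ?_⟩
  · exact (SchwartzMap.memLp _ 2 volume).integrable_mul (SchwartzMap.memLp ψ 2 volume)
  · refine (SchwartzMap.toTemperedDistributionCLM_apply_apply volume _ _).trans ?_
    simp only [smul_eq_mul, mul_comm]
  · rw [SchwartzMap.integral_fourier_mul_eq, FourierTransform.fourier_fourierInv_eq, ofTest_apply]
    refine Eq.trans ?_ (integral_ofReal (𝕜 := ℂ))
    refine integral_congr_ae (Eventually.of_forall fun z => ?_)
    change ((Real.exp (-σ * z.fst) * φ z : ℝ) : ℂ) * ((ψ z : ℝ) : ℂ) =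
      ((Real.exp (-σ * z.fst) * ψ z * φ z : ℝ) : ℂ)
    rw [← Complex.ofReal_mul]
    congr 1
    ring

theorem suppIn_ofTest {φ : Test d} {C : Set (SpaceTime d)} (h : tsupport φ ⊆ C) :
    SuppIn (ofTest φ) C := by
  intro ψ hψ
  rw [ofTest_apply]
  refine integral_eq_zero_of_ae (Eventually.of_forall fun z => ?_)
  by_cases hz : z ∈ C
  · have : ψ z = 0 := image_eq_zero_of_notMem_tsupport fun h1 => hψ h1 hz
    simp [this]
  · have : φ z = 0 := image_eq_zero_of_notMem_tsupport fun h1 => hz (h h1)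
    simp [this]

theorem isNonneg_ofTest {φ : Test d} (h : ∀ z, 0 ≤ φ z) : IsNonneg (ofTest φ) := by
  intro ψ hψ
  rw [ofTest_apply]
  exact integral_nonneg fun z => mul_nonneg (hψ z) (h z)

theorem memH_ofTest {σ : ℝ} (hσ : 0 < σ) (s r : ℝ) {φ : Test d}
    (h : tsupport φ ⊆ {z | 0 ≤ z.fst}) : MemH σ s r (ofTest φ) :=
  ⟨suppIn_ofTest h, _, isFourierLaplace_ofTest σ φ, memLp_sobolevWeight_schwartz hσ s r _⟩

/-! ### Elementary properties of the function spaces -/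

theorem isVanishingOn_sub {u v : Dist d} {s : Set (SpaceTime d)} (hu : IsVanishingOn u s)
    (hv : IsVanishingOn v s) : IsVanishingOn (u - v) s := fun φ hφ => by
  rw [sub_apply, hu φ hφ, hv φ hφ, sub_zero]

theorem isVanishingOn_add {u v : Dist d} {s : Set (SpaceTime d)} (hu : IsVanishingOn u s)
    (hv : IsVanishingOn v s) : IsVanishingOn (u + v) s := fun φ hφ => by
  rw [add_apply, hu φ hφ, hv φ hφ, add_zero]

theorem isVanishingOn_smul {u : Dist d} {s : Set (SpaceTime d)} (hu : IsVanishingOn u s)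
    (c : ℝ) : IsVanishingOn (c • u) s := fun φ hφ => by
  rw [smul_apply, hu φ hφ, smul_zero]

theorem MemH.sub {σ s r : ℝ} {u v : Dist d} (hu : MemH σ s r u) (hv : MemH σ s r v) :
    MemH σ s r (u - v) := by
  obtain ⟨h1, f, h2, h3⟩ := hu
  obtain ⟨k1, g, k2, k3⟩ := hv
  refine ⟨isVanishingOn_sub h1 k1, f - g, h2.sub k2, ?_⟩
  convert h3.sub k3 using 1
  ext z
  simp [mul_sub]

theorem MemH.add {σ s r : ℝ} {u v : Dist d} (hu : MemH σ s r u) (hv : MemH σ s r v) :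
    MemH σ s r (u + v) := by
  obtain ⟨h1, f, h2, h3⟩ := hu
  obtain ⟨k1, g, k2, k3⟩ := hv
  refine ⟨isVanishingOn_add h1 k1, f + g, h2.add k2, ?_⟩
  convert h3.add k3 using 1
  ext z
  simp [mul_add]

theorem MemH.smul {σ s r : ℝ} {u : Dist d} (hu : MemH σ s r u) (c : ℝ) :
    MemH σ s r (c • u) := by
  obtain ⟨h1, f, h2, h3⟩ := hu
  refine ⟨isVanishingOn_smul h1 c, _, h2.smul c, ?_⟩
  convert h3.const_mul (c : ℂ) using 1
  ext z
  ring

theorem MemHTilde.sub {σ s r : ℝ} {G : Opens (Bdry d)} {u v : Dist d} (hu : MemHTilde σ s r G u)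
    (hv : MemHTilde σ s r G v) : MemHTilde σ s r G (u - v) :=
  ⟨hu.1.sub hv.1, isVanishingOn_sub hu.2 hv.2⟩

theorem MemHTilde.add {σ s r : ℝ} {G : Opens (Bdry d)} {u v : Dist d} (hu : MemHTilde σ s r G u)
    (hv : MemHTilde σ s r G v) : MemHTilde σ s r G (u + v) :=
  ⟨hu.1.add hv.1, isVanishingOn_add hu.2 hv.2⟩

theorem MemHTilde.smul {σ s r : ℝ} {G : Opens (Bdry d)} {u : Dist d} (hu : MemHTilde σ s r G u)
    (c : ℝ) : MemHTilde σ s r G (c • u) :=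
  ⟨hu.1.smul c, isVanishingOn_smul hu.2 c⟩

theorem MemHRestr.sub {σ s r : ℝ} {G : Opens (Bdry d)} {l m : DistOn G}
    (hl : MemHRestr σ s r G l) (hm : MemHRestr σ s r G m) : MemHRestr σ s r G (l - m) := by
  obtain ⟨L, hL, rfl⟩ := hl
  obtain ⟨M, hM, rfl⟩ := hm
  exact ⟨L - M, hL.sub hM, map_sub _ _ _⟩

theorem MemHRestr.add {σ s r : ℝ} {G : Opens (Bdry d)} {l m : DistOn G}
    (hl : MemHRestr σ s r G l) (hm : MemHRestr σ s r G m) : MemHRestr σ s r G (l + m) := by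
  obtain ⟨L, hL, rfl⟩ := hl
  obtain ⟨M, hM, rfl⟩ := hm
  exact ⟨L + M, hL.add hM, map_add _ _ _⟩

theorem MemHRestr.smul {σ s r : ℝ} {G : Opens (Bdry d)} {l : DistOn G}
    (hl : MemHRestr σ s r G l) (c : ℝ) : MemHRestr σ s r G (c • l) := by
  obtain ⟨L, hL, rfl⟩ := hl
  exact ⟨c • L, hL.smul c, map_smul _ _ _⟩

theorem MemHRestr.mono {σ : ℝ} (hσ : 0 < σ) {s r s' r' : ℝ} (hs : s' ≤ s) (hr : r' ≤ r)
    {G : Opens (Bdry d)} {l : DistOn G} (hl : MemHRestr σ s r G l) : MemHRestr σ s' r' G l := by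
  obtain ⟨L, hL, rfl⟩ := hl
  exact ⟨L, hL.mono hσ hs hr, rfl⟩

/-- Extension by zero of a test function on the cylinder. -/
def extend {G : Opens (Bdry d)} (φ : 𝓓(cylinder G, ℝ)) : Test d :=
  ⟨φ, φ.contDiff, φ.hasCompactSupport, fun _ _ => trivial⟩

theorem restrict_apply {G : Opens (Bdry d)} (u : Dist d) (φ : 𝓓(cylinder G, ℝ)) :
    restrict G u φ = u (extend φ) := by
  change u (TestFunction.monoCLM ℝ φ) = _
  congr 1
  ext z
  have h := TestFunction.monoCLM_apply (𝕜 := ℝ) (Ω₂ := (⊤ : Opens (SpaceTime d)))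
    (n₂ := ⊤) φ
  rw [if_pos ⟨le_rfl, le_top⟩] at h
  exact congrFun h z

/-- A test function supported in the cylinder, as a test function on the cylinder. -/
def ofSubset {G : Opens (Bdry d)} (φ : Test d) (h : tsupport φ ⊆ cylinder G) :
    𝓓(cylinder G, ℝ) :=
  ⟨φ, φ.contDiff, φ.hasCompactSupport, h⟩

theorem extend_ofSubset {G : Opens (Bdry d)} (φ : Test d) (h : tsupport φ ⊆ cylinder G) :
    extend (ofSubset φ h) = φ := rfl

theorem tsupport_extend {G : Opens (Bdry d)} (φ : 𝓓(cylinder G, ℝ)) :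
    tsupport (extend φ) ⊆ cylinder G := φ.tsupport_subset

/-! ### Density of test functions: the frequency side -/

/-- If the Fourier–Laplace transform of `v` is square integrable, then `e^{-σ t} v` is a square
integrable function. -/
theorem exists_real_density {σ : ℝ} {v : Dist d} {f : SpaceTime d → ℂ}
    (hf : IsFourierLaplace σ v f) (hf2 : MemLp f 2) {C : Set (SpaceTime d)} (hC : IsClosed C)
    (hv : SuppIn v C) :
    ∃ V : SpaceTime d → ℝ, MemLp V 2 ∧ (∀ x ∉ C, V x = 0) ∧
      ∀ φ : 𝓢(SpaceTime d, ℂ), ∫ x, (V x : ℂ) * φ x = ∫ z, f z * (𝓕⁻ φ) z := by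
  set V₀ : Lp ℂ 2 (volume : Measure (SpaceTime d)) := 𝓕⁻ (hf2.toLp f)
  have h0 : ∀ φ : 𝓢(SpaceTime d, ℂ), ∫ x, V₀ x * φ x = ∫ z, f z * (𝓕⁻ φ) z := by
    intro φ
    have h := congrArg (fun U : 𝓢'(SpaceTime d, ℂ) => U φ)
      (Lp.fourierInv_toTemperedDistribution_eq hf2.toLp)
    simp only [TemperedDistribution.fourierInv_apply, Lp.toTemperedDistribution_apply] at h
    calc ∫ x, V₀ x * φ x = ∫ x, φ x • V₀ x := by simp only [smul_eq_mul, mul_comm]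
      _ = ∫ x, (𝓕⁻ φ) x • (hf2.toLp f) x := h.symm
      _ = _ := by
        refine integral_congr_ae ?_
        filter_upwards [hf2.coeFn_toLp] with z hz
        rw [hz, smul_eq_mul, mul_comm]
  have hV₀ : MemLp V₀ 2 := Lp.memLp V₀
  have hre : MemLp (fun x => (V₀ x).re) 2 := hV₀.re
  have him : MemLp (fun x => (V₀ x).im) 2 := hV₀.im
  have hint : ∀ φ : Test d, Integrable fun x => V₀ x * toSchwartz φ x := fun φ =>
    hV₀.integrable_mul (SchwartzMap.memLp _ 2 volume)
  have hcx : ∀ φ : Test d, ∫ x, V₀ x * toSchwartz φ x = ((v (expMul (-σ) φ) : ℝ) : ℂ) :=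
    fun φ => by rw [h0, hf.integral_eq]
  have hIm : ∀ φ : Test d, ∫ x, φ x • (V₀ x).im = 0 := fun φ => by
    have h1 := integral_im (hint φ)
    rw [hcx] at h1
    simp only [RCLike.im_to_complex, Complex.ofReal_im] at h1
    rw [← h1]
    congr 1 with x
    simp [mul_comm]
  have hRe : ∀ φ : Test d, ∫ x, φ x • (V₀ x).re = v (expMul (-σ) φ) := fun φ => by
    have h1 := integral_re (hint φ)
    rw [hcx] at h1
    simp only [RCLike.re_to_complex, Complex.ofReal_re] at h1
    rw [← h1]
    congr 1 with x
    simp [mul_comm]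
  -- `v` is real, so the imaginary part integrates to zero against every real test function.
  have him0 : ∀ᵐ x, (V₀ x).im = 0 :=
    ae_eq_zero_of_integral_contDiff_smul_eq_zero (him.locallyIntegrable one_le_two)
      fun φ hφ hc => hIm (mkTest φ hφ hc)
  have hre0 : ∀ᵐ x, x ∈ Cᶜ → (V₀ x).re = 0 :=
    hC.isOpen_compl.ae_eq_zero_of_integral_contDiff_smul_eq_zero
      ((hre.locallyIntegrable one_le_two).locallyIntegrableOn _) fun φ hφ hc hs => by
        refine (hRe (mkTest φ hφ hc)).trans (hv _ ?_)
        rw [tsupport_expMul]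
        exact hs
  -- Changing the density on a null set makes it vanish everywhere off `C`, which the later support
  -- arguments use pointwise.
  refine ⟨C.indicator fun x => (V₀ x).re, hre.indicator hC.measurableSet,
    fun x hx => Set.indicator_of_notMem hx _, fun φ => ?_⟩
  rw [← h0]
  refine integral_congr_ae ?_
  filter_upwards [him0, hre0] with x h1 h2
  congr 1
  by_cases hx : x ∈ C
  · rw [Set.indicator_of_mem hx]
    exact Complex.ext rfl h1.symm
  · rw [Set.indicator_of_notMem hx]
    exact Complex.ext (h2 hx).symm h1.symm

/-- The Fourier transform of a cutoff `η V`, as a convolution of Fourier transforms. -/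
theorem fourier_cutoff {f : SpaceTime d → ℂ} {V : SpaceTime d → ℝ}
    (hVf : ∀ φ : 𝓢(SpaceTime d, ℂ), ∫ x, (V x : ℂ) * φ x = ∫ z, f z * (𝓕⁻ φ) z) (η : Test d)
    (z : SpaceTime d) :
    (𝓕 fun x => ((η x * V x : ℝ) : ℂ)) z = ∫ ζ, (𝓕 (toSchwartz η)) ζ * f (z - ζ) := by
  have hsm : ContDiff ℝ ∞ fun x : SpaceTime d =>
      Complex.exp (((-2 * Real.pi * inner ℝ x z : ℝ) : ℂ) * Complex.I) * ((η x : ℝ) : ℂ) := by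
    refine ContDiff.mul (Complex.contDiff_exp.comp (ContDiff.mul ?_ contDiff_const)) ?_
    · exact Complex.ofRealCLM.contDiff.comp
        (contDiff_const.mul (contDiff_id.inner ℝ contDiff_const))
    · exact Complex.ofRealCLM.contDiff.comp η.contDiff
  have hcs : HasCompactSupport fun x : SpaceTime d =>
      Complex.exp (((-2 * Real.pi * inner ℝ x z : ℝ) : ℂ) * Complex.I) * ((η x : ℝ) : ℂ) :=
    HasCompactSupport.mul_left
      (η.hasCompactSupport.comp_left (g := ((↑) : ℝ → ℂ)) Complex.ofReal_zero)
  have h1 : (𝓕 fun x => ((η x * V x : ℝ) : ℂ)) z =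
      ∫ x, (V x : ℂ) * hcs.toSchwartzMap hsm x := by
    rw [Real.fourier_eq']
    congr 1 with x
    change _ = (V x : ℂ) * (_ * _)
    rw [smul_eq_mul]
    push_cast
    ring
  -- The modulated cutoff is itself a Schwartz function, so `hVf` applies to it; modulation becomes
  -- translation in frequency.
  have h2 : ∀ y, (𝓕⁻ (hcs.toSchwartzMap hsm)) y = (𝓕 (toSchwartz η)) (z - y) := fun y => by
    rw [SchwartzMap.fourierInv_coe, SchwartzMap.fourier_coe, Real.fourierInv_eq',
      Real.fourier_eq']
    congr 1 with x
    change _ • (_ * _) = _ • ((η x : ℝ) : ℂ)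
    rw [smul_eq_mul, smul_eq_mul, ← mul_assoc, ← Complex.exp_add, inner_sub_right]
    congr 2
    push_cast
    ring
  rw [h1, hVf, ← integral_sub_left_eq_self _ volume z]
  congr 1 with ζ
  rw [h2, sub_sub_cancel, mul_comm]

/-! ### Cross correlations in dual weighted spaces -/

theorem integral_norm_mul_le {α : Type*} [MeasurableSpace α] {ν : Measure α} {A D : α → ℂ}
    (hA : MemLp A 2 ν) (hD : MemLp D 2 ν) :
    ∫ z, ‖A z‖ * ‖D z‖ ∂ν ≤ (eLpNorm A 2 ν).toReal * (eLpNorm D 2 ν).toReal := by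
  have hpq : (2 : ℝ).HolderConjugate 2 := Real.HolderConjugate.two_two
  have h := integral_mul_norm_le_Lp_mul_Lq (f := A) (g := D) hpq (by simpa using hA)
    (by simpa using hD)
  have h2 : ∀ {B : α → ℂ}, MemLp B 2 ν →
      (∫ z, ‖B z‖ ^ (2 : ℝ) ∂ν) ^ (1 / (2 : ℝ)) = (eLpNorm B 2 ν).toReal := fun {B} hB => by
    rw [toReal_eLpNorm hB.1, lpNorm_eq_integral_norm_rpow_toReal two_ne_zero
      ENNReal.ofNat_ne_top hB.1]
    simp
  rwa [h2 hA, h2 hD] at h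

theorem norm_integral_mul_le {α : Type*} [MeasurableSpace α] {ν : Measure α} {A D : α → ℂ}
    (hA : MemLp A 2 ν) (hD : MemLp D 2 ν) :
    ‖∫ z, A z * D z ∂ν‖ ≤ (eLpNorm A 2 ν).toReal * (eLpNorm D 2 ν).toReal := by
  refine (norm_integral_le_integral_norm _).trans ?_
  simp only [norm_mul]
  exact integral_norm_mul_le hA hD

/-- Translations act continuously on `L²`. -/
theorem tendsto_eLpNorm_translate_sub {h : SpaceTime d → ℂ} (hh : MemLp h 2) :
    Tendsto (fun ζ => (eLpNorm (fun z => h (z - ζ) - h z) 2 volume).toReal) (𝓝 0) (𝓝 0) := by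
  let g : SpaceTime d → C(SpaceTime d, SpaceTime d) := fun ζ => ⟨fun z => z - ζ, by fun_prop⟩
  have hg : Continuous g :=
    ContinuousMap.continuous_of_continuous_uncurry _ (_root_.continuous_snd.sub _root_.continuous_fst)
  have hgm : ∀ ζ, MeasurePreserving (g ζ) volume volume := fun ζ =>
    measurePreserving_sub_right volume ζ
  have hlim : Tendsto (fun ζ => Lp.compMeasurePreserving (g ζ) (hgm ζ) (hh.toLp h)) (𝓝 0)
      (𝓝 (Lp.compMeasurePreserving (g 0) (hgm 0) (hh.toLp h))) :=
    tendsto_const_nhds.compMeasurePreservingLp hg.continuousAt hgm (hgm 0) ENNReal.ofNat_ne_top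
  have h0 := (tendsto_iff_norm_sub_tendsto_zero.1 hlim)
  refine h0.congr fun ζ => ?_
  rw [Lp.toLp_compMeasurePreserving, Lp.toLp_compMeasurePreserving, ← MemLp.toLp_sub,
    Lp.norm_toLp]
  congr 2
  ext z
  simp [g]

/-- The cross correlation of two functions. -/
def crossCorr (g f : SpaceTime d → ℂ) (ζ : SpaceTime d) : ℂ :=
  ∫ z, g z * conj (f (z - ζ))

section

variable {σ : ℝ} {f g : SpaceTime d → ℂ}

/-- Peetre's inequality moves the weight from `z` to `z - ζ`, after which the two dual weights
cancel and ab ≤ a² + b² applies. This is the common majorant for the correlation estimates, with a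
constant independent of `f` and `g`. -/
theorem exists_norm_mul_translate_le (hσ : 0 < σ) :
    ∃ C : ℝ, 0 ≤ C ∧ ∀ (f g : SpaceTime d → ℂ) (z ζ : SpaceTime d),
      ‖g z * conj (f (z - ζ))‖ ≤ C * (1 + ‖ζ‖) *
        (‖(sobolevWeight σ (-1 / 2) (-1 / 2) z : ℂ) * g z‖ ^ 2 +
          ‖(sobolevWeight σ (1 / 2) (1 / 2) (z - ζ) : ℂ) * f (z - ζ)‖ ^ 2) := by
  obtain ⟨C, hC, h⟩ := exists_peetre (d := d) hσ
  refine ⟨C, hC, fun f g z ζ => ?_⟩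
  have h1 := sobolevWeight_mul_neg hσ (1 / 2) (1 / 2) z
  rw [show -(1 / 2 : ℝ) = -1 / 2 by norm_num] at h1
  rw [norm_sobolevWeight_mul hσ, norm_sobolevWeight_mul hσ, norm_mul, RCLike.norm_conj]
  have hw := sobolevWeight_pos hσ (-1 / 2) (-1 / 2) z
  have hw' := sobolevWeight_pos hσ (1 / 2) (1 / 2) z
  set a := sobolevWeight σ (-1 / 2) (-1 / 2) z * ‖g z‖
  set b := sobolevWeight σ (1 / 2) (1 / 2) (z - ζ) * ‖f (z - ζ)‖
  have ha : 0 ≤ a := by positivity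
  calc ‖g z‖ * ‖f (z - ζ)‖
      = a * (sobolevWeight σ (1 / 2) (1 / 2) z * ‖f (z - ζ)‖) := by
        simp only [a]
        linear_combination (-(‖g z‖ * ‖f (z - ζ)‖)) * h1
    _ ≤ a * (C * (1 + ‖ζ‖) * sobolevWeight σ (1 / 2) (1 / 2) (z - ζ) * ‖f (z - ζ)‖) := by
        gcongr
        exact h z ζ
    _ = C * (1 + ‖ζ‖) * (a * b) := by simp only [b]; ring
    _ ≤ C * (1 + ‖ζ‖) * (a ^ 2 + b ^ 2) := by
        gcongr
        nlinarith [sq_nonneg (a - b), sq_nonneg a, sq_nonneg b]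

theorem integrable_mul_translate (hσ : 0 < σ)
    (hf : MemLp (fun z => (sobolevWeight σ (1 / 2) (1 / 2) z : ℂ) * f z) 2)
    (hg : MemLp (fun z => (sobolevWeight σ (-1 / 2) (-1 / 2) z : ℂ) * g z) 2)
    (k : 𝓢(SpaceTime d, ℂ)) :
    Integrable (fun p : SpaceTime d × SpaceTime d => g p.1 * conj (k p.2 * f (p.1 - p.2)))
      (volume.prod volume) := by
  obtain ⟨C, hC, h⟩ := exists_norm_mul_translate_le (d := d) hσ
  have hk : Integrable fun ζ : SpaceTime d => (1 + ‖ζ‖) * ‖k ζ‖ := by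
    have h0 := k.integrable_pow_mul volume 0
    have h1 := k.integrable_pow_mul volume 1
    refine (h0.add h1).congr (Eventually.of_forall fun ζ => ?_)
    simp only [Pi.add_apply]
    ring
  have ha := (memLp_two_iff_integrable_sq_norm hg.1).1 hg
  have hb := (memLp_two_iff_integrable_sq_norm hf.1).1 hf
  have h1 := (ha.mul_prod hk).const_mul C
  have h2 := (hk.convolution_integrand (ContinuousLinearMap.mul ℝ ℝ) hb).const_mul C
  refine (h1.add h2).mono' ?_ (Eventually.of_forall fun p => ?_)
  · refine (aestronglyMeasurable_of_sobolevWeight_mul hσ hg.1).comp_fst.mul ?_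
    refine Complex.continuous_conj.comp_aestronglyMeasurable ?_
    refine k.continuous.aestronglyMeasurable.comp_snd.mul ?_
    exact (aestronglyMeasurable_of_sobolevWeight_mul hσ hf.1).comp_quasiMeasurePreserving
      (quasiMeasurePreserving_sub_of_right_invariant volume volume)
  · have h3 := mul_le_mul_of_nonneg_left (h f g p.1 p.2) (norm_nonneg (k p.2))
    have h4 : ‖g p.1 * conj (k p.2 * f (p.1 - p.2))‖ =
        ‖k p.2‖ * ‖g p.1 * conj (f (p.1 - p.2))‖ := by
      simp only [norm_mul, map_mul, RCLike.norm_conj]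
      ring
    rw [h4]
    refine h3.trans (le_of_eq ?_)
    simp only [Pi.add_apply, ContinuousLinearMap.mul_apply']
    ring

/-- This is Fubini's theorem. When `k` is the transform of a cutoff η, the left side pairs `g` with
the transform of the cut off function, so the effect of a cutoff is an average of `crossCorr g f`
over frequency shifts. -/
theorem integral_mul_conj_convolution (hσ : 0 < σ)
    (hf : MemLp (fun z => (sobolevWeight σ (1 / 2) (1 / 2) z : ℂ) * f z) 2)
    (hg : MemLp (fun z => (sobolevWeight σ (-1 / 2) (-1 / 2) z : ℂ) * g z) 2)
    (k : 𝓢(SpaceTime d, ℂ)) :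
    Integrable (fun z => g z * conj (∫ ζ, k ζ * f (z - ζ))) ∧
    Integrable (fun ζ => conj (k ζ) * crossCorr g f ζ) ∧
    ∫ z, g z * conj (∫ ζ, k ζ * f (z - ζ)) = ∫ ζ, conj (k ζ) * crossCorr g f ζ := by
  have h := integrable_mul_translate hσ hf hg k
  have e1 : ∀ z, ∫ ζ, g z * conj (k ζ * f (z - ζ)) = g z * conj (∫ ζ, k ζ * f (z - ζ)) :=
    fun z => by rw [integral_const_mul, integral_conj]
  have e2 : ∀ ζ, ∫ z, g z * conj (k ζ * f (z - ζ)) = conj (k ζ) * crossCorr g f ζ :=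
    fun ζ => by
      rw [crossCorr, ← integral_const_mul]
      congr 1 with z
      rw [map_mul]
      ring
  have h1 := h.integral_prod_left
  have h2 := h.integral_prod_right
  have h3 := integral_integral_swap (f := fun z ζ => g z * conj (k ζ * f (z - ζ))) h
  simp only [e1] at h1 h3
  simp only [e2] at h2 h3
  exact ⟨h1, h2, h3⟩

theorem exists_norm_crossCorr_le (hσ : 0 < σ)
    (hf : MemLp (fun z => (sobolevWeight σ (1 / 2) (1 / 2) z : ℂ) * f z) 2)
    (hg : MemLp (fun z => (sobolevWeight σ (-1 / 2) (-1 / 2) z : ℂ) * g z) 2) :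
    ∃ M : ℝ, 0 ≤ M ∧ ∀ ζ, ‖crossCorr g f ζ‖ ≤ M * (1 + ‖ζ‖) := by
  obtain ⟨C, hC, h⟩ := exists_norm_mul_translate_le (d := d) hσ
  have ha := (memLp_two_iff_integrable_sq_norm hg.1).1 hg
  have hb := (memLp_two_iff_integrable_sq_norm hf.1).1 hf
  refine ⟨C * ((∫ z, ‖(sobolevWeight σ (-1 / 2) (-1 / 2) z : ℂ) * g z‖ ^ 2) +
    ∫ z, ‖(sobolevWeight σ (1 / 2) (1 / 2) z : ℂ) * f z‖ ^ 2), by positivity, fun ζ => ?_⟩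
  refine (norm_integral_le_of_norm_le ((ha.add (hb.comp_sub_right ζ)).const_mul
    (C * (1 + ‖ζ‖))) (Eventually.of_forall fun z => h f g z ζ)).trans (le_of_eq ?_)
  simp only [Pi.add_apply]
  rw [integral_const_mul, integral_add ha (hb.comp_sub_right ζ),
    integral_sub_right_eq_self (fun z => ‖(sobolevWeight σ (1 / 2) (1 / 2) z : ℂ) * f z‖ ^ 2) ζ]
  ring

/-- With the weights distributed, the integrand is m(ζ, z) A(z) times the conjugate of B(z - ζ),
where `A` and `B` are square integrable. The quotient of weights `m` is bounded by Peetre's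
inequality and tends to 1 pointwise. Continuity of translations in L² handles `B`, and dominated
convergence handles `m`. -/
theorem tendsto_crossCorr (hσ : 0 < σ)
    (hf : MemLp (fun z => (sobolevWeight σ (1 / 2) (1 / 2) z : ℂ) * f z) 2)
    (hg : MemLp (fun z => (sobolevWeight σ (-1 / 2) (-1 / 2) z : ℂ) * g z) 2) :
    Tendsto (crossCorr g f) (𝓝 0) (𝓝 (crossCorr g f 0)) := by
  obtain ⟨C, hC, hpe⟩ := exists_peetre (d := d) hσ
  set A : SpaceTime d → ℂ := fun z => (sobolevWeight σ (-1 / 2) (-1 / 2) z : ℂ) * g z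
  set B : SpaceTime d → ℂ := fun z => (sobolevWeight σ (1 / 2) (1 / 2) z : ℂ) * f z
  set m : SpaceTime d → SpaceTime d → ℝ := fun ζ z =>
    sobolevWeight σ (1 / 2) (1 / 2) z * sobolevWeight σ (-1 / 2) (-1 / 2) (z - ζ)
  have hw : ∀ z : SpaceTime d, sobolevWeight σ (1 / 2) (1 / 2) z *
      sobolevWeight σ (-1 / 2) (-1 / 2) z = 1 := fun z => by
    have h1 := sobolevWeight_mul_neg hσ (1 / 2) (1 / 2) z
    rwa [show -(1 / 2 : ℝ) = -1 / 2 by norm_num] at h1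
  have hm0 : ∀ ζ z, 0 ≤ m ζ z := fun ζ z =>
    mul_nonneg (sobolevWeight_pos hσ _ _ _).le (sobolevWeight_pos hσ _ _ _).le
  have hm : ∀ ζ z, m ζ z ≤ C * (1 + ‖ζ‖) := fun ζ z => by
    have h1 := mul_le_mul_of_nonneg_right (hpe z ζ)
      (sobolevWeight_pos hσ (-1 / 2) (-1 / 2) (z - ζ)).le
    rwa [mul_assoc _ (sobolevWeight _ _ _ _), hw, mul_one] at h1
  have hmc : ∀ z, Continuous fun ζ => m ζ z := fun z =>
    continuous_const.mul ((continuous_sobolevWeight hσ _ _).comp (continuous_const.sub continuous_id))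
  have hmc' : ∀ ζ, Continuous fun z => m ζ z := fun ζ =>
    (continuous_sobolevWeight hσ _ _).mul
      ((continuous_sobolevWeight hσ _ _).comp (continuous_id.sub continuous_const))
  have hm1 : ∀ z, m 0 z = 1 := fun z => by simp only [m, sub_zero, hw]
  have hgf : ∀ ζ z, g z * conj (f (z - ζ)) = (m ζ z : ℂ) * A z * conj (B (z - ζ)) := by
    intro ζ z
    have h1 : ((sobolevWeight σ (1 / 2) (1 / 2) z : ℝ) : ℂ) *
      ((sobolevWeight σ (-1 / 2) (-1 / 2) z : ℝ) : ℂ) = 1 := by exact_mod_cast hw z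
    have h2 : ((sobolevWeight σ (1 / 2) (1 / 2) (z - ζ) : ℝ) : ℂ) *
      ((sobolevWeight σ (-1 / 2) (-1 / 2) (z - ζ) : ℝ) : ℂ) = 1 := by exact_mod_cast hw (z - ζ)
    simp only [m, A, B, map_mul, Complex.conj_ofReal, Complex.ofReal_mul]
    linear_combination (-(g z * conj (f (z - ζ)))) * h1 -
      (sobolevWeight σ (1 / 2) (1 / 2) z * sobolevWeight σ (-1 / 2) (-1 / 2) z *
        (g z * conj (f (z - ζ)))) * h2
  have hBt : ∀ ζ, MemLp (fun z => B (z - ζ)) 2 := fun ζ =>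
    hf.comp_measurePreserving (measurePreserving_sub_right volume ζ)
  have hmA : ∀ ζ, MemLp (fun z => (m ζ z : ℂ) * A z) 2 := fun ζ =>
    hg.of_le_mul (c := C * (1 + ‖ζ‖))
      ((Complex.continuous_ofReal.comp (hmc' ζ)).aestronglyMeasurable.mul hg.1)
      (Eventually.of_forall fun z => by
        rw [norm_mul, Complex.norm_real, Real.norm_of_nonneg (hm0 ζ z)]
        exact mul_le_mul_of_nonneg_right (hm ζ z) (norm_nonneg _))
  have hconj : ∀ {D : SpaceTime d → ℂ}, MemLp D 2 → MemLp (fun z => conj (D z)) 2 :=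
    fun {D} hD => hD.of_le (Complex.continuous_conj.comp_aestronglyMeasurable hD.1)
      (Eventually.of_forall fun z => (RCLike.norm_conj _).le)
  have hsplit : ∀ ζ, crossCorr g f ζ =
      (∫ z, (m ζ z : ℂ) * A z * conj (B (z - ζ) - B z)) + ∫ z, (m ζ z : ℂ) * A z * conj (B z) := by
    intro ζ
    refine Eq.trans ?_ (integral_add ((hmA ζ).integrable_mul (hconj ((hBt ζ).sub hf)))
      ((hmA ζ).integrable_mul (hconj hf)))
    rw [crossCorr]
    congr 1 with z
    rw [hgf]
    change _ = (m ζ z : ℂ) * A z * conj (B (z - ζ) - B z) + (m ζ z : ℂ) * A z * conj (B z)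
    rw [map_sub]
    ring
  have hsecond : Tendsto (fun ζ => ∫ z, (m ζ z : ℂ) * A z * conj (B z)) (𝓝 0)
      (𝓝 (crossCorr g f 0)) := by
    have h1 : crossCorr g f 0 = ∫ z, A z * conj (B z) := by
      rw [crossCorr]
      congr 1 with z
      rw [hgf, hm1, sub_zero, Complex.ofReal_one, one_mul]
    rw [h1]
    refine tendsto_integral_filter_of_dominated_convergence
      (fun z => C * 2 * ‖A z * conj (B z)‖)
      (Eventually.of_forall fun ζ => ((hmA ζ).integrable_mul (hconj hf)).1) ?_
      ((hg.integrable_mul (hconj hf)).norm.const_mul _) (Eventually.of_forall fun z => ?_)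
    · filter_upwards [Metric.ball_mem_nhds (0 : SpaceTime d) one_pos] with ζ hζ
      refine Eventually.of_forall fun z => ?_
      rw [mul_assoc, norm_mul, Complex.norm_real, Real.norm_of_nonneg (hm0 ζ z)]
      have : ‖ζ‖ < 1 := by simpa using hζ
      exact mul_le_mul_of_nonneg_right ((hm ζ z).trans (by gcongr; linarith)) (norm_nonneg _)
    · have h2 := ((Complex.continuous_ofReal.comp (hmc z)).tendsto 0).mul_const (A z * conj (B z))
      simp only [Function.comp_apply, hm1, Complex.ofReal_one, one_mul] at h2
      exact h2.congr fun ζ => (mul_assoc _ (A z) _).symm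
  have hfirst : Tendsto (fun ζ => ∫ z, (m ζ z : ℂ) * A z * conj (B (z - ζ) - B z)) (𝓝 0)
      (𝓝 0) := by
    have hlim : Tendsto (fun ζ : SpaceTime d => C * (1 + ‖ζ‖) * ((eLpNorm A 2 volume).toReal *
        (eLpNorm (fun z => B (z - ζ) - B z) 2 volume).toReal)) (𝓝 0) (𝓝 0) := by
      have h1 := (tendsto_eLpNorm_translate_sub hf).const_mul (eLpNorm A 2 volume).toReal
      have h2 : Tendsto (fun ζ : SpaceTime d => C * (1 + ‖ζ‖)) (𝓝 0)
          (𝓝 (C * (1 + ‖(0 : SpaceTime d)‖))) :=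
        (continuous_const.mul (continuous_const.add continuous_norm)).tendsto 0
      have h3 := h2.mul h1
      rwa [mul_zero, mul_zero] at h3
    refine squeeze_zero_norm (fun ζ => ?_) hlim
    have h1 := integral_norm_mul_le hg ((hBt ζ).sub hf)
    have h2 : Integrable (fun z => ‖A z‖ * ‖B (z - ζ) - B z‖) :=
      hg.norm.integrable_mul ((hBt ζ).sub hf).norm
    calc _ ≤ ∫ z, C * (1 + ‖ζ‖) * (‖A z‖ * ‖B (z - ζ) - B z‖) :=
          norm_integral_le_of_norm_le (h2.const_mul _) (Eventually.of_forall fun z => by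
            rw [norm_mul, norm_mul, RCLike.norm_conj, Complex.norm_real,
              Real.norm_of_nonneg (hm0 ζ z), mul_assoc]
            exact mul_le_mul_of_nonneg_right (hm ζ z) (by positivity))
      _ ≤ _ := by
          rw [integral_const_mul]
          exact mul_le_mul_of_nonneg_left h1 (by positivity)
  have := hfirst.add hsecond
  rw [zero_add] at this
  exact this.congr fun ζ => (hsplit ζ).symm

end

/-! ### Inward translations at a Lipschitz boundary -/

/-- Moving in the direction `e` leaves the projection of `y` along `e` fixed and raises its height,
so points on or above the graph move strictly above it. At interior points no shift is needed. -/
theorem HasLipschitzBoundary.exists_shift {G : Set (Bdry d)} (hG : HasLipschitzBoundary G)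
    {x : Bdry d} (hx : x ∈ closure G) :
    ∃ r > 0, ∀ ε > 0, ∃ c : Bdry d, ‖c‖ < ε ∧ ∀ y ∈ Metric.ball x r, y ∈ closure G →
      y + c ∈ G := by
  by_cases hxi : x ∈ interior G
  · obtain ⟨r, hr, h⟩ := Metric.isOpen_iff.1 isOpen_interior x hxi
    exact ⟨r, hr, fun ε hε => ⟨0, by simpa using hε, fun y hy _ => by
      simpa using interior_subset (h hy)⟩⟩
  · obtain ⟨e, he, K, f, hf, r, hr, h⟩ := hG x ⟨hx, hxi⟩
    refine ⟨r / 2, by positivity, fun ε hε => ?_⟩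
    set t := min ε r / 2
    have ht : 0 < t := by positivity
    have htε : t < ε := by
      have := min_le_left ε r
      simp only [t]
      linarith
    have htr : t ≤ r / 2 := by
      have := min_le_right ε r
      simp only [t]
      linarith
    refine ⟨t • e, by rwa [norm_smul, he, mul_one, Real.norm_of_nonneg ht.le], fun y hy hyG => ?_⟩
    have hee : inner ℝ e e = (1 : ℝ) := by rw [real_inner_self_eq_norm_sq, he, one_pow]
    -- On the closure only the weak inequality survives; the shift by `t` makes it strict again. The
    -- smaller radius r/2 keeps the shifted point inside the chart.
    have hle : f (y - inner ℝ e y • e) ≤ inner ℝ e y := by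
      have hcl : IsClosed {y : Bdry d | f (y - inner ℝ e y • e) ≤ inner ℝ e y} :=
        isClosed_le (hf.continuous.comp (by fun_prop)) (by fun_prop)
      have hyr : y ∈ Metric.ball x r := Metric.ball_subset_ball (by linarith) hy
      have : y ∈ closure (Metric.ball x r ∩ G) :=
        Metric.isOpen_ball.inter_closure ⟨hyr, hyG⟩
      exact closure_minimal (fun y hy => ((h y hy.1).1 hy.2).le) hcl this
    have hmem : y + t • e ∈ Metric.ball x r := by
      rw [Metric.mem_ball, dist_eq_norm] at hy ⊢
      calc ‖y + t • e - x‖ = ‖(y - x) + t • e‖ := by congr 1; abel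
        _ ≤ ‖y - x‖ + ‖t • e‖ := norm_add_le _ _
        _ < r / 2 + r / 2 := by
          rw [norm_smul, he, mul_one, Real.norm_of_nonneg ht.le]
          linarith
        _ = r := by ring
    rw [h _ hmem, inner_add_right, real_inner_smul_right, hee, mul_one]
    have : y + t • e - (inner ℝ e y + t) • e = y - inner ℝ e y • e := by module
    rw [this]
    linarith

theorem norm_snd_le (z : SpaceTime d) : ‖z.snd‖ ≤ ‖z‖ :=
  le_of_sq_le_sq (by rw [norm_sq_eq]; nlinarith [sq_nonneg z.fst]) (norm_nonneg z)

theorem exists_shift_cylinder {G : Opens (Bdry d)} (hG : HasLipschitzBoundary (G : Set (Bdry d)))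
    {x : SpaceTime d} (hx : x.snd ∈ closure (G : Set (Bdry d))) :
    ∃ r > 0, ∀ ε > 0, ∃ c : SpaceTime d, ‖c‖ < ε ∧ ∀ y ∈ Metric.ball x r,
      y.snd ∈ closure (G : Set (Bdry d)) → y + c ∈ cylinder G := by
  obtain ⟨r, hr, h⟩ := hG.exists_shift hx
  refine ⟨r, hr, fun ε hε => ?_⟩
  obtain ⟨c, hc, h'⟩ := h ε hε
  refine ⟨WithLp.toLp 2 ((0 : ℝ), c), ?_, fun y hy hyG => h' y.snd ?_ hyG⟩
  · refine lt_of_eq_of_lt ?_ hc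
    rw [← sq_eq_sq₀ (norm_nonneg _) (norm_nonneg _), norm_sq_eq]
    simp
  · rw [Metric.mem_ball, dist_eq_norm] at hy ⊢
    exact (norm_snd_le (y - x)).trans_lt hy

/-! ### Mollification -/

/-- Convolution with a bump of mass one centred at `c` translates by about `c` and mollifies at
once. Both effects are one multiplier, bounded by 1 and tending to 1 as `c` and the radius tend to
0. -/
theorem norm_fourier_bump_le {c : SpaceTime d} (ρ : ContDiffBump c) (z : SpaceTime d) :
    ‖(𝓕 fun x => ((ρ.normed volume x : ℝ) : ℂ)) z‖ ≤ 1 ∧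
    ‖(𝓕 fun x => ((ρ.normed volume x : ℝ) : ℂ)) z - 1‖ ≤ 2 * Real.pi * (‖c‖ + ρ.rOut) * ‖z‖ := by
  have hint : Integrable (ρ.normed volume) := ρ.integrable_normed
  have hnn : ∀ x, 0 ≤ ρ.normed volume x := fun x => ρ.nonneg_normed x
  have h1 : ∫ x, ρ.normed volume x = 1 := ρ.integral_normed
  have hint' : Integrable fun x => ((ρ.normed volume x : ℝ) : ℂ) := hint.ofReal
  have hexp : ∀ x : SpaceTime d,
      ‖Complex.exp (((-2 * Real.pi * inner ℝ x z : ℝ) : ℂ) * Complex.I)‖ = 1 := fun x =>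
    Complex.norm_exp_ofReal_mul_I _
  have hint2 : Integrable fun x : SpaceTime d =>
      Complex.exp (((-2 * Real.pi * inner ℝ x z : ℝ) : ℂ) * Complex.I) •
        ((ρ.normed volume x : ℝ) : ℂ) := by
    refine hint'.bdd_mul (c := 1) ?_ (Eventually.of_forall fun x => (hexp x).le)
    exact (by fun_prop : Continuous fun x : SpaceTime d =>
      Complex.exp (((-2 * Real.pi * inner ℝ x z : ℝ) : ℂ) * Complex.I)).aestronglyMeasurable
  rw [Real.fourier_eq']
  constructor
  · refine (norm_integral_le_of_norm_le hint (Eventually.of_forall fun x => ?_)).trans h1.le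
    rw [norm_smul, hexp, one_mul, Complex.norm_real, Real.norm_of_nonneg (hnn x)]
  · have h2 : (1 : ℂ) = ∫ x, ((ρ.normed volume x : ℝ) : ℂ) := by
      rw [integral_complex_ofReal, h1, Complex.ofReal_one]
    conv_lhs => rw [h2, ← integral_sub hint2 hint']
    have h3 := norm_integral_le_of_norm_le (hint.const_mul (2 * Real.pi * (‖c‖ + ρ.rOut) * ‖z‖))
      (f := fun x => Complex.exp (((-2 * Real.pi * inner ℝ x z : ℝ) : ℂ) * Complex.I) •
        ((ρ.normed volume x : ℝ) : ℂ) - ((ρ.normed volume x : ℝ) : ℂ))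
      (Eventually.of_forall fun x => ?_)
    · rwa [integral_const_mul, h1, mul_one] at h3
    · by_cases hx : x ∈ Metric.ball c ρ.rOut
      · have h4 : ‖x‖ ≤ ‖c‖ + ρ.rOut := by
          rw [Metric.mem_ball, dist_eq_norm] at hx
          have := norm_le_norm_add_norm_sub' x c
          linarith
        rw [smul_eq_mul, ← sub_one_mul, norm_mul, Complex.norm_real, Real.norm_of_nonneg (hnn x)]
        refine mul_le_mul_of_nonneg_right ?_ (hnn x)
        rw [mul_comm _ Complex.I]
        refine (Real.norm_exp_I_mul_ofReal_sub_one_le).trans ?_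
        rw [Real.norm_eq_abs, abs_mul, abs_mul, abs_neg, abs_two, abs_of_pos Real.pi_pos,
          mul_assoc _ _ ‖z‖]
        refine mul_le_mul_of_nonneg_left ((abs_real_inner_le_norm x z).trans ?_) (by positivity)
        exact mul_le_mul_of_nonneg_right h4 (norm_nonneg _)
      · have : ρ.normed volume x = 0 := by
          rw [← ρ.support_normed_eq (μ := volume)] at hx
          exact Function.notMem_support.1 hx
        simp [this]

/-- A compactly supported function that can be translated into the cylinder by arbitrarily small
vectors is approximated by test functions on the cylinder. -/
theorem re_integral_fourier_mem {G : Opens (Bdry d)} {g : SpaceTime d → ℂ} {P : Prop} {S : Set ℝ}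
    (hS : IsClosed S) (hmem : ∀ ψ : 𝓓(cylinder G, ℝ), (P → ∀ z, 0 ≤ ψ z) →
      (∫ z, g z * (𝓕⁻ (toSchwartz (extend ψ))) z).re ∈ S)
    {U : SpaceTime d → ℝ} (hU : Integrable U) {K : Set (SpaceTime d)} (hK : IsCompact K)
    (hUK : ∀ x ∉ K, U x = 0)
    (hshift : ∀ ε > 0, ∃ c : SpaceTime d, ‖c‖ < ε ∧ ∀ y ∈ K, y + c ∈ cylinder G)
    (hpos : P → ∀ φ : Test d, (∀ x, 0 ≤ φ x) → 0 ≤ ∫ x, φ x * U x)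
    (hgm : Integrable (fun z => g z * conj ((𝓕 fun x => ((U x : ℝ) : ℂ)) z))) :
    (∫ z, g z * conj ((𝓕 fun x => ((U x : ℝ) : ℂ)) z)).re ∈ S := by
  set F := 𝓕 fun x => ((U x : ℝ) : ℂ)
  have key : ∀ n : ℕ, ∃ m : SpaceTime d → ℂ, Continuous m ∧ (∀ z, ‖m z‖ ≤ 1) ∧
      (∀ z, ‖m z - 1‖ ≤ 2 * Real.pi * (2 / ((n : ℝ) + 1)) * ‖z‖) ∧
      (∫ z, g z * conj (m z * F z)).re ∈ S := by
    intro n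
    have hn : (0 : ℝ) < 1 / ((n : ℝ) + 1) := by positivity
    obtain ⟨c, hc, hcK⟩ := hshift _ hn
    have hKc : IsCompact ((fun y => y + c) '' K) := hK.image (by fun_prop)
    obtain ⟨δ, hδ, hδK⟩ := hKc.exists_thickening_subset_open (cylinder G).isOpen
      (Set.image_subset_iff.2 hcK)
    set ε := min δ (1 / ((n : ℝ) + 1)) / 2
    have hε : 0 < ε := by positivity
    have hεδ : ε < δ := by
      have := min_le_left δ (1 / ((n : ℝ) + 1))
      simp only [ε]
      linarith
    have hεn : ε < 1 / ((n : ℝ) + 1) := by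
      have := min_le_right δ (1 / ((n : ℝ) + 1))
      simp only [ε]
      linarith
    let ρ : ContDiffBump c := ⟨ε / 2, ε, by positivity, by linarith⟩
    set ψ : SpaceTime d → ℝ :=
      convolution (ρ.normed volume) U (ContinuousLinearMap.mul ℝ ℝ) volume
    have hρc : HasCompactSupport (ρ.normed volume) := ρ.hasCompactSupport_normed
    have hψd : ContDiff ℝ ∞ ψ :=
      hρc.contDiff_convolution_left _ ρ.contDiff_normed hU.locallyIntegrable
    have hcpt : IsCompact (Metric.closedBall c ε + K) := (isCompact_closedBall c ε).add hK
    -- The support lies within ε of K + c, a compact subset of the cylinder whose δ-thickening is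
    -- still inside it; this is why ε < δ.
    have hsub : tsupport ψ ⊆ Metric.closedBall c ε + K := by
      refine closure_minimal ((support_convolution_subset _).trans
        (Set.add_subset_add ?_ fun x hx => ?_)) hcpt.isClosed
      · rw [ρ.support_normed_eq]
        exact Metric.ball_subset_closedBall
      · by_contra h
        exact hx (hUK x h)
    have hψc : HasCompactSupport ψ := hcpt.of_isClosed_subset (isClosed_tsupport _) hsub
    have hsubQ : tsupport ψ ⊆ cylinder G := by
      refine hsub.trans (Set.Subset.trans ?_ hδK)
      rintro _ ⟨b, hb, k, hk, rfl⟩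
      rw [Metric.mem_thickening_iff]
      refine ⟨k + c, ⟨k, hk, rfl⟩, ?_⟩
      rw [Metric.mem_closedBall] at hb
      change dist (b + k) (k + c) < δ
      rw [add_comm b k, dist_add_left]
      linarith
    have hψ0 : P → ∀ z, 0 ≤ ψ z := by
      intro hP z
      have hd : ContDiff ℝ ∞ fun x => ρ.normed volume (z - x) :=
        ρ.contDiff_normed.comp (contDiff_const.sub contDiff_id)
      have hs : HasCompactSupport fun x => ρ.normed volume (z - x) :=
        hρc.comp_homeomorph (Homeomorph.subLeft z)
      have h1 := hpos hP (mkTest _ hd hs) fun x => ρ.nonneg_normed _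
      refine h1.trans_eq ?_
      simp only [ψ, mkTest_apply]
      rw [convolution_eq_swap]
      rfl
    refine ⟨𝓕 fun x => ((ρ.normed volume x : ℝ) : ℂ), ?_, fun z => (norm_fourier_bump_le ρ z).1,
      fun z => (norm_fourier_bump_le ρ z).2.trans ?_, ?_⟩
    · have h1 : Integrable fun x => ((ρ.normed volume x : ℝ) : ℂ) :=
        ρ.integrable_normed.ofReal
      exact VectorFourier.fourierIntegral_continuous Real.continuous_fourierChar
        (L := innerₗ (SpaceTime d)) continuous_inner h1
    · gcongr
      have : (2 : ℝ) / (n + 1) = 1 / (n + 1) + 1 / (n + 1) := by ring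
      rw [this]
      exact (add_le_add hc.le hεn.le)
    · have hT : tsupport (mkTest ψ hψd hψc) ⊆ cylinder G := hsubQ
      have h1 := hmem (ofSubset (mkTest ψ hψd hψc) hT) hψ0
      rw [extend_ofSubset] at h1
      convert h1 using 4 with z
      rw [← conj_fourier_toSchwartz, SchwartzMap.fourier_coe]
      congr 1
      have h2 : ⇑(toSchwartz (mkTest ψ hψd hψc)) = convolution
          (fun x => ((ρ.normed volume x : ℝ) : ℂ)) (fun x => ((U x : ℝ) : ℂ))
          (ContinuousLinearMap.mul ℂ ℂ) volume := by
        funext x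
        rw [toSchwartz_apply, mkTest_apply]
        simp only [ψ, convolution_def]
        rw [← integral_complex_ofReal]
        simp
      have hρi : Integrable fun x => ((ρ.normed volume x : ℝ) : ℂ) := ρ.integrable_normed.ofReal
      have h3 := Real.fourier_mul_convolution_eq hρi hU.ofReal z
      rw [h2]
      exact congrArg conj h3.symm
  choose m hmc hm1 hm2 hmS using key
  have hlim : Tendsto (fun n => ∫ z, g z * conj (m n z * F z)) atTop
      (𝓝 (∫ z, g z * conj (F z))) := by
    -- The multipliers are bounded by 1, so the integrable limit serves as its own majorant.
    refine tendsto_integral_of_dominated_convergence (fun z => ‖g z * conj (F z)‖)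
      (fun n => ?_) hgm.norm (fun n => Eventually.of_forall fun z => ?_)
      (Eventually.of_forall fun z => ?_)
    · refine (((Complex.continuous_conj.comp (hmc n)).aestronglyMeasurable).mul hgm.1).congr
        (Eventually.of_forall fun z => ?_)
      simp only [Pi.mul_apply, Function.comp_apply, map_mul]
      ring
    · rw [map_mul, mul_left_comm, norm_mul, RCLike.norm_conj]
      exact mul_le_of_le_one_left (norm_nonneg _) (hm1 n z)
    · have h1 : Tendsto (fun n : ℕ => 2 * Real.pi * (2 / ((n : ℝ) + 1)) * ‖z‖) atTop (𝓝 0) := by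
        have h2 := ((tendsto_one_div_add_atTop_nhds_zero_nat (𝕜 := ℝ)).const_mul
          (2 * Real.pi * 2)).mul_const ‖z‖
        rw [mul_zero, zero_mul] at h2
        refine h2.congr fun n => ?_
        ring
      have h3 : Tendsto (fun n => m n z) atTop (𝓝 1) :=
        tendsto_iff_norm_sub_tendsto_zero.2 (squeeze_zero (fun n => norm_nonneg _)
          (fun n => hm2 n z) h1)
      have h4 := ((Complex.continuous_conj.tendsto _).comp (h3.mul_const (F z))).const_mul (g z)
      rw [one_mul] at h4
      exact h4
  exact hS.mem_of_tendsto ((Complex.continuous_re.tendsto _).comp hlim)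
    (Eventually.of_forall hmS)

/-! ### Density of test functions on the cylinder -/

/-- The test function `x ↦ θ (x / (n + 1))`. -/
def dilate (θ : Test d) (n : ℕ) : Test d :=
  mkTest (fun x => θ (((n : ℝ) + 1)⁻¹ • x)) (θ.contDiff.comp (contDiff_const_smul _))
    (θ.hasCompactSupport.comp_homeomorph (Homeomorph.smulOfNeZero ((n : ℝ) + 1)⁻¹ (by positivity)))

theorem fourier_dilate (θ : Test d) (n : ℕ) (ζ : SpaceTime d) :
    (𝓕 (toSchwartz (dilate θ n))) ζ =
      (((((n : ℝ) + 1) ^ Module.finrank ℝ (SpaceTime d) : ℝ)) : ℂ) *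
        (𝓕 (toSchwartz θ)) (((n : ℝ) + 1) • ζ) := by
  have hn : (n : ℝ) + 1 ≠ 0 := by positivity
  have h := Measure.integral_comp_inv_smul volume (fun x : SpaceTime d =>
    Complex.exp (((-2 * Real.pi * inner ℝ x (((n : ℝ) + 1) • ζ) : ℝ) : ℂ) * Complex.I) •
      ((θ x : ℝ) : ℂ)) ((n : ℝ) + 1)
  rw [SchwartzMap.fourier_coe, SchwartzMap.fourier_coe, Real.fourier_eq', Real.fourier_eq']
  rw [abs_of_pos (by positivity), Complex.real_smul] at h
  refine Eq.trans ?_ h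
  congr 1 with x
  rw [real_inner_smul_left, real_inner_smul_right, inv_mul_cancel_left₀ hn]
  rfl

/-- The transforms of the dilated cutoffs form an approximate identity: they are rescalings of `k`,
whose integral is θ(0) = 1. Rescaling gives the integral of conj k(ζ) against the correlation at
ζ/(n + 1). Linear growth provides the majorant and continuity at 0 the limit. -/
theorem tendsto_integral_dilate {σ : ℝ} {f g : SpaceTime d → ℂ} (hσ : 0 < σ)
    (hf : MemLp (fun z => (sobolevWeight σ (1 / 2) (1 / 2) z : ℂ) * f z) 2)
    (hg : MemLp (fun z => (sobolevWeight σ (-1 / 2) (-1 / 2) z : ℂ) * g z) 2) {θ : Test d}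
    (hθ : θ 0 = 1) :
    Tendsto (fun n => ∫ ζ, conj ((𝓕 (toSchwartz (dilate θ n))) ζ) * crossCorr g f ζ) atTop
      (𝓝 (crossCorr g f 0)) := by
  obtain ⟨M, hM, hH⟩ := exists_norm_crossCorr_le hσ hf hg
  set k : 𝓢(SpaceTime d, ℂ) := 𝓕 (toSchwartz θ)
  set Φ : ℕ → SpaceTime d → ℂ := fun n ζ => conj (k ζ) * crossCorr g f (((n : ℝ) + 1)⁻¹ • ζ)
  have hΦ : ∀ (n : ℕ) (ζ : SpaceTime d), conj ((𝓕 (toSchwartz (dilate θ n))) ζ) * crossCorr g f ζ =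
      (((n : ℝ) + 1) ^ Module.finrank ℝ (SpaceTime d) : ℝ) • Φ n (((n : ℝ) + 1) • ζ) := by
    intro n ζ
    have hn : (n : ℝ) + 1 ≠ 0 := by positivity
    simp only [Φ]
    rw [fourier_dilate, map_mul, Complex.conj_ofReal, inv_smul_smul₀ hn, Complex.real_smul,
      mul_assoc]
  have hΦi : ∀ n, Integrable (Φ n) := fun n => by
    have hn : (n : ℝ) + 1 ≠ 0 := by positivity
    have h1 := (integral_mul_conj_convolution hσ hf hg (𝓕 (toSchwartz (dilate θ n)))).2.1
    simp only [hΦ] at h1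
    have h2 := (h1.smul (((n : ℝ) + 1) ^ Module.finrank ℝ (SpaceTime d) : ℝ)⁻¹).comp_smul
      (inv_ne_zero hn)
    refine h2.congr (Eventually.of_forall fun ζ => ?_)
    simp only [Pi.smul_apply]
    rw [inv_smul_smul₀ (pow_ne_zero _ hn), smul_inv_smul₀ hn]
  have heq : ∀ n, ∫ ζ, conj ((𝓕 (toSchwartz (dilate θ n))) ζ) * crossCorr g f ζ = ∫ ζ, Φ n ζ := by
    intro n
    have hn : (0 : ℝ) < ((n : ℝ) + 1) ^ Module.finrank ℝ (SpaceTime d) := by positivity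
    simp only [hΦ]
    rw [integral_smul, Measure.integral_comp_smul, abs_of_pos (by positivity), smul_inv_smul₀ hn.ne']
  simp only [heq]
  have hk : ∫ ζ, k ζ = 1 := by
    have h1 : (𝓕⁻ k) 0 = toSchwartz θ 0 := by
      rw [FourierTransform.fourierInv_fourier_eq]
    rw [toSchwartz_apply, hθ, SchwartzMap.fourierInv_coe, Real.fourierInv_eq'] at h1
    simpa using h1
  have hlim : crossCorr g f 0 = ∫ ζ, conj (k ζ) * crossCorr g f 0 := by
    rw [integral_mul_const, integral_conj, hk, map_one, one_mul]
  rw [hlim]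
  have hkb : Integrable fun ζ : SpaceTime d => ‖k ζ‖ * (M * (1 + ‖ζ‖)) := by
    have h0 := k.integrable_pow_mul volume 0
    have h1 := k.integrable_pow_mul volume 1
    refine ((h0.add h1).const_mul M).congr (Eventually.of_forall fun ζ => ?_)
    simp only [Pi.add_apply]
    ring
  refine tendsto_integral_of_dominated_convergence _ (fun n => (hΦi n).1) hkb
    (fun n => Eventually.of_forall fun ζ => ?_) (Eventually.of_forall fun ζ => ?_)
  · simp only [Φ]
    rw [norm_mul, RCLike.norm_conj]
    refine mul_le_mul_of_nonneg_left ((hH _).trans ?_) (norm_nonneg _)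
    gcongr
    rw [norm_smul, norm_inv]
    refine mul_le_of_le_one_left (norm_nonneg _) (inv_le_one_of_one_le₀ ?_)
    rw [Real.norm_of_nonneg (by positivity)]
    have : (0 : ℝ) ≤ n := Nat.cast_nonneg n
    linarith
  · refine (Tendsto.comp (tendsto_crossCorr hσ hf hg) ?_).const_mul _
    have h1 : Tendsto (fun n : ℕ => ((n : ℝ) + 1)⁻¹ • ζ) atTop (𝓝 ((0 : ℝ) • ζ)) := by
      refine Tendsto.smul_const ?_ ζ
      simpa using tendsto_one_div_add_atTop_nhds_zero_nat (𝕜 := ℝ)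
    rwa [zero_smul] at h1

/-- Functions in a space supported in `ℝ × closure G` are approximated by test functions on the
cylinder `ℝ × G`, and nonnegative ones by nonnegative test functions. -/
theorem re_integral_conj_mem {σ : ℝ} (hσ : 0 < σ) {G : Opens (Bdry d)}
    (hG : HasLipschitzBoundary (G : Set (Bdry d))) {v : Dist d} {f g : SpaceTime d → ℂ}
    (hv : SuppIn v {z | z.snd ∈ closure (G : Set (Bdry d))}) (hvf : IsFourierLaplace σ v f)
    (hf : MemLp (fun z => (sobolevWeight σ (1 / 2) (1 / 2) z : ℂ) * f z) 2)
    (hg : MemLp (fun z => (sobolevWeight σ (-1 / 2) (-1 / 2) z : ℂ) * g z) 2)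
    {S : AddSubmonoid ℝ} (hS : IsClosed (S : Set ℝ))
    (hmem : ∀ ψ : 𝓓(cylinder G, ℝ), (IsNonneg v → ∀ z, 0 ≤ ψ z) →
      (∫ z, g z * (𝓕⁻ (toSchwartz (extend ψ))) z).re ∈ S) :
    (∫ z, g z * conj (f z)).re ∈ S := by
  set C : Set (SpaceTime d) := {z | z.snd ∈ closure (G : Set (Bdry d))}
  have hC : IsClosed C := isClosed_closure.preimage continuous_snd
  -- With both orders nonnegative, e^{-σt} v is an honest L² function, so cutoffs and translations
  -- can be made pointwise.
  have hf2 : MemLp f 2 := by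
    have h1 := memLp_sobolevWeight_mono hσ (by norm_num : (0 : ℝ) ≤ 1 / 2)
      (by norm_num : (0 : ℝ) ≤ 1 / 2) hf
    simpa only [sobolevWeight_zero, Complex.ofReal_one, one_mul] using h1
  obtain ⟨V, hV, hVC, hVf⟩ := exists_real_density hvf hf2 hC hv
  have hVi : ∀ η : Test d, Integrable fun x => η x * V x := fun η => by
    have h1 := (hV.locallyIntegrable one_le_two).integrable_smul_left_of_hasCompactSupport
      η.continuous η.hasCompactSupport
    exact h1
  set F : Test d → SpaceTime d → ℂ := fun η => 𝓕 fun x => ((η x * V x : ℝ) : ℂ)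
  have hF : ∀ η, Integrable (fun z => g z * conj (F η z)) ∧ ∫ z, g z * conj (F η z) =
      ∫ ζ, conj ((𝓕 (toSchwartz η)) ζ) * crossCorr g f ζ := fun η => by
    obtain ⟨h1, -, h3⟩ := integral_mul_conj_convolution hσ hf hg (𝓕 (toSchwartz η))
    simp only [← fourier_cutoff hVf] at h1 h3
    exact ⟨h1, h3⟩
  have hpos : IsNonneg v → ∀ φ : Test d, (∀ x, 0 ≤ φ x) → 0 ≤ ∫ x, φ x * V x := by
    intro hvn φ hφ
    have h1 : ((∫ x, φ x * V x : ℝ) : ℂ) = ((v (expMul (-σ) φ) : ℝ) : ℂ) := by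
      rw [← hvf.integral_eq, ← hVf, ← integral_complex_ofReal]
      congr 1 with x
      rw [toSchwartz_apply, mul_comm, Complex.ofReal_mul]
    rw [Complex.ofReal_inj.1 h1]
    exact hvn _ (expMul_nonneg hφ)
  -- If one small vector moves all of supp η ∩ C into the cylinder, translation and mollification
  -- suffice.
  have hlocal : ∀ η : Test d, (∀ x, 0 ≤ η x) → (∀ ε > 0, ∃ c : SpaceTime d, ‖c‖ < ε ∧
      ∀ y ∈ tsupport η ∩ C, y + c ∈ cylinder G) → (∫ z, g z * conj (F η z)).re ∈ S := by
    intro η hη hshift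
    refine re_integral_fourier_mem hS hmem (hVi η) (η.hasCompactSupport.isCompact.inter_right hC)
      (fun x hx => ?_) hshift (fun hvn φ hφ => ?_) (hF η).1
    · by_cases h : x ∈ C
      · rw [image_eq_zero_of_notMem_tsupport fun h' => hx ⟨h', h⟩, zero_mul]
      · rw [hVC x h, mul_zero]
    · have hd : ContDiff ℝ ∞ fun x => φ x * η x := φ.contDiff.mul η.contDiff
      have hs : HasCompactSupport fun x => φ x * η x := φ.hasCompactSupport.mul_right
      have h1 := hpos hvn (mkTest _ hd hs) fun x => mul_nonneg (hφ x) (hη x)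
      simpa only [mkTest_apply, mul_assoc] using h1
  have hglobal : ∀ η : Test d, (∀ x, 0 ≤ η x) → (∫ z, g z * conj (F η z)).re ∈ S := by
    intro η hη
    have hK : IsCompact (tsupport η ∩ C) := η.hasCompactSupport.isCompact.inter_right hC
    have hsh : ∀ x : SpaceTime d, ∃ r > 0, x ∈ C → ∀ ε > 0, ∃ c : SpaceTime d, ‖c‖ < ε ∧
        ∀ y ∈ Metric.ball x r, y ∈ C → y + c ∈ cylinder G := fun x => by
      by_cases hx : x ∈ C
      · obtain ⟨r, hr, h⟩ := exists_shift_cylinder hG hx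
        exact ⟨r, hr, fun _ => h⟩
      · exact ⟨1, one_pos, fun h => absurd h hx⟩
    choose r hr hsh using hsh
    obtain ⟨t, htK, ht⟩ := hK.elim_nhds_subcover (fun x => Metric.ball x (r x))
      fun x _ => Metric.ball_mem_nhds x (hr x)
    -- The admissible shift direction depends on the boundary chart, hence the splitting into
    -- finitely many pieces.
    obtain ⟨p, hp⟩ := SmoothPartitionOfUnity.exists_isSubordinate 𝓘(ℝ, SpaceTime d) hK.isClosed
      (fun i : t => Metric.ball (i : SpaceTime d) (r i)) (fun i => Metric.isOpen_ball)
      (fun x hx => by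
        obtain ⟨i, hi, hxi⟩ := Set.mem_iUnion₂.1 (ht hx)
        exact Set.mem_iUnion.2 ⟨⟨i, hi⟩, hxi⟩)
    have hpd : ∀ i : t, ContDiff ℝ ∞ fun x => p i x * η x := fun i =>
      (p i).contMDiff.contDiff.mul η.contDiff
    have hps : ∀ i : t, HasCompactSupport fun x => p i x * η x := fun i =>
      η.hasCompactSupport.mul_left
    set E : t → Test d := fun i => mkTest _ (hpd i) (hps i)
    have hsum : ∀ x, ((η x * V x : ℝ) : ℂ) = ∑ i, ((E i x * V x : ℝ) : ℂ) := by
      intro x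
      by_cases hx : x ∈ tsupport η ∩ C
      · have h1 := p.sum_eq_one hx
        rw [finsum_eq_sum_of_fintype] at h1
        rw [← Complex.ofReal_sum]
        congr 1
        simp only [E, mkTest_apply]
        rw [← Finset.sum_mul, ← Finset.sum_mul, h1, one_mul]
      · have h1 : η x * V x = 0 := by
          by_cases h : x ∈ C
          · rw [image_eq_zero_of_notMem_tsupport fun h' => hx ⟨h', h⟩, zero_mul]
          · rw [hVC x h, mul_zero]
        simp only [E, mkTest_apply, mul_assoc, h1, mul_zero, Complex.ofReal_zero,
          Finset.sum_const_zero]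
    have hFsum : ∀ z, F η z = ∑ i, F (E i) z := by
      intro z
      simp only [F, Real.fourier_eq, hsum, Finset.smul_sum]
      exact integral_finsetSum _ fun i _ => (Real.fourierIntegral_convergent_iff z).2 (hVi (E i)).ofReal
    have h1 : (∫ z, g z * conj (F η z)).re = ∑ i, (∫ z, g z * conj (F (E i) z)).re := by
      rw [← Complex.re_sum, ← integral_finsetSum _ fun i _ => (hF (E i)).1]
      simp only [hFsum, map_sum, Finset.mul_sum]
    rw [h1]
    -- Only closure under addition is used here, and closedness in the limits. So the same argument
    -- serves {0}, for independence of the extension, and [0, ∞), for positivity.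
    refine sum_mem fun i _ => hlocal _ (fun x => mul_nonneg (p.nonneg i x) (hη x)) fun ε hε => ?_
    obtain ⟨c, hc, h⟩ := hsh i (htK i i.2).2 ε hε
    refine ⟨c, hc, fun y hy => h y (hp i ?_) hy.2⟩
    exact closure_mono (Function.support_mul_subset_left _ _) hy.1
  let χ : ContDiffBump (0 : SpaceTime d) := ⟨1, 2, one_pos, one_lt_two⟩
  let θ : Test d := mkTest χ χ.contDiff χ.hasCompactSupport
  have hθ : θ 0 = 1 := χ.one_of_mem_closedBall (Metric.mem_closedBall_self zero_le_one)
  have hlim := tendsto_integral_dilate hσ hf hg hθ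
  simp only [← (hF _).2] at hlim
  have h0 : crossCorr g f 0 = ∫ z, g z * conj (f z) := by simp only [crossCorr, sub_zero]
  rw [h0] at hlim
  exact hS.mem_of_tendsto ((Complex.continuous_re.tendsto _).comp hlim)
    (Eventually.of_forall fun n => hglobal _ fun x => χ.nonneg)

/-! ### The duality pairing -/

theorem MemH.memLp {σ s r : ℝ} {u : Dist d} (hu : MemH σ s r u) {f : SpaceTime d → ℂ}
    (hf : IsFourierLaplace σ u f) : MemLp (fun z => (sobolevWeight σ s r z : ℂ) * f z) 2 := by
  obtain ⟨-, k, hk, hm⟩ := hu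
  refine hm.ae_eq ?_
  filter_upwards [hk.ae_unique hf] with z hz
  rw [hz]

theorem MemH.isFourierLaplace {σ s r : ℝ} {u : Dist d} (hu : MemH σ s r u) :
    IsFourierLaplace σ u (fourierLaplace σ u) :=
  let ⟨_, _, hk, _⟩ := hu
  fourierLaplace_spec hk

theorem memLp_conj {h : SpaceTime d → ℂ} (hh : MemLp h 2) : MemLp (fun z => conj (h z)) 2 :=
  hh.of_le (Complex.continuous_conj.comp_aestronglyMeasurable hh.1)
    (Eventually.of_forall fun _ => (RCLike.norm_conj _).le)

theorem integrable_mul_conj {σ : ℝ} (hσ : 0 < σ) {f g : SpaceTime d → ℂ}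
    (hf : MemLp (fun z => (sobolevWeight σ (1 / 2) (1 / 2) z : ℂ) * f z) 2)
    (hg : MemLp (fun z => (sobolevWeight σ (-1 / 2) (-1 / 2) z : ℂ) * g z) 2) :
    Integrable (fun z => g z * conj (f z)) := by
  refine (hg.integrable_mul (memLp_conj hf)).congr (Eventually.of_forall fun z => ?_)
  have h1 := sobolevWeight_mul_neg hσ (1 / 2) (1 / 2) z
  rw [show -(1 / 2 : ℝ) = -1 / 2 by norm_num] at h1
  have h2 : ((sobolevWeight σ (1 / 2) (1 / 2) z : ℝ) : ℂ) *
      ((sobolevWeight σ (-1 / 2) (-1 / 2) z : ℝ) : ℂ) = 1 := by exact_mod_cast h1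
  simp only [Pi.mul_apply, map_mul, Complex.conj_ofReal]
  linear_combination (g z * conj (f z)) * h2

/-- The test function `e^{a t} ψ` on the cylinder. -/
def expMulOn {G : Opens (Bdry d)} (a : ℝ) (ψ : 𝓓(cylinder G, ℝ)) : 𝓓(cylinder G, ℝ) :=
  ofSubset (expMul a (extend ψ)) ((tsupport_expMul a _).trans_subset (tsupport_extend ψ))

theorem integral_fourierInv_extend {σ : ℝ} {G : Opens (Bdry d)} {L : Dist d}
    {g : SpaceTime d → ℂ} (hg : IsFourierLaplace σ L g) (ψ : 𝓓(cylinder G, ℝ)) :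
    ∫ z, g z * (𝓕⁻ (toSchwartz (extend ψ))) z =
      ((restrict G L (expMulOn (-σ) ψ) : ℝ) : ℂ) := by
  rw [hg.integral_eq, restrict_apply, expMulOn, extend_ofSubset]

section

variable {σ : ℝ} {G : Opens (Bdry d)}

/-- The difference of two extensions annihilates all test functions on the cylinder, so density with
`S = ⊥` shows that it pairs to zero with `v`. This frees the pairing from the arbitrary choices of
extension and transform. -/
theorem pairing_eq (hσ : 0 < σ) (hG : HasLipschitzBoundary (G : Set (Bdry d))) {L v : Dist d}
    {f g : SpaceTime d → ℂ} (hL : MemH σ (-1 / 2) (-1 / 2) L) (hg : IsFourierLaplace σ L g)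
    (hv : MemHTilde σ (1 / 2) (1 / 2) G v) (hf : IsFourierLaplace σ v f) :
    pairing σ G (restrict G L) v = (∫ z, g z * conj (f z)).re := by
  have hex : ∃ L' : Dist d, MemH σ (-1 / 2) (-1 / 2) L' ∧ restrict G L' = restrict G L :=
    ⟨L, hL, rfl⟩
  obtain ⟨hL', hr⟩ := hex.choose_spec
  rw [pairing, dif_pos hex]
  set L' := hex.choose
  have hg' := hL'.isFourierLaplace
  have h1 : ∫ z, fourierLaplace σ L' z * conj (fourierLaplace σ v z) =
      ∫ z, fourierLaplace σ L' z * conj (f z) := by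
    refine integral_congr_ae ?_
    filter_upwards [hf.fourierLaplace_ae_eq] with z hz
    rw [hz]
  have hfm := hv.1.memLp hf
  have hmem := re_integral_conj_mem hσ hG (S := ⊥) (g := fourierLaplace σ L' - g) hv.2 hf hfm
    ((hL'.sub hL).memLp (hg'.sub hg)) (by simp) fun ψ _ => by
      rw [integral_fourierInv_extend (hg'.sub hg), map_sub, hr, sub_self]
      simp
  rw [AddSubmonoid.mem_bot] at hmem
  have h2 : ∫ z, (fourierLaplace σ L' - g) z * conj (f z) =
      (∫ z, fourierLaplace σ L' z * conj (f z)) - ∫ z, g z * conj (f z) := by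
    rw [← integral_sub (integrable_mul_conj hσ hfm (hL'.memLp hg'))
      (integrable_mul_conj hσ hfm (hL.memLp hg))]
    simp only [Pi.sub_apply, sub_mul]
  rw [h2, Complex.sub_re, sub_eq_zero] at hmem
  rw [h1, hmem]

/-- This is the density theorem with S = [0, ∞): `v` is approximated by nonnegative test functions,
and the factor e^{-σt} preserves signs. -/
theorem pairing_nonneg (hσ : 0 < σ) (hG : HasLipschitzBoundary (G : Set (Bdry d)))
    {l : DistOn G} {v : Dist d} (hl : MemHRestr σ (-1 / 2) (-1 / 2) G l) (hl0 : IsNonneg l)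
    (hv : MemHTilde σ (1 / 2) (1 / 2) G v) (hv0 : IsNonneg v) : 0 ≤ pairing σ G l v := by
  obtain ⟨L, hL, rfl⟩ := hl
  rw [pairing_eq hσ hG hL hL.isFourierLaplace hv hv.1.isFourierLaplace]
  refine re_integral_conj_mem hσ hG (S := AddSubmonoid.nonneg ℝ) hv.2 hv.1.isFourierLaplace
    (hv.1.memLp hv.1.isFourierLaplace) (hL.memLp hL.isFourierLaplace) isClosed_Ici fun ψ hψ => ?_
  rw [integral_fourierInv_extend hL.isFourierLaplace, Complex.ofReal_re]
  exact hl0 _ (expMul_nonneg (hψ hv0))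

theorem pairing_sub_right (hσ : 0 < σ) (hG : HasLipschitzBoundary (G : Set (Bdry d)))
    {l : DistOn G} {v w : Dist d} (hl : MemHRestr σ (-1 / 2) (-1 / 2) G l)
    (hv : MemHTilde σ (1 / 2) (1 / 2) G v) (hw : MemHTilde σ (1 / 2) (1 / 2) G w) :
    pairing σ G l (v - w) = pairing σ G l v - pairing σ G l w := by
  obtain ⟨L, hL, rfl⟩ := hl
  have hv' := hv.1.isFourierLaplace
  have hw' := hw.1.isFourierLaplace
  have hL' := hL.isFourierLaplace
  rw [pairing_eq hσ hG hL hL' hv hv', pairing_eq hσ hG hL hL' hw hw',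
    pairing_eq hσ hG hL hL' (hv.sub hw) (hv'.sub hw'), ← Complex.sub_re,
    ← integral_sub (integrable_mul_conj hσ (hv.1.memLp hv') (hL.memLp hL'))
      (integrable_mul_conj hσ (hw.1.memLp hw') (hL.memLp hL'))]
  simp only [Pi.sub_apply, map_sub, mul_sub]

theorem pairing_sub_left (hσ : 0 < σ) (hG : HasLipschitzBoundary (G : Set (Bdry d)))
    {l m : DistOn G} {v : Dist d} (hl : MemHRestr σ (-1 / 2) (-1 / 2) G l)
    (hm : MemHRestr σ (-1 / 2) (-1 / 2) G m) (hv : MemHTilde σ (1 / 2) (1 / 2) G v) :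
    pairing σ G (l - m) v = pairing σ G l v - pairing σ G m v := by
  obtain ⟨L, hL, rfl⟩ := hl
  obtain ⟨M, hM, rfl⟩ := hm
  have hv' := hv.1.isFourierLaplace
  have hL' := hL.isFourierLaplace
  have hM' := hM.isFourierLaplace
  rw [← map_sub, pairing_eq hσ hG hL hL' hv hv', pairing_eq hσ hG hM hM' hv hv',
    pairing_eq hσ hG (hL.sub hM) (hL'.sub hM') hv hv', ← Complex.sub_re,
    ← integral_sub (integrable_mul_conj hσ (hv.1.memLp hv') (hL.memLp hL'))
      (integrable_mul_conj hσ (hv.1.memLp hv') (hM.memLp hM'))]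
  simp only [Pi.sub_apply, sub_mul]

theorem memHTilde_ofTest (hσ : 0 < σ) (s r : ℝ) {φ : Test d}
    (h0 : tsupport φ ⊆ {z | 0 ≤ z.fst}) (hG : tsupport φ ⊆ cylinder G) :
    MemHTilde σ s r G (ofTest φ) :=
  ⟨memH_ofTest hσ s r h0, suppIn_ofTest (hG.trans fun _ hz => subset_closure hz)⟩

/-- The weight e^{-2σt} is the product of the factors e^{-σt} in the transforms of `l` and of `φ`.
-/
theorem pairing_ofTest_right (hσ : 0 < σ) (hG : HasLipschitzBoundary (G : Set (Bdry d)))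
    {l : DistOn G} (hl : MemHRestr σ (-1 / 2) (-1 / 2) G l) {φ : Test d}
    (h0 : tsupport φ ⊆ {z | 0 ≤ z.fst}) (hφ : tsupport φ ⊆ cylinder G) :
    pairing σ G l (ofTest φ) = l (expMulOn (-(2 * σ)) (ofSubset φ hφ)) := by
  obtain ⟨L, hL, rfl⟩ := hl
  rw [pairing_eq hσ hG hL hL.isFourierLaplace (memHTilde_ofTest hσ _ _ h0 hφ)
    (isFourierLaplace_ofTest σ φ)]
  simp only [conj_fourier_toSchwartz]
  rw [hL.isFourierLaplace.integral_eq, Complex.ofReal_re, expMul_expMul, restrict_apply, expMulOn,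
    extend_ofSubset, extend_ofSubset]
  congr 2
  ring

theorem pairing_restrict_ofTest (hσ : 0 < σ) (hG : HasLipschitzBoundary (G : Set (Bdry d)))
    {φ : Test d} (h0 : tsupport φ ⊆ {z | 0 ≤ z.fst}) {u : Dist d}
    (hu : MemHTilde σ (1 / 2) (1 / 2) G u) :
    pairing σ G (restrict G (ofTest φ)) u = u (expMul (-(2 * σ)) φ) := by
  have hu' := hu.1.isFourierLaplace
  rw [pairing_eq hσ hG (memH_ofTest hσ _ _ h0) (isFourierLaplace_ofTest σ φ) hu hu',
    ← Complex.conj_re, ← integral_conj]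
  simp only [map_mul, conj_fourier_toSchwartz, Complex.conj_conj]
  simp only [mul_comm _ (fourierLaplace σ u _)]
  rw [hu'.integral_eq, Complex.ofReal_re, expMul_expMul]
  congr 2
  ring

end

/-! ### Cutoffs near the initial time -/

theorem fourierInv_lineDeriv_apply (f : 𝓢(SpaceTime d, ℂ)) (m z : SpaceTime d) :
    (𝓕⁻ (∂_{m} f)) z = -(2 * Real.pi * Complex.I) * (inner ℝ z m : ℝ) * (𝓕⁻ f) z := by
  rw [SchwartzMap.fourierInv_lineDerivOp_eq, smul_apply,
    SchwartzMap.smulLeftCLM_apply_apply (by fun_prop), Complex.real_smul, smul_eq_mul, ← mul_assoc]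

/-- The unit vector of space-time in the `j`-th spatial direction. -/
def spaceDir (j : Fin d) : SpaceTime d := WithLp.toLp 2 ((0 : ℝ), EuclideanSpace.single j (1 : ℝ))

theorem inner_spaceDir (z : SpaceTime d) (j : Fin d) : inner ℝ z (spaceDir j) = z.snd j := by
  rw [WithLp.prod_inner_apply]
  simp [spaceDir, EuclideanSpace.inner_single_right]

/-- The operator `σ² - Δ` in the space variables. -/
def spaceHelmholtz (σ : ℝ) (f : 𝓢(SpaceTime d, ℂ)) : 𝓢(SpaceTime d, ℂ) :=
  ((σ ^ 2 : ℝ) : ℂ) • f - ∑ j : Fin d, ∂_{spaceDir j} (∂_{spaceDir j} f)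

theorem fourierInv_spaceHelmholtz (σ : ℝ) (f : 𝓢(SpaceTime d, ℂ)) (z : SpaceTime d) :
    (𝓕⁻ (spaceHelmholtz σ f)) z = ((σ ^ 2 + normSqXi z : ℝ) : ℂ) * (𝓕⁻ f) z := by
  have h1 : 𝓕⁻ (spaceHelmholtz σ f) = ((σ ^ 2 : ℝ) : ℂ) • 𝓕⁻ f -
      ∑ j : Fin d, 𝓕⁻ (∂_{spaceDir j} (∂_{spaceDir j} f)) := by
    change (FourierTransform.fourierCLE ℂ 𝓢(SpaceTime d, ℂ)).symm _ = _
    rw [spaceHelmholtz, map_sub, map_smul, map_sum]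
    rfl
  have h2 : normSqXi z = ∑ j : Fin d, (2 * Real.pi) ^ 2 * z.snd j ^ 2 := by
    rw [normSqXi, mul_pow, EuclideanSpace.real_norm_sq_eq, Finset.mul_sum]
  rw [h1, sub_apply, smul_apply, sum_apply, h2,
    Complex.ofReal_add, add_mul, sub_eq_add_neg, smul_eq_mul, Complex.ofReal_sum, Finset.sum_mul,
    ← Finset.sum_neg_distrib]
  congr 1
  refine Finset.sum_congr rfl fun j _ => ?_
  rw [fourierInv_lineDeriv_apply, fourierInv_lineDeriv_apply, inner_spaceDir]
  push_cast
  linear_combination (-(4 * Real.pi ^ 2 * z.snd j ^ 2 * (𝓕⁻ f) z)) * Complex.I_sq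

/-- Spatial derivatives do not see a factor depending on time only. Hence no derivative will fall on
the time cutoffs, whose own derivatives blow up. -/
theorem lineDeriv_mul_of_invariant {f h : 𝓢(SpaceTime d, ℂ)} {β : ℝ → ℂ}
    (hfh : ∀ z, h z = β z.fst * f z) (j : Fin d) (z : SpaceTime d) :
    (∂_{spaceDir j} h) z = β z.fst * (∂_{spaceDir j} f) z := by
  rw [SchwartzMap.lineDerivOp_apply, SchwartzMap.lineDerivOp_apply, lineDeriv, lineDeriv]
  have h1 : ∀ t : ℝ, h (z + t • spaceDir j) = β z.fst * f (z + t • spaceDir j) := fun t => by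
    rw [hfh]
    congr 2
    change z.fst + t * 0 = z.fst
    ring
  simp only [h1]
  have h2 : DifferentiableAt ℝ (fun t : ℝ => f (z + t • spaceDir j)) 0 := by
    have h3 : Differentiable ℝ f := (f.smooth 1).differentiable one_ne_zero
    exact (h3 _).comp _ (by fun_prop)
  exact deriv_const_mul _ h2

theorem spaceHelmholtz_mul_of_invariant (σ : ℝ) {f h : 𝓢(SpaceTime d, ℂ)} {β : ℝ → ℂ}
    (hfh : ∀ z, h z = β z.fst * f z) (z : SpaceTime d) :
    spaceHelmholtz σ h z = β z.fst * spaceHelmholtz σ f z := by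
  simp only [spaceHelmholtz, sub_apply, smul_apply, sum_apply,
    smul_eq_mul, lineDeriv_mul_of_invariant (lineDeriv_mul_of_invariant hfh _) _, hfh,
    ← Finset.mul_sum]
  ring

theorem volume_fst_eq_zero : ∀ᵐ z : SpaceTime d, z.fst ≠ 0 := by
  have h := Measure.addHaar_submodule volume
    (LinearMap.ker (WithLp.fstL 2 ℝ ℝ (Bdry d)).toLinearMap) fun h => by
      have h1 : (WithLp.toLp 2 ((1 : ℝ), (0 : Bdry d)) : SpaceTime d) ∈ (⊤ : Submodule ℝ _) :=
        Submodule.mem_top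
      rw [← h] at h1
      exact one_ne_zero (LinearMap.mem_ker.1 h1)
  exact measure_mono_null (fun z hz => not_not.1 hz) h

/-- A smooth cutoff that vanishes for `t ≤ 1 / (n + 1)` and equals one for `t ≥ 2 / (n + 1)`. -/
def lateCutoff (n : ℕ) (t : ℝ) : ℝ := Real.smoothTransition (((n : ℝ) + 1) * t - 1)

/-- A smooth cutoff that vanishes for `t ≤ - 2 / (n + 1)` and equals one for
`t ≥ - 1 / (n + 1)`. -/
def earlyCutoff (n : ℕ) (t : ℝ) : ℝ := Real.smoothTransition (((n : ℝ) + 1) * t + 2)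

theorem contDiff_lateCutoff (n : ℕ) : ContDiff ℝ ∞ (lateCutoff n) :=
  Real.smoothTransition.contDiff.comp (by fun_prop)

theorem contDiff_earlyCutoff (n : ℕ) : ContDiff ℝ ∞ (earlyCutoff n) :=
  Real.smoothTransition.contDiff.comp (by fun_prop)

/-- Multiplication of a test function by a smooth function of time. -/
def timeMul (β : ℝ → ℝ) (hβ : ContDiff ℝ ∞ β) (φ : Test d) : Test d :=
  mkTest (fun z => β z.fst * φ z)
    ((hβ.comp (WithLp.fstL 2 ℝ ℝ (Bdry d)).contDiff).mul φ.contDiff) φ.hasCompactSupport.mul_left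

theorem timeMul_apply (β : ℝ → ℝ) (hβ : ContDiff ℝ ∞ β) (φ : Test d) (z : SpaceTime d) :
    timeMul β hβ φ z = β z.fst * φ z := rfl

theorem tsupport_timeMul_subset (β : ℝ → ℝ) (hβ : ContDiff ℝ ∞ β) (φ : Test d) :
    tsupport (timeMul β hβ φ) ⊆ tsupport φ :=
  closure_mono (Function.support_mul_subset_right _ _)

theorem tsupport_timeMul_subset' (β : ℝ → ℝ) (hβ : ContDiff ℝ ∞ β) (φ : Test d) {s : Set ℝ}
    (hs : IsClosed s) (h : ∀ t ∉ s, β t = 0) : tsupport (timeMul β hβ φ) ⊆ {z | z.fst ∈ s} := by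
  refine closure_minimal (fun z hz => ?_) (hs.preimage continuous_fst)
  by_contra hzs
  exact hz (by rw [timeMul_apply, h _ hzs, zero_mul])

/-- In H^{1/2}(H^{-1/2}) the negative spatial order is absorbed by σ² - Δ' (spatial Laplacian),
which maps e^{-σt} `L` to an L² setting without using time derivatives. Moved onto the test function
it commutes with `β n`, so dominated convergence in L² suffices. In particular `L` cannot charge the
hyperplane t = 0. -/
theorem tendsto_apply_timeMul {σ : ℝ} (hσ : 0 < σ) {L : Dist d}
    (hL : MemH σ (1 / 2) (-1 / 2) L) (φ : Test d) {β : ℕ → ℝ → ℝ}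
    (hβ : ∀ n, ContDiff ℝ ∞ (β n)) (hβ1 : ∀ n t, |β n t| ≤ 1)
    (hβ0 : ∀ t ≠ 0, Tendsto (fun n => β n t) atTop (𝓝 0)) :
    Tendsto (fun n => L (timeMul (β n) (hβ n) φ)) atTop (𝓝 0) := by
  have hg := hL.isFourierLaplace
  set g := fourierLaplace σ L
  have hgm := hL.memLp hg
  set F : 𝓢(SpaceTime d, ℂ) := toSchwartz (expMul σ φ)
  set Fn : ℕ → 𝓢(SpaceTime d, ℂ) := fun n => toSchwartz (expMul σ (timeMul (β n) (hβ n) φ))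
  have hFn : ∀ n z, Fn n z = ((β n z.fst : ℝ) : ℂ) * F z := fun n z => by
    simp only [Fn, F, toSchwartz_apply, expMul_apply, timeMul_apply]
    push_cast
    ring
  set Ψ := spaceHelmholtz σ F
  set Ψn := fun n => spaceHelmholtz σ (Fn n)
  have hΨn : ∀ n z, Ψn n z = ((β n z.fst : ℝ) : ℂ) * Ψ z := fun n z =>
    spaceHelmholtz_mul_of_invariant σ (β := fun t => ((β n t : ℝ) : ℂ)) (hFn n) z
  have hB : ∀ z : SpaceTime d, 0 < σ ^ 2 + normSqXi z := fun z =>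
    add_pos_of_pos_of_nonneg (by positivity) (normSqXi_nonneg z)
  have hgB : MemLp (fun z => ((σ ^ 2 + normSqXi z : ℝ) : ℂ)⁻¹ * g z) 2 := by
    refine hgm.of_le_mul (c := (σ ^ 2)⁻¹) ?_ (Eventually.of_forall fun z => ?_)
    · refine AEStronglyMeasurable.mul ?_ (aestronglyMeasurable_of_sobolevWeight_mul hσ hgm.1)
      exact (Continuous.inv₀ (Complex.continuous_ofReal.comp
        (continuous_const.add continuous_normSqXi))
        fun z => Complex.ofReal_ne_zero.2 (hB z).ne').aestronglyMeasurable
    · rw [norm_sobolevWeight_mul hσ, norm_mul, norm_inv, Complex.norm_real,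
        Real.norm_of_nonneg (hB z).le, ← mul_assoc]
      refine mul_le_mul_of_nonneg_right ?_ (norm_nonneg _)
      have hΩ := normSqOmega_pos hσ z
      have hΩσ := normSqOmega_ge σ z
      have hk := normSqXi_nonneg z
      have hσ2 : 0 < σ ^ 2 := by positivity
      -- The weight is y^{-1/4} with y ≥ 1, hence at least y⁻¹. Since |ω|² ≥ σ², also y ≤ (σ² +
      -- |ξ'|²)/σ², which gives the constant (σ²)⁻¹.
      set y := (normSqOmega σ z + normSqXi z) / normSqOmega σ z
      have hy1 : 1 ≤ y := by
        rw [one_le_div hΩ]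
        linarith
      have hw : sobolevWeight σ (1 / 2) (-1 / 2) z = y ^ (-(1 / 4) : ℝ) := by
        rw [sobolevWeight, Real.div_rpow (by linarith) hΩ.le, Real.rpow_neg hΩ.le, div_inv_eq_mul,
          mul_comm]
        norm_num
      have h1 : y⁻¹ ≤ sobolevWeight σ (1 / 2) (-1 / 2) z := by
        rw [hw, ← Real.rpow_neg_one]
        exact Real.rpow_le_rpow_of_exponent_le hy1 (by norm_num)
      have h2 : y ≤ (σ ^ 2)⁻¹ * (σ ^ 2 + normSqXi z) := by
        rw [inv_mul_eq_div, div_le_div_iff₀ hΩ hσ2]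
        nlinarith
      calc (σ ^ 2 + normSqXi z)⁻¹ = (σ ^ 2)⁻¹ * ((σ ^ 2)⁻¹ * (σ ^ 2 + normSqXi z))⁻¹ := by
            field_simp
        _ ≤ (σ ^ 2)⁻¹ * y⁻¹ := by gcongr
        _ ≤ _ := by gcongr
  have hval : ∀ n, ((L (timeMul (β n) (hβ n) φ) : ℝ) : ℂ) =
      ∫ z, ((σ ^ 2 + normSqXi z : ℝ) : ℂ)⁻¹ * g z * (𝓕⁻ (Ψn n)) z := fun n => by
    rw [← hg.integral_expMul]
    congr 1 with z
    have : ((σ ^ 2 + normSqXi z : ℝ) : ℂ) ≠ 0 := Complex.ofReal_ne_zero.2 (hB z).ne'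
    rw [fourierInv_spaceHelmholtz]
    field_simp
    rfl
  have hbound : ∀ n, ‖L (timeMul (β n) (hβ n) φ)‖ ≤
      (eLpNorm (fun z => ((σ ^ 2 + normSqXi z : ℝ) : ℂ)⁻¹ * g z) 2 volume).toReal *
        (eLpNorm (Ψn n) 2 volume).toReal := fun n => by
    rw [← Complex.norm_real, hval]
    refine (norm_integral_mul_le hgB (SchwartzMap.memLp (𝓕⁻ (Ψn n)) 2 volume)).trans_eq ?_
    congr 1
    have h1 := SchwartzMap.norm_fourier_toL2_eq (𝓕⁻ (Ψn n))
    rw [FourierTransform.fourier_fourierInv_eq, SchwartzMap.norm_toLp, SchwartzMap.norm_toLp] at h1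
    exact h1.symm
  have hlim : Tendsto (fun n => (eLpNorm (Ψn n) 2 volume).toReal) atTop (𝓝 0) := by
    have h1 : ∀ n, (eLpNorm (Ψn n) 2 volume).toReal = (∫ z, ‖Ψn n z‖ ^ 2) ^ (1 / 2 : ℝ) :=
      fun n => by
        rw [toReal_eLpNorm (Ψn n).continuous.aestronglyMeasurable,
          lpNorm_eq_integral_norm_rpow_toReal two_ne_zero ENNReal.ofNat_ne_top
            (Ψn n).continuous.aestronglyMeasurable]
        simp
    have h2 : Tendsto (fun n => ∫ z, ‖Ψn n z‖ ^ 2) atTop (𝓝 (∫ _ : SpaceTime d, (0 : ℝ))) := by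
      refine tendsto_integral_of_dominated_convergence (fun z => ‖Ψ z‖ ^ 2)
        (fun n => ((Ψn n).continuous.norm.pow 2).aestronglyMeasurable)
        ((memLp_two_iff_integrable_sq_norm Ψ.continuous.aestronglyMeasurable).1
          (SchwartzMap.memLp Ψ 2 volume)) (fun n => Eventually.of_forall fun z => ?_) ?_
      · rw [hΨn, norm_mul, Complex.norm_real, Real.norm_of_nonneg (by positivity), mul_pow]
        refine mul_le_of_le_one_left (by positivity) ?_
        rw [Real.norm_eq_abs, sq_abs]
        exact (sq_le_one_iff_abs_le_one _).2 (hβ1 n _)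
      · filter_upwards [volume_fst_eq_zero] with z hz
        have h3 := (((hβ0 _ hz).norm.mul_const ‖Ψ z‖).pow 2)
        simp only [norm_zero, zero_mul, ne_eq, OfNat.ofNat_ne_zero, not_false_eq_true,
          zero_pow] at h3
        refine h3.congr fun n => ?_
        rw [hΨn, norm_mul, Complex.norm_real]
    rw [integral_zero] at h2
    simp only [h1]
    have h3 := h2.rpow_const (p := 1 / 2) (Or.inr (by norm_num))
    rwa [Real.zero_rpow (by norm_num)] at h3
  have h4 := hlim.const_mul
    (eLpNorm (fun z => ((σ ^ 2 + normSqXi z : ℝ) : ℂ)⁻¹ * g z) 2 volume).toReal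
  rw [mul_zero] at h4
  exact squeeze_zero_norm hbound h4

/-- A distribution in the space `H^{1/2}_σ(ℝ⁺, H^{-1/2}(Γ))` is determined by its values on test
functions supported in `{t > 0}`. -/
theorem exists_tendsto_of_memH {σ : ℝ} (hσ : 0 < σ) (φ : Test d) :
    ∃ φn : ℕ → Test d, (∀ n, tsupport (φn n) ⊆ tsupport φ) ∧
      (∀ n, tsupport (φn n) ⊆ {z | 0 < z.fst}) ∧ ((∀ z, 0 ≤ φ z) → ∀ n z, 0 ≤ φn n z) ∧
      ∀ L : Dist d, MemH σ (1 / 2) (-1 / 2) L → Tendsto (fun n => L (φn n)) atTop (𝓝 (L φ)) := by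
  have hs0 := Real.smoothTransition.nonneg
  have hs1 := Real.smoothTransition.le_one
  -- A window shrinking to t = 0. The rest of 1 - `lateCutoff` is the function `γ` below, supported
  -- in t < 0, where `L` vanishes.
  set β : ℕ → ℝ → ℝ := fun n t => (1 - lateCutoff n t) * earlyCutoff n t
  have hβ : ∀ n, ContDiff ℝ ∞ (β n) := fun n =>
    (contDiff_const.sub (contDiff_lateCutoff n)).mul (contDiff_earlyCutoff n)
  refine ⟨fun n => timeMul (lateCutoff n) (contDiff_lateCutoff n) φ,
    fun n => tsupport_timeMul_subset _ _ _, fun n => ?_,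
    fun h n z => mul_nonneg (hs0 _) (h z), fun L hL => ?_⟩
  · refine (tsupport_timeMul_subset' _ _ _ (s := Set.Ici (1 / ((n : ℝ) + 1))) isClosed_Ici
      fun t ht => ?_).trans fun z hz => ?_
    · refine Real.smoothTransition.zero_of_nonpos ?_
      rw [Set.mem_Ici, not_le, lt_div_iff₀ (by positivity)] at ht
      linarith
    · exact lt_of_lt_of_le (by positivity : (0 : ℝ) < 1 / ((n : ℝ) + 1)) hz
  · have hlim := tendsto_apply_timeMul hσ hL φ hβ (fun n t => ?_) fun t ht => ?_
    · have h1 : ∀ n, L (timeMul (lateCutoff n) (contDiff_lateCutoff n) φ) =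
          L φ - L (timeMul (β n) (hβ n) φ) := by
        intro n
        set γ : ℝ → ℝ := fun t => (1 - lateCutoff n t) * (1 - earlyCutoff n t)
        have hγ : ContDiff ℝ ∞ γ := (contDiff_const.sub (contDiff_lateCutoff n)).mul
          (contDiff_const.sub (contDiff_earlyCutoff n))
        have h2 : L (timeMul γ hγ φ) = 0 := by
          refine hL.1 _ ((tsupport_timeMul_subset' _ _ _
            (s := Set.Iic (-(1 / ((n : ℝ) + 1)))) isClosed_Iic fun t ht => ?_).trans
            fun z hz => ?_)
          · have : earlyCutoff n t = 1 := by
              refine Real.smoothTransition.one_of_one_le ?_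
              rw [Set.mem_Iic, not_le, ← neg_div, div_lt_iff₀ (by positivity)] at ht
              linarith
            simp only [γ, this, sub_self, mul_zero]
          · have h3 : (0 : ℝ) < 1 / ((n : ℝ) + 1) := by positivity
            have h4 : z.fst ≤ -(1 / ((n : ℝ) + 1)) := hz
            have h5 : z.fst < 0 := by linarith
            exact not_le.2 h5
        have h3 : φ = timeMul (lateCutoff n) (contDiff_lateCutoff n) φ + timeMul (β n) (hβ n) φ +
            timeMul γ hγ φ := by
          ext z
          change φ z = lateCutoff n z.fst * φ z + β n z.fst * φ z + γ z.fst * φ z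
          simp only [β, γ]
          ring
        have h4 := congrArg L h3
        rw [map_add, map_add, h2] at h4
        linarith
      simp only [h1]
      simpa using hlim.const_sub (L φ)
    · have h0 : 0 ≤ 1 - lateCutoff n t := sub_nonneg.2 (hs1 _)
      have h1 : 0 ≤ lateCutoff n t := hs0 _
      have h2 : 0 ≤ earlyCutoff n t := hs0 _
      rw [abs_of_nonneg (mul_nonneg h0 h2)]
      exact mul_le_one₀ (by linarith) h2 (hs1 _)
    · have h2 : ∀ᶠ n : ℕ in atTop, 2 / |t| ≤ (n : ℝ) + 1 := by
        filter_upwards [eventually_ge_atTop ⌈2 / |t|⌉₊] with n hn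
        have := Nat.ceil_le.1 hn
        linarith
      refine tendsto_const_nhds.congr' ?_
      filter_upwards [h2] with n hn
      have ht' : 0 < |t| := abs_pos.2 ht
      rw [div_le_iff₀ ht'] at hn
      rcases lt_or_gt_of_ne ht with h | h
      · rw [abs_of_neg h] at hn
        have : earlyCutoff n t = 0 := Real.smoothTransition.zero_of_nonpos (by linarith)
        simp only [β, this, mul_zero]
      · rw [abs_of_pos h] at hn
        have : lateCutoff n t = 1 := Real.smoothTransition.one_of_one_le (by linarith)
        simp only [β, this, sub_self, zero_mul]

/-! ### Causal functions on the frequency side -/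

/-- The Fourier transform is injective on integrable functions. -/
theorem ae_eq_zero_of_fourier_eq_zero {E : Type*} [NormedAddCommGroup E] [InnerProductSpace ℝ E]
    [FiniteDimensional ℝ E] [MeasurableSpace E] [BorelSpace E] {H : E → ℂ} (hH : Integrable H)
    (h : ∀ x, (𝓕 H) x = 0) : ∀ᵐ x, H x = 0 := by
  refine ae_eq_zero_of_integral_contDiff_smul_eq_zero hH.locallyIntegrable fun g hg hc => ?_
  have hg' : ContDiff ℝ ∞ fun x => ((g x : ℝ) : ℂ) := Complex.ofRealCLM.contDiff.comp hg
  have hc' : HasCompactSupport fun x => ((g x : ℝ) : ℂ) :=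
    hc.comp_left (g := ((↑) : ℝ → ℂ)) Complex.ofReal_zero
  set φ : 𝓢(E, ℂ) := hc'.toSchwartzMap hg'
  set ψ : 𝓢(E, ℂ) := 𝓕⁻ φ
  have h1 := VectorFourier.integral_fourierIntegral_smul_eq_flip (L := innerₗ E) (μ := volume)
    (ν := volume) Real.continuous_fourierChar continuous_inner (f := ψ) ψ.integrable hH
  have h2 : ∀ x, VectorFourier.fourierIntegral Real.fourierChar volume (innerₗ E) ψ x =
      ((g x : ℝ) : ℂ) := fun x => by
    change (𝓕 ⇑ψ) x = φ x
    rw [← SchwartzMap.fourier_coe, FourierTransform.fourier_fourierInv_eq]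
  have h3 : ∀ x, VectorFourier.fourierIntegral Real.fourierChar volume (innerₗ E).flip H x = 0 :=
    fun x => by
      rw [flip_innerₗ]
      exact h x
  simp only [h2, h3, smul_eq_mul, mul_zero, integral_zero] at h1
  simpa only [Complex.real_smul] using h1

/-- The hypothesis says that the marginal of `h` in the spatial frequency has zero Fourier
transform, so the marginal vanishes almost everywhere. Any bounded continuous multiplier in ξ' may
then be inserted, such as the phases of the delay formula. -/
theorem integral_mul_snd_eq_zero {h : SpaceTime d → ℂ} (hh : Integrable h)
    (h0 : ∀ x : Bdry d, ∫ z : SpaceTime d,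
      Complex.exp (((-2 * Real.pi * inner ℝ z.snd x : ℝ) : ℂ) * Complex.I) * h z = 0)
    {c : Bdry d → ℂ} (hc : Continuous c) (hc1 : ∀ ξ, ‖c ξ‖ ≤ 1) :
    ∫ z, c z.snd * h z = 0 := by
  have hmp : MeasurePreserving (WithLp.toLp 2 : ℝ × Bdry d → SpaceTime d)
      (volume.prod volume) volume := WithLp.volume_preserving_toLp ℝ (Bdry d)
  have hemb : MeasurableEmbedding (WithLp.toLp 2 : ℝ × Bdry d → SpaceTime d) :=
    (MeasurableEquiv.toLp 2 (ℝ × Bdry d)).measurableEmbedding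
  have hh' : Integrable (fun p : ℝ × Bdry d => h (WithLp.toLp 2 p)) (volume.prod volume) :=
    (hmp.integrable_comp_emb hemb).2 hh
  have hmarg : ∀ e : Bdry d → ℂ, Continuous e → (∀ ξ, ‖e ξ‖ ≤ 1) →
      ∫ z : SpaceTime d, e z.snd * h z = ∫ ξ, e ξ * ∫ τ, h (WithLp.toLp 2 (τ, ξ)) := by
    intro e he he1
    have h2 : Integrable (fun p : ℝ × Bdry d => e p.2 * h (WithLp.toLp 2 p))
        (volume.prod volume) :=
      hh'.bdd_mul (c := 1) (he.comp _root_.continuous_snd).aestronglyMeasurable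
        (Eventually.of_forall fun p => he1 _)
    rw [← hmp.integral_comp hemb]
    refine (integral_prod_symm _ h2).trans ?_
    refine integral_congr_ae (Eventually.of_forall fun ξ => ?_)
    exact integral_const_mul (e ξ) fun τ => h (WithLp.toLp 2 (τ, ξ))
  have hH := hh'.integral_prod_right
  have hz := ae_eq_zero_of_fourier_eq_zero hH fun x => by
    rw [Real.fourier_eq']
    have h3 := hmarg (fun ξ =>
      Complex.exp (((-2 * Real.pi * inner ℝ ξ x : ℝ) : ℂ) * Complex.I)) (by fun_prop)
      fun ξ => (Complex.norm_exp_ofReal_mul_I _).le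
    rw [h0] at h3
    exact h3.symm
  rw [hmarg c hc hc1]
  refine integral_eq_zero_of_ae ?_
  filter_upwards [hz] with ξ hξ
  rw [hξ, mul_zero]
  rfl

/-- `f` is the transform of a distribution supported in `{t ≥ 0}`. -/
structure IsCausal (f : SpaceTime d → ℂ) : Prop where
  integrable : ∀ φ : 𝓢(SpaceTime d, ℂ), Integrable fun z => f z * φ z
  integral_eq_zero : ∀ φ : 𝓢(SpaceTime d, ℂ), HasCompactSupport φ → tsupport φ ⊆ {z | z.fst < 0} →
    ∫ z, f z * (𝓕⁻ φ) z = 0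

theorem fourierInv_translate (φ : 𝓢(SpaceTime d, ℂ)) (a z : SpaceTime d) :
    (𝓕⁻ (φ.compSubConstCLM ℂ a)) z =
      Complex.exp (((2 * Real.pi * inner ℝ a z : ℝ) : ℂ) * Complex.I) * (𝓕⁻ φ) z := by
  rw [SchwartzMap.fourierInv_coe, SchwartzMap.fourierInv_coe, Real.fourierInv_eq',
    Real.fourierInv_eq', ← integral_const_mul, ← integral_add_right_eq_self _ a]
  congr 1 with x
  rw [SchwartzMap.compSubConstCLM_apply, add_sub_cancel_right, smul_eq_mul, smul_eq_mul, ← mul_assoc,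
    ← Complex.exp_add, inner_add_left]
  congr 2
  push_cast
  ring

/-- A delay by `s` translates the test function to earlier times and keeps its support in t < 0.
Arbitrary spatial translations do too, and varying them yields every multiplier `c` in ξ'. -/
theorem IsCausal.integral_shift_mul {f : SpaceTime d → ℂ} (hf : IsCausal f)
    {φ : 𝓢(SpaceTime d, ℂ)} (hφc : HasCompactSupport φ) (hφ : tsupport φ ⊆ {z | z.fst < 0})
    {s : ℝ} (hs : 0 ≤ s) {c : Bdry d → ℂ} (hc : Continuous c) (hc1 : ∀ ξ, ‖c ξ‖ ≤ 1) :
    ∫ z, c z.snd * (Complex.exp (((-2 * Real.pi * s * z.fst : ℝ) : ℂ) * Complex.I) *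
      (f z * (𝓕⁻ φ) z)) = 0 := by
  refine integral_mul_snd_eq_zero ?_ (fun x => ?_) hc hc1
  · refine (hf.integrable (𝓕⁻ φ)).bdd_mul (c := 1) ?_
      (Eventually.of_forall fun z => (Complex.norm_exp_ofReal_mul_I _).le)
    exact (Complex.continuous_exp.comp ((Complex.continuous_ofReal.comp
      (continuous_const.mul continuous_fst)).mul continuous_const)).aestronglyMeasurable
  · set a : SpaceTime d := WithLp.toLp 2 (-s, -x)
    have hts : tsupport (φ.compSubConstCLM ℂ a) ⊆ (fun z => z - a) ⁻¹' tsupport φ :=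
      tsupport_comp_subset_preimage φ (by fun_prop)
    have h1 := hf.integral_eq_zero (φ.compSubConstCLM ℂ a)
      (hφc.comp_homeomorph (Homeomorph.subRight a)) fun z hz => by
        have h2 : (z - a).fst < 0 := hφ (hts hz)
        have h3 : (z - a).fst = z.fst - -s := rfl
        rw [h3] at h2
        change z.fst < 0
        linarith
    rw [← h1]
    congr 1 with z
    rw [fourierInv_translate, ← mul_assoc, ← Complex.exp_add, mul_left_comm (f z)]
    congr 2
    have h4 : inner ℝ a z = z.fst * -s + inner ℝ (-x) z.snd := by
      rw [WithLp.prod_inner_apply]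
      rfl
    rw [h4, inner_neg_left, real_inner_comm x z.snd]
    push_cast
    ring

theorem tsupport_lineDeriv_subset (m : SpaceTime d) (f : 𝓢(SpaceTime d, ℂ)) :
    tsupport (∂_{m} f : 𝓢(SpaceTime d, ℂ)) ⊆ tsupport f := SchwartzMap.tsupport_lineDerivOp_subset m f

/-- The complex frequency `p = σ - i ξ₀`, dual to differentiation in time. -/
def laplaceVar (σ : ℝ) (z : SpaceTime d) : ℂ := σ + 2 * Real.pi * z.fst * Complex.I

/-- The wave operator acting on `e^{-σ t}`-weighted functions. -/
def waveOp (σ : ℝ) (f : 𝓢(SpaceTime d, ℂ)) : 𝓢(SpaceTime d, ℂ) :=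
  spaceHelmholtz σ f - ((2 * σ : ℝ) : ℂ) • ∂_{(WithLp.toLp 2 ((1 : ℝ), (0 : Bdry d)))} f +
    ∂_{(WithLp.toLp 2 ((1 : ℝ), (0 : Bdry d)))} (∂_{(WithLp.toLp 2 ((1 : ℝ), (0 : Bdry d)))} f)

theorem fourierInv_waveOp (σ : ℝ) (f : 𝓢(SpaceTime d, ℂ)) (z : SpaceTime d) :
    (𝓕⁻ (waveOp σ f)) z = (laplaceVar σ z ^ 2 + (normSqXi z : ℂ)) * (𝓕⁻ f) z := by
  have h1 : inner ℝ z (WithLp.toLp 2 ((1 : ℝ), (0 : Bdry d))) = z.fst := by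
    rw [WithLp.prod_inner_apply]
    simp
  set m : SpaceTime d := WithLp.toLp 2 ((1 : ℝ), (0 : Bdry d))
  have h2 : 𝓕⁻ (waveOp σ f) = 𝓕⁻ (spaceHelmholtz σ f) - ((2 * σ : ℝ) : ℂ) • 𝓕⁻ (∂_{m} f) +
      𝓕⁻ (∂_{m} (∂_{m} f)) := by
    change (FourierTransform.fourierCLE ℂ 𝓢(SpaceTime d, ℂ)).symm _ = _
    rw [waveOp, map_add, map_sub, map_smul]
    rfl
  rw [h2, add_apply, sub_apply, smul_apply, fourierInv_spaceHelmholtz,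
    fourierInv_lineDeriv_apply, fourierInv_lineDeriv_apply, fourierInv_lineDeriv_apply, h1,
    laplaceVar, smul_eq_mul]
  push_cast
  ring

theorem tsupport_waveOp_subset (σ : ℝ) (f : 𝓢(SpaceTime d, ℂ)) :
    tsupport (waveOp σ f) ⊆ tsupport f := by
  refine closure_minimal (fun z hz => ?_) (isClosed_tsupport _)
  by_contra h
  refine hz ?_
  have h0 : f z = 0 := image_eq_zero_of_notMem_tsupport h
  have h1 : ∀ m, (∂_{m} f : 𝓢(SpaceTime d, ℂ)) z = 0 := fun m =>
    image_eq_zero_of_notMem_tsupport fun h' => h (tsupport_lineDeriv_subset m f h')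
  have h2 : ∀ m m', (∂_{m} (∂_{m'} f : 𝓢(SpaceTime d, ℂ)) : 𝓢(SpaceTime d, ℂ)) z = 0 := fun m m' =>
    image_eq_zero_of_notMem_tsupport fun h' =>
      h (tsupport_lineDeriv_subset m' f (tsupport_lineDeriv_subset m _ h'))
  simp only [waveOp, spaceHelmholtz, add_apply, sub_apply, smul_apply, sum_apply, h0, h1, h2,
    smul_zero, Finset.sum_const_zero, sub_zero, add_zero]

/-- The symbol is polynomial, so it acts on test functions as a differential operator, which does
not enlarge supports. -/
theorem IsCausal.waveSymbol_mul {f : SpaceTime d → ℂ} (hf : IsCausal f) (σ : ℝ) :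
    IsCausal fun z => (laplaceVar σ z ^ 2 + (normSqXi z : ℂ)) * f z where
  integrable φ := by
    refine (hf.integrable (𝓕⁻ (waveOp σ (𝓕 φ)))).congr (Eventually.of_forall fun z => ?_)
    simp only
    rw [fourierInv_waveOp, FourierTransform.fourierInv_fourier_eq]
    ring
  integral_eq_zero φ hφc hφ := by
    rw [← hf.integral_eq_zero (waveOp σ φ)
      (hφc.mono' ((subset_tsupport _).trans (tsupport_waveOp_subset σ φ)))
      ((tsupport_waveOp_subset σ φ).trans hφ)]
    congr 1 with z
    rw [fourierInv_waveOp]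
    ring

/-- Multiplication by `(π / (p + i k))^{1/2}`, where `k = ± |ξ'|`, preserves causality: this symbol
is a superposition of time delays. -/
theorem IsCausal.gaussian_mul {f : SpaceTime d → ℂ} (hf : IsCausal f) {σ : ℝ} (hσ : 0 < σ)
    (κ : ℝ) :
    IsCausal fun z => ((Real.pi : ℂ) /
      (laplaceVar σ z + (κ * ‖z.snd‖ : ℝ) * Complex.I)) ^ (1 / 2 : ℂ) * f z := by
  set b : SpaceTime d → ℂ := fun z => laplaceVar σ z + (κ * ‖z.snd‖ : ℝ) * Complex.I
  have hbc : Continuous b := by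
    refine Continuous.add (continuous_const.add (Continuous.mul (continuous_const.mul
      (Complex.continuous_ofReal.comp continuous_fst)) continuous_const)) ?_
    exact (Complex.continuous_ofReal.comp (continuous_const.mul continuous_snd.norm)).mul
      continuous_const
  have hb : ∀ z, (b z).re = σ := fun z => by simp [b, laplaceVar]
  have hexp : ∀ z (x : ℝ), ‖Complex.exp (-b z * (x : ℂ) ^ 2)‖ = Real.exp (-σ * x ^ 2) :=
    fun z x => by
      rw [Complex.norm_exp]
      congr 1
      rw [← Complex.ofReal_pow, Complex.re_mul_ofReal, Complex.neg_re, hb]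
  -- The Gaussian integral converges since the real part of `b` is σ > 0. Its integrand is the
  -- constant e^{-σx²}, times a phase in ξ', times the symbol of the delay x².
  have hgauss : ∀ z, ((Real.pi : ℂ) / b z) ^ (1 / 2 : ℂ) =
      ∫ x : ℝ, Complex.exp (-b z * (x : ℂ) ^ 2) := fun z =>
    (integral_gaussian_complex (by rw [hb]; exact hσ)).symm
  have hint : ∀ φ : 𝓢(SpaceTime d, ℂ), Integrable (fun q : SpaceTime d × ℝ =>
      Complex.exp (-b q.1 * (q.2 : ℂ) ^ 2) * (f q.1 * φ q.1)) (volume.prod volume) := by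
    intro φ
    have h1 := (hf.integrable φ).norm.mul_prod (integrable_exp_neg_mul_sq hσ)
    refine h1.mono' ?_ (Eventually.of_forall fun q => ?_)
    · refine AEStronglyMeasurable.mul ?_ (hf.integrable φ).1.comp_fst
      exact (Complex.continuous_exp.comp (((hbc.comp _root_.continuous_fst).neg).mul
        ((Complex.continuous_ofReal.comp _root_.continuous_snd).pow 2))).aestronglyMeasurable
    · rw [norm_mul, hexp, mul_comm]
  have hswap : ∀ φ : 𝓢(SpaceTime d, ℂ), ∫ z, ((Real.pi : ℂ) / b z) ^ (1 / 2 : ℂ) * f z * φ z =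
      ∫ x : ℝ, ∫ z, Complex.exp (-b z * (x : ℂ) ^ 2) * (f z * φ z) := by
    intro φ
    rw [← integral_integral_swap (hint φ)]
    congr 1 with z
    rw [hgauss, integral_mul_const, mul_assoc]
  refine ⟨fun φ => ?_, fun φ hφc hφ => ?_⟩
  · refine (hint φ).integral_prod_left.congr (Eventually.of_forall fun z => ?_)
    simp only
    rw [hgauss, integral_mul_const, mul_assoc]
  · rw [hswap]
    refine integral_eq_zero_of_ae (Eventually.of_forall fun x => ?_)
    have h1 := hf.integral_shift_mul hφc hφ (sq_nonneg x)
      (c := fun ξ => Complex.exp (((-(κ * ‖ξ‖ * x ^ 2) : ℝ) : ℂ) * Complex.I)) (by fun_prop)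
      fun ξ => (Complex.norm_exp_ofReal_mul_I _).le
    have h2 := congrArg (fun y : ℂ => Complex.exp ((-σ * x ^ 2 : ℝ) : ℂ) * y) h1
    simp only [mul_zero] at h2
    rw [← integral_const_mul] at h2
    refine (integral_congr_ae (Eventually.of_forall fun z => ?_)).trans h2
    have he : Complex.exp (-b z * (x : ℂ) ^ 2) = Complex.exp ((-σ * x ^ 2 : ℝ) : ℂ) *
        Complex.exp (((-(κ * ‖z.snd‖ * x ^ 2) : ℝ) : ℂ) * Complex.I) *
        Complex.exp (((-2 * Real.pi * x ^ 2 * z.fst : ℝ) : ℂ) * Complex.I) := by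
      rw [← Complex.exp_add, ← Complex.exp_add]
      congr 1
      simp only [b, laplaceVar]
      push_cast
      ring
    rw [he]
    ring

/-! ### The Dirichlet-to-Neumann operator -/

theorem tsupport_toSchwartz_subset (φ : Test d) : tsupport (toSchwartz φ) ⊆ tsupport φ :=
  tsupport_comp_subset (g := ((↑) : ℝ → ℂ)) Complex.ofReal_zero φ

theorem IsFourierLaplace.isCausal {σ : ℝ} {u : Dist d} {f : SpaceTime d → ℂ}
    (hf : IsFourierLaplace σ u f) (hu : SuppIn u {z | 0 ≤ z.fst}) : IsCausal f where
  integrable := hf.isTempered.integrable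
  integral_eq_zero φ hφc hφ := by
    obtain ⟨a, b, hab, ha, hb⟩ := exists_eq_toSchwartz_add φ hφc
    have h0 : ∀ a : Test d, tsupport a ⊆ tsupport φ →
        ∫ z, f z * (𝓕⁻ (toSchwartz a)) z = 0 := fun a ha => by
      have h1 : u (expMul (-σ) a) = 0 := hu _ fun z hz => by
        rw [tsupport_expMul] at hz
        exact not_le.2 (show z.fst < 0 from hφ (ha hz))
      rw [hf.integral_eq, h1, Complex.ofReal_zero]
    have h2 : 𝓕⁻ φ = 𝓕⁻ (toSchwartz a) + Complex.I • 𝓕⁻ (toSchwartz b) := by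
      rw [hab, FourierTransform.fourierInv_add, FourierTransform.fourierInv_smul]
    have h3 : ∀ z, f z * (𝓕⁻ φ) z = f z * (𝓕⁻ (toSchwartz a)) z +
        Complex.I * (f z * (𝓕⁻ (toSchwartz b)) z) := fun z => by
      rw [h2, add_apply, smul_apply, smul_eq_mul]
      ring
    simp only [h3]
    rw [integral_add (hf.isTempered.integrable _) ((hf.isTempered.integrable _).const_mul _),
      integral_const_mul, h0 a ha, h0 b hb, mul_zero, add_zero]

theorem IsFourierLaplace.suppIn {σ : ℝ} {w : Dist d} {h : SpaceTime d → ℂ}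
    (hw : IsFourierLaplace σ w h) (hh : IsCausal h) : SuppIn w {z | 0 ≤ z.fst} := by
  intro φ hφ
  rw [← Complex.ofReal_eq_zero, ← hw.integral_expMul]
  have hts : tsupport (toSchwartz (expMul σ φ)) ⊆ tsupport φ :=
    (tsupport_toSchwartz_subset _).trans (tsupport_expMul σ φ).subset
  exact hh.integral_eq_zero _
    (φ.hasCompactSupport.mono' ((subset_tsupport _).trans hts))
    fun z hz => not_le.1 (show ¬ 0 ≤ z.fst from hφ (hts hz))

theorem IsCausal.const_mul {f : SpaceTime d → ℂ} (hf : IsCausal f) (c : ℂ) :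
    IsCausal fun z => c * f z where
  integrable φ := by
    simp only [mul_assoc]
    exact (hf.integrable φ).const_mul c
  integral_eq_zero φ hφc hφ := by
    simp only [mul_assoc]
    rw [integral_const_mul, hf.integral_eq_zero φ hφc hφ, mul_zero]

/-- Arguments in (-π/2, π/2) let the principal logarithms add without crossing the cut. The root is
thereby expressed by a polynomial and two inverse roots. -/
theorem mul_cpow_half_of_re_pos {a b : ℂ} (ha : 0 < a.re) (hb : 0 < b.re) :
    (a * b) * ((Real.pi / a) ^ (1 / 2 : ℂ) * (Real.pi / b) ^ (1 / 2 : ℂ)) =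
      Real.pi * (a * b) ^ (1 / 2 : ℂ) := by
  have ha0 : a ≠ 0 := fun h => by simp [h] at ha
  have hb0 : b ≠ 0 := fun h => by simp [h] at hb
  have hπ : (Real.pi : ℂ) ≠ 0 := Complex.ofReal_ne_zero.2 Real.pi_ne_zero
  have ha1 := abs_lt.1 (Complex.abs_arg_lt_pi_div_two_iff.2 (Or.inl ha))
  have hb1 := abs_lt.1 (Complex.abs_arg_lt_pi_div_two_iff.2 (Or.inl hb))
  have hlog : Complex.log (a * b) = Complex.log a + Complex.log b :=
    (Complex.log_mul_eq_add_log_iff ha0 hb0).2 ⟨by linarith, by linarith⟩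
  have hdiv : ∀ {c : ℂ}, c ≠ 0 → 0 < c.re →
      ((Real.pi : ℂ) / c) ^ (1 / 2 : ℂ) =
        Complex.exp ((Complex.log Real.pi - Complex.log c) * (1 / 2)) := fun {c} hc hc1 => by
    have hc2 := abs_lt.1 (Complex.abs_arg_lt_pi_div_two_iff.2 (Or.inl hc1))
    rw [Complex.cpow_def_of_ne_zero (div_ne_zero hπ hc), div_eq_mul_inv (Real.pi : ℂ),
      Complex.log_ofReal_mul Real.pi_pos (inv_ne_zero hc), Complex.log_inv _ (by
        intro h
        linarith [Real.pi_pos]), Complex.ofReal_log Real.pi_pos.le, ← sub_eq_add_neg]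
  rw [hdiv ha0 ha, hdiv hb0 hb, Complex.cpow_def_of_ne_zero (mul_ne_zero ha0 hb0), hlog]
  conv_lhs => rw [← Complex.exp_log ha0, ← Complex.exp_log hb0]
  conv_rhs => rw [← Complex.exp_log hπ]
  simp only [← Complex.exp_add]
  congr 1
  simp only [Complex.exp_log ha0, Complex.exp_log hb0]
  ring

theorem waveSymbol_factor (σ : ℝ) (z : SpaceTime d) :
    laplaceVar σ z ^ 2 + (normSqXi z : ℂ) =
      (laplaceVar σ z + ((2 * Real.pi) * ‖z.snd‖ : ℝ) * Complex.I) *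
        (laplaceVar σ z + ((-(2 * Real.pi)) * ‖z.snd‖ : ℝ) * Complex.I) := by
  rw [normSqXi]
  push_cast
  linear_combination (2 * Real.pi * ‖z.snd‖ : ℂ) ^ 2 * Complex.I_sq

theorem laplaceVar_add_re (σ κ : ℝ) (z : SpaceTime d) :
    (laplaceVar σ z + (κ * ‖z.snd‖ : ℝ) * Complex.I).re = σ := by
  simp [laplaceVar]

theorem dtnSymbol_eq (σ μ : ℝ) (z : SpaceTime d) :
    dtnSymbol σ μ z = μ * (laplaceVar σ z ^ 2 + (normSqXi z : ℂ)) ^ (1 / 2 : ℂ) := rfl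

/-- Factor p² + k² = (p + ik)(p - ik). The inverse roots of both factors are superpositions of
delays and p² + k² is a differential operator; this replaces a Paley–Wiener argument. -/
theorem IsCausal.dtnSymbol_mul {f : SpaceTime d → ℂ} (hf : IsCausal f) {σ : ℝ} (hσ : 0 < σ)
    (μ : ℝ) : IsCausal fun z => dtnSymbol σ μ z * f z := by
  have h1 := (((hf.gaussian_mul hσ (2 * Real.pi)).gaussian_mul hσ
    (-(2 * Real.pi))).waveSymbol_mul σ).const_mul (μ / Real.pi)
  convert h1 using 2 with z
  have h2 := mul_cpow_half_of_re_pos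
    (a := laplaceVar σ z + ((2 * Real.pi) * ‖z.snd‖ : ℝ) * Complex.I)
    (b := laplaceVar σ z + ((-(2 * Real.pi)) * ‖z.snd‖ : ℝ) * Complex.I)
    (by rw [laplaceVar_add_re]; exact hσ) (by rw [laplaceVar_add_re]; exact hσ)
  rw [← waveSymbol_factor] at h2
  have hπ : (Real.pi : ℂ) ≠ 0 := Complex.ofReal_ne_zero.2 Real.pi_ne_zero
  rw [dtnSymbol_eq]
  have h3 : (μ : ℂ) * (laplaceVar σ z ^ 2 + (normSqXi z : ℂ)) ^ (1 / 2 : ℂ) =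
      μ / Real.pi * (Real.pi * (laplaceVar σ z ^ 2 + (normSqXi z : ℂ)) ^ (1 / 2 : ℂ)) := by
    field_simp
  rw [h3, ← h2]
  ring

/-- The imaginary part vanishes only at ξ₀ = 0, where the real part is at least σ². So the principal
root is continuous and commutes with conjugation. -/
theorem waveSymbol_mem_slitPlane {σ : ℝ} (hσ : 0 < σ) (z : SpaceTime d) :
    laplaceVar σ z ^ 2 + (normSqXi z : ℂ) ∈ Complex.slitPlane := by
  have hre : (laplaceVar σ z ^ 2 + (normSqXi z : ℂ)).re =
      σ ^ 2 - (2 * Real.pi * z.fst) ^ 2 + normSqXi z := by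
    simp [laplaceVar, sq]
  have him : (laplaceVar σ z ^ 2 + (normSqXi z : ℂ)).im = 2 * σ * (2 * Real.pi * z.fst) := by
    simp [laplaceVar, sq]
    ring
  rw [Complex.mem_slitPlane_iff, hre, him]
  by_cases h : z.fst = 0
  · left
    rw [h, mul_zero]
    have h1 := normSqXi_nonneg z
    have h2 : 0 < σ ^ 2 := by positivity
    linarith
  · right
    have := Real.pi_ne_zero
    positivity

theorem continuous_dtnSymbol {σ : ℝ} (hσ : 0 < σ) (μ : ℝ) :
    Continuous (dtnSymbol (d := d) σ μ) := by
  have h1 : Continuous fun z : SpaceTime d => laplaceVar σ z ^ 2 + (normSqXi z : ℂ) := by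
    refine Continuous.add (Continuous.pow (continuous_const.add (Continuous.mul
      (continuous_const.mul (Complex.continuous_ofReal.comp continuous_fst)) continuous_const)) 2) ?_
    exact Complex.continuous_ofReal.comp continuous_normSqXi
  exact continuous_const.mul (h1.cpow continuous_const (waveSymbol_mem_slitPlane hσ))

/-- This symmetry makes 𝒮_σ map real distributions to real ones. -/
theorem conj_dtnSymbol_neg {σ : ℝ} (hσ : 0 < σ) (μ : ℝ) (z : SpaceTime d) :
    conj (dtnSymbol σ μ (-z)) = dtnSymbol σ μ z := by
  have h1 : laplaceVar σ z ^ 2 + (normSqXi z : ℂ) =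
      conj (laplaceVar σ (-z) ^ 2 + (normSqXi (-z) : ℂ)) := by
    have h2 : laplaceVar σ z = conj (laplaceVar σ (-z)) := by
      have h3 : (-z).fst = -z.fst := rfl
      simp only [laplaceVar, h3, Complex.ofReal_neg, map_add, map_mul, map_neg,
        Complex.conj_ofReal, Complex.conj_I, map_ofNat]
      ring
    have h4 : normSqXi z = normSqXi (-z) := by
      have h3 : (-z).snd = -z.snd := rfl
      rw [normSqXi, normSqXi, h3, norm_neg]
    rw [map_add, map_pow, ← h2, Complex.conj_ofReal, ← h4]
  rw [dtnSymbol_eq, dtnSymbol_eq, h1, Complex.conj_cpow_eq_ite,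
    if_neg (Complex.slitPlane_arg_ne_pi (waveSymbol_mem_slitPlane hσ _)), map_mul,
    Complex.conj_ofReal, map_div₀, map_one, map_ofNat]

theorem norm_dtnSymbol_le {σ μ : ℝ} (hσ : 0 < σ) (hμ : 0 < μ) (z : SpaceTime d) :
    ‖dtnSymbol σ μ z‖ ≤ μ * sobolevWeight σ 0 1 z := by
  have h1 : ‖laplaceVar σ z ^ 2 + (normSqXi z : ℂ)‖ ≤ normSqOmega σ z + normSqXi z := by
    refine (norm_add_le _ _).trans (add_le_add ?_ ?_)
    · rw [norm_pow, Complex.sq_norm, Complex.normSq_apply, normSqOmega]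
      simp [laplaceVar]
      nlinarith
    · rw [Complex.norm_real, Real.norm_of_nonneg (normSqXi_nonneg z)]
  have h2 : ‖(laplaceVar σ z ^ 2 + (normSqXi z : ℂ)) ^ (1 / 2 : ℂ)‖ ^ 2 =
      ‖laplaceVar σ z ^ 2 + (normSqXi z : ℂ)‖ := by
    rw [← norm_pow]
    congr 1
    simp
  have h3 : sobolevWeight σ 0 1 z ^ 2 = normSqOmega σ z + normSqXi z := by
    rw [sobolevWeight, zero_div, Real.rpow_zero, one_mul, ← Real.rpow_natCast, ← Real.rpow_mul
      (normSqSum_pos hσ z).le]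
    norm_num
  rw [dtnSymbol_eq, norm_mul, Complex.norm_real, Real.norm_of_nonneg hμ.le]
  gcongr
  refine le_of_sq_le_sq ?_ (sobolevWeight_pos hσ _ _ z).le
  rw [h2, h3]
  exact h1

theorem memLp_dtnSymbol_mul {σ μ : ℝ} (hσ : 0 < σ) (hμ : 0 < μ) {f : SpaceTime d → ℂ}
    (hf : MemLp (fun z => (sobolevWeight σ (1 / 2) (1 / 2) z : ℂ) * f z) 2) :
    MemLp (fun z => (sobolevWeight σ (1 / 2) (-1 / 2) z : ℂ) * (dtnSymbol σ μ z * f z)) 2 := by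
  refine hf.of_le_mul (c := μ) (aestronglyMeasurable_sobolevWeight_mul hσ _ _
    ((continuous_dtnSymbol hσ μ).aestronglyMeasurable.mul
      (aestronglyMeasurable_of_sobolevWeight_mul hσ hf.1))) (Eventually.of_forall fun z => ?_)
  have h1 := sobolevWeight_add hσ (1 / 2) (-1 / 2) 0 1 z
  norm_num at h1
  rw [norm_sobolevWeight_mul hσ, norm_sobolevWeight_mul hσ, norm_mul]
  have h2 := sobolevWeight_pos hσ (1 / 2) (-1 / 2) z
  calc _ ≤ sobolevWeight σ (1 / 2) (-1 / 2) z * (μ * sobolevWeight σ 0 1 z * ‖f z‖) := by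
        gcongr
        exact norm_dtnSymbol_le hσ hμ z
    _ = _ := by
        norm_num
        rw [h1]
        ring

/-- A function with the symmetry of the transform of a real distribution is a Fourier–Laplace
transform. -/
theorem exists_isFourierLaplace (σ : ℝ) {h : SpaceTime d → ℂ} (hh : IsTempered h)
    (hsymm : (fun z => conj (h (-z))) =ᵐ[volume] h) : ∃ w : Dist d, IsFourierLaplace σ w h := by
  obtain ⟨W, hW⟩ := id hh
  refine ⟨ofTempered σ (𝓕⁻ W), isFourierLaplace_iff.2 ⟨hh, fun φ => ?_⟩⟩
  rw [ofTempered_apply, expMul_expMul, add_neg_cancel, expMul_zero,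
    TemperedDistribution.fourierInv_apply, (hW _).2]
  -- `ofTempered` keeps only the real part; the symmetry shows that nothing is lost.
  have h1 : conj (∫ z, h z * (𝓕⁻ (toSchwartz φ)) z) = ∫ z, h z * (𝓕⁻ (toSchwartz φ)) z := by
    rw [← integral_conj, ← integral_neg_eq_self]
    refine integral_congr_ae ?_
    filter_upwards [hsymm] with z hz
    rw [map_mul, hz, conj_fourierInv_toSchwartz]
    congr 1
  exact (Complex.conj_eq_iff_re.1 h1).symm

/-- The symbol costs one order in the joint weight and none in |ω|. Its symmetry gives a real
distribution, its delay representation the support in t ≥ 0. -/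
theorem dtn_spec {σ μ : ℝ} (hσ : 0 < σ) (hμ : 0 < μ) {u : Dist d}
    (hu : MemH σ (1 / 2) (1 / 2) u) : MemH σ (1 / 2) (-1 / 2) (dtn σ μ u) := by
  have hf := hu.isFourierLaplace
  have hm := memLp_dtnSymbol_mul hσ hμ (hu.memLp hf)
  have hex : ∃ w : Dist d,
      IsFourierLaplace σ w (fun z => dtnSymbol σ μ z * fourierLaplace σ u z) := by
    refine exists_isFourierLaplace σ (isTempered_of_memLp hσ hm) ?_
    filter_upwards [hf.neg_ae_eq] with z hz
    rw [map_mul, conj_dtnSymbol_neg hσ, hz]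
  have hw : IsFourierLaplace σ (dtn σ μ u)
      (fun z => dtnSymbol σ μ z * fourierLaplace σ u z) := by
    rw [dtn, dif_pos hex]
    exact hex.choose_spec
  exact ⟨hw.suppIn ((hf.isCausal hu.1).dtnSymbol_mul hσ μ), _, hw, hm⟩

/-! ### Equivalence of the two formulations -/

theorem isNonneg_add {Ω : Opens (SpaceTime d)} {u v : 𝓓'(Ω, ℝ)} (hu : IsNonneg u)
    (hv : IsNonneg v) : IsNonneg (u + v) := fun φ hφ => by
  rw [add_apply]
  exact add_nonneg (hu φ hφ) (hv φ hφ)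

theorem setOf_fst_pos_subset : {z : SpaceTime d | 0 < z.fst} ⊆ {z | 0 ≤ z.fst} :=
  fun z (hz : 0 < z.fst) => show 0 ≤ z.fst from hz.le

theorem isNonneg_sub_self {Ω : Opens (SpaceTime d)} (u : 𝓓'(Ω, ℝ)) : IsNonneg (u - u) :=
  fun φ _ => by rw [sub_apply, sub_self]

section

variable {σ : ℝ} {G : Opens (Bdry d)}

theorem MemHRestr.exists_tendsto (hσ : 0 < σ) {l : DistOn G}
    (hl : MemHRestr σ (1 / 2) (-1 / 2) G l) (ψ : 𝓓(cylinder G, ℝ)) :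
    ∃ (φn : ℕ → Test d) (hφn : ∀ n, tsupport (φn n) ⊆ cylinder G),
      (∀ n, tsupport (φn n) ⊆ {z | 0 < z.fst}) ∧ ((∀ z, 0 ≤ ψ z) → ∀ n z, 0 ≤ φn n z) ∧
      Tendsto (fun n => l (ofSubset (φn n) (hφn n))) atTop (𝓝 (l ψ)) := by
  obtain ⟨L, hL, rfl⟩ := hl
  obtain ⟨φn, h1, h2, h3, h4⟩ := exists_tendsto_of_memH hσ (extend ψ)
  refine ⟨φn, fun n => (h1 n).trans (tsupport_extend ψ), h2, h3, ?_⟩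
  simp only [restrict_apply]
  exact h4 L hL

/-- The pairing tests `l` only on functions admissible in t ≥ 0; the vanishing time window extends
the sign to all of the cylinder. -/
theorem MemHRestr.isNonneg (hσ : 0 < σ) {l : DistOn G} (hl : MemHRestr σ (1 / 2) (-1 / 2) G l)
    (h : ∀ (φ : Test d) (hφ : tsupport φ ⊆ cylinder G), tsupport φ ⊆ {z | 0 < z.fst} →
      (∀ z, 0 ≤ φ z) → 0 ≤ l (ofSubset φ hφ)) : IsNonneg l := fun ψ hψ => by
  obtain ⟨φn, h1, h2, h3, h4⟩ := hl.exists_tendsto hσ ψ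
  exact ge_of_tendsto' h4 fun n => h _ _ (h2 n) (h3 hψ n)

theorem MemHRestr.eq_zero (hσ : 0 < σ) {l : DistOn G} (hl : MemHRestr σ (1 / 2) (-1 / 2) G l)
    (h : ∀ (φ : Test d) (hφ : tsupport φ ⊆ cylinder G), tsupport φ ⊆ {z | 0 < z.fst} →
      l (ofSubset φ hφ) = 0) : l = 0 := by
  ext ψ
  obtain ⟨φn, h1, h2, -, h4⟩ := hl.exists_tendsto hσ ψ
  refine tendsto_nhds_unique h4 ?_
  simp only [h _ _ (h2 _)]
  exact tendsto_const_nhds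

theorem MemHRestr.toDual (hσ : 0 < σ) {l : DistOn G} (hl : MemHRestr σ (1 / 2) (-1 / 2) G l) :
    MemHRestr σ (-1 / 2) (-1 / 2) G l :=
  hl.mono hσ (by norm_num) le_rfl

/-- The value of `l` at a test function, recovered from the pairing. -/
theorem pairing_ofTest_expMul (hσ : 0 < σ) (hG : HasLipschitzBoundary (G : Set (Bdry d)))
    {l : DistOn G} (hl : MemHRestr σ (-1 / 2) (-1 / 2) G l) {φ : Test d}
    (h0 : tsupport φ ⊆ {z | 0 < z.fst}) (hφ : tsupport φ ⊆ cylinder G) :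
    pairing σ G l (ofTest (expMul (2 * σ) φ)) = l (ofSubset φ hφ) := by
  have h0' : tsupport (expMul (2 * σ) φ) ⊆ {z | 0 ≤ z.fst} :=
    (tsupport_expMul _ φ).trans_subset (h0.trans setOf_fst_pos_subset)
  have hφ' : tsupport (expMul (2 * σ) φ) ⊆ cylinder G :=
    (tsupport_expMul _ φ).trans_subset hφ
  rw [pairing_ofTest_right hσ hG hl h0' hφ']
  congr 1
  ext z
  change expMul (-(2 * σ)) (expMul (2 * σ) φ) z = φ z
  rw [expMul_neg_expMul]

theorem memHTilde_ofTest_expMul (hσ : 0 < σ) (s r : ℝ) {φ : Test d}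
    (h0 : tsupport φ ⊆ {z | 0 < z.fst}) (hφ : tsupport φ ⊆ cylinder G) :
    MemHTilde σ s r G (ofTest (expMul (2 * σ) φ)) :=
  memHTilde_ofTest hσ s r
    ((tsupport_expMul _ φ).trans_subset (h0.trans setOf_fst_pos_subset))
    ((tsupport_expMul _ φ).trans_subset hφ)

theorem SolvesVI.solvesMixed {μ : ℝ} (hσ : 0 < σ) (hμ : 0 < μ)
    (hG : HasLipschitzBoundary (G : Set (Bdry d))) {h : DistOn G}
    (hh : MemHRestr σ (1 / 2) (-1 / 2) G h) {u : Dist d} (hu : SolvesVI σ μ G h u) :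
    SolvesMixed σ μ G h u (restrict G (dtn σ μ u) - h) := by
  have hS : MemHRestr σ (1 / 2) (-1 / 2) G (restrict G (dtn σ μ u)) :=
    ⟨_, dtn_spec hσ hμ hu.mem.1, rfl⟩
  have hl := hS.sub hh
  set l := restrict G (dtn σ μ u) - h
  have hle : ∀ v, MemHTilde σ (1 / 2) (1 / 2) G v → IsNonneg v → 0 ≤ pairing σ G l (v - u) :=
    fun v hv hv0 => by
      rw [pairing_sub_left hσ hG (hS.toDual hσ) (hh.toDual hσ) (hv.sub hu.mem)]
      exact sub_nonneg.2 (hu.ineq v hv hv0)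
  -- Perturbing `u` upwards by e^{2σt} φ cancels the weight of the pairing and tests `l` on `φ`
  -- itself.
  have hl0 : IsNonneg l := hl.isNonneg hσ fun φ hφ h0 hφ0 => by
    have h1 := hle (u + ofTest (expMul (2 * σ) φ))
      (hu.mem.add (memHTilde_ofTest_expMul hσ _ _ h0 hφ))
      (isNonneg_add hu.nonneg (isNonneg_ofTest (expMul_nonneg hφ0)))
    rwa [add_sub_cancel_left, pairing_ofTest_expMul hσ hG (hl.toDual hσ) h0 hφ] at h1
  -- Complementarity: v = 2u and v = 0 give opposite inequalities.
  have hlu : pairing σ G l u = 0 := by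
    have h1 := hle (u + u) (hu.mem.add hu.mem) (isNonneg_add hu.nonneg hu.nonneg)
    have h2 := hle (u - u) (hu.mem.sub hu.mem) (isNonneg_sub_self u)
    rw [add_sub_cancel_left] at h1
    rw [pairing_sub_right hσ hG (hl.toDual hσ) (hu.mem.sub hu.mem) hu.mem,
      pairing_sub_right hσ hG (hl.toDual hσ) hu.mem hu.mem] at h2
    linarith
  refine ⟨hu.mem, hl, hl0, fun v hv => ?_, fun m hm hm0 => ?_⟩
  · rw [pairing_sub_left hσ hG (hS.toDual hσ) (hh.toDual hσ) hv]
    ring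
  · rw [pairing_sub_left hσ hG (hm.toDual hσ) (hl.toDual hσ) hu.mem, hlu, sub_zero]
    exact pairing_nonneg hσ hG (hm.toDual hσ) hm0 hu.mem hu.nonneg

theorem SolvesMixed.eq_sub {μ : ℝ} (hσ : 0 < σ) (hμ : 0 < μ)
    (hG : HasLipschitzBoundary (G : Set (Bdry d))) {h : DistOn G}
    (hh : MemHRestr σ (1 / 2) (-1 / 2) G h) {u : Dist d} {l : DistOn G}
    (hu : SolvesMixed σ μ G h u l) : l = restrict G (dtn σ μ u) - h := by
  have hS : MemHRestr σ (1 / 2) (-1 / 2) G (restrict G (dtn σ μ u)) :=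
    ⟨_, dtn_spec hσ hμ hu.mem_fst.1, rfl⟩
  have hl := hu.mem_snd
  have h0 : restrict G (dtn σ μ u) - l - h = 0 :=
    ((hS.sub hl).sub hh).eq_zero hσ fun φ hφ h0 => by
      have hv := memHTilde_ofTest_expMul hσ (1 / 2) (1 / 2) h0 hφ
      rw [← pairing_ofTest_expMul hσ hG (((hS.sub hl).sub hh).toDual hσ) h0 hφ,
        pairing_sub_left hσ hG ((hS.sub hl).toDual hσ) (hh.toDual hσ) hv,
        pairing_sub_left hσ hG (hS.toDual hσ) (hl.toDual hσ) hv, hu.eq _ hv, sub_self]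
  rw [sub_right_comm, sub_eq_zero] at h0
  exact h0.symm

/-- Adding a nonnegative test function to `l` in (b) tests the sign of `u`. Functions in t > 0
suffice because `u` also lies in H^{1/2}(H^{-1/2}). -/
theorem SolvesMixed.isNonneg {μ : ℝ} (hσ : 0 < σ) (hG : HasLipschitzBoundary (G : Set (Bdry d)))
    {h : DistOn G} {u : Dist d} {l : DistOn G} (hu : SolvesMixed σ μ G h u l) : IsNonneg u := by
  intro φ hφ
  obtain ⟨φn, -, h2, h3, h4⟩ := exists_tendsto_of_memH hσ φ
  refine ge_of_tendsto' (h4 u (hu.mem_fst.1.mono hσ le_rfl (by norm_num))) fun n => ?_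
  set η := expMul (2 * σ) (φn n)
  have hη : tsupport η ⊆ {z | 0 ≤ z.fst} :=
    (tsupport_expMul _ (φn n)).trans_subset ((h2 n).trans setOf_fst_pos_subset)
  have hm : MemHRestr σ (1 / 2) (-1 / 2) G (restrict G (ofTest η)) :=
    ⟨_, memH_ofTest hσ _ _ hη, rfl⟩
  have hm0 : IsNonneg (restrict G (ofTest η)) := fun ψ hψ => by
    rw [restrict_apply]
    exact isNonneg_ofTest (expMul_nonneg (h3 hφ n)) _ hψ
  have h5 := hu.ineq (l + restrict G (ofTest η)) (hu.mem_snd.add hm)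
    (isNonneg_add hu.nonneg_snd hm0)
  rwa [add_sub_cancel_left, pairing_restrict_ofTest hσ hG hη hu.mem_fst, expMul_neg_expMul] at h5

theorem SolvesMixed.solvesVI {μ : ℝ} (hσ : 0 < σ) (hμ : 0 < μ)
    (hG : HasLipschitzBoundary (G : Set (Bdry d))) {h : DistOn G} {u : Dist d} {l : DistOn G}
    (hu : SolvesMixed σ μ G h u l) : SolvesVI σ μ G h u := by
  have hl := hu.mem_snd
  have hS : MemHRestr σ (1 / 2) (-1 / 2) G (restrict G (dtn σ μ u)) :=
    ⟨_, dtn_spec hσ hμ hu.mem_fst.1, rfl⟩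
  -- Now (b) at m = 2l and m = 0. By (a) the variational inequality then reduces to ⟨l, v⟩ ≥ 0.
  have hlu : pairing σ G l u = 0 := by
    have h1 := hu.ineq (l + l) (hl.add hl) (isNonneg_add hu.nonneg_snd hu.nonneg_snd)
    have h2 := hu.ineq (l - l) (hl.sub hl) (isNonneg_sub_self l)
    rw [add_sub_cancel_left] at h1
    rw [pairing_sub_left hσ hG ((hl.sub hl).toDual hσ) (hl.toDual hσ) hu.mem_fst,
      pairing_sub_left hσ hG (hl.toDual hσ) (hl.toDual hσ) hu.mem_fst] at h2
    linarith
  refine ⟨hu.mem_fst, hu.isNonneg hσ hG, fun v hv hv0 => ?_⟩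
  have h1 := hu.eq (v - u) (hv.sub hu.mem_fst)
  rw [pairing_sub_right hσ hG (hl.toDual hσ) hv hu.mem_fst, hlu] at h1
  have h2 := pairing_nonneg hσ hG (hl.toDual hσ) hu.nonneg_snd hv hv0
  linarith

end

end WaveContact

end

/-! ### The equivalence -/

theorem theorem6p1 {d : ℕ} (hd : 1 ≤ d) {σ μ : ℝ} (hσ : 0 < σ) (hμ : 0 < μ)
    (G : Opens (WaveContact.Bdry d)) (hG_bdd : Bornology.IsBounded (G : Set (WaveContact.Bdry d)))
    (hG_lip : WaveContact.HasLipschitzBoundary (G : Set (WaveContact.Bdry d)))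
    (h : WaveContact.DistOn G) (hh : WaveContact.MemHRestr σ (3 / 2) (-1 / 2) G h) :
    (∀ u : WaveContact.Dist d,
      WaveContact.SolvesVI σ μ G h u ↔ ∃ l : WaveContact.DistOn G,
        WaveContact.SolvesMixed σ μ G h u l) ∧
    (∀ (u : WaveContact.Dist d) (l : WaveContact.DistOn G),
      WaveContact.SolvesMixed σ μ G h u l →
        l = WaveContact.restrict G (WaveContact.dtn σ μ u) - h) := by
  have hh' : WaveContact.MemHRestr σ (1 / 2) (-1 / 2) G h := hh.mono hσ (by norm_num) le_rfl
  exact ⟨fun u => ⟨fun hu => ⟨_, hu.solvesMixed hσ hμ hG_lip hh'⟩,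
    fun ⟨_, hu⟩ => hu.solvesVI hσ hμ hG_lip⟩,
    fun _ _ hu => hu.eq_sub hσ hμ hG_lip hh'⟩
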